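/- **Theorem (per-step bound for the Newton–Stein method, sub-gaussian covariates).** *Setting.* Let $x_1,\dots,x_n$ be i.i.d. random vectors in $\mathbb R^p$ with $\mathbb E[x_i]=0$, $\mathbb E[x_ix_i^T]=\Sigma$ and sub-gaussian norm $\sup_{\|v\|_2=1}\sup_{m\ge1} m^{-1/2}\,\mathbb E[|\langle x_i,v\rangle|^m]^{1/m}\le K$. Assume that $\Sigma$ is $r$-spiked, $r<p$: $\Sigma=\sigma^2I+\sum_{i=1}^r\theta_iu_iu_i^T$ with $\sigma>0$, $\theta_i\ge0$ and $u_1,\dots,u_r$ orthonormal. Let $y_1,\dots,y_n$ be arbitrary real random variables, let $\phi:\mathbb R\to\mathbb R$ be $C^5$ with bounded derivatives of orders $2$ to $5$ and $\phi^{(2)}>0$ (as holds for the cumulant generating function of any non-degenerate exponential family with these bounds), and let $\ell(\beta)=\frac1n\sum_{i=1}^n[\phi(\langle x_i,\beta\rangle)-y_i\langle x_i,\beta\rangle]$. Let $S\subset[n]$ be a random set of fixed size $|S|$ that is independent of $(x_1,\dots,x_n)$ (for instance uniformly distributed), and $\widehat\Sigma_S=\frac1{|S|}\sum_{i\in S}x_ix_i^T$.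 For a symmetric matrix $A$ let $\zeta_r(A)$ be obtained from $A$ by keeping the eigenvectors and the $r$ largest eigenvalues and replacing all other eigenvalues by the $(r+1)$-st largest one. Write $\mu_j(\beta)=\mathbb E[\phi^{(j)}(\langle x,\beta\rangle)]$, where $x$ is distributed as $x_1$, and $\hat\mu_j(\beta)=\frac1n\sum_i\phi^{(j)}(\langle x_i,\beta\rangle)$, for $j=2,4$. *Iteration.* Let $R>0$, let $\mathcal P_R$ be the Euclidean projection onto the closed ball $B_p(R)$ of radius $R$ centred at $0$, let $\hat\beta^0$ be any random vector, and (step size $1$) let $$\hat\beta^{t+1}=\mathcal P_R\big(\hat\beta^t-\mathbf Q^t\nabla\ell(\hat\beta^t)\big),\qquad \mathbf Q^t=\frac1{\hat\mu_2(\hat\beta^t)}\Big[\zeta_r(\widehat\Sigma_S)^{-1}-\frac{\hat\mu_4(\hat\beta^t)\,\hat\beta^t(\hat\beta^t)^T}{\hat\mu_2(\hat\beta^t)+\hat\mu_4(\hat\beta^t)\langle\zeta_r(\widehat\Sigma_S)\hat\beta^t,\hat\beta^t\rangle}\Big].$$ For a random vector $\beta_*$, a constant $\xi>0$ and $t\ge1$,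 let $\mathcal E$ be the event that $|\mu_2(\hat\beta^t)+\mu_4(\hat\beta^t)\langle\Sigma\hat\beta^t,\hat\beta^t\rangle|>\xi$ and that $\beta_*$ is a minimizer of $\ell$ over $\mathbb R^p$ with $\|\beta_*\|_2\le R$. *Discrepancy.* Let $z\sim N(0,\Sigma)$ and $$\mathfrak D(x,z)=\|\Sigma\|_2\,d_{\mathcal H_1}(x,z)+\|\Sigma\|_2^2R^2\,d_{\mathcal H_2}(x,z)+d_{\mathcal H_3}(x,z),\qquad d_{\mathcal H}(x,z)=\sup_{h\in\mathcal H}|\mathbb E h(x)-\mathbb E h(z)|,$$ where $\mathcal H_1,\mathcal H_2,\mathcal H_3$ consist of the functions $u\mapsto\phi^{(2)}(\langle u,\beta\rangle)$, $u\mapsto\phi^{(4)}(\langle u,\beta\rangle)$ and $u\mapsto\langle v,u\rangle^2\phi^{(2)}(\langle u,\beta\rangle)$, respectively, with $\|\beta\|_2\le R$ and $\|v\|_2=1$. *Claim.* Let $K,\sigma,R,\xi,q>0$, let $B_2,B_4$ be real numbers, and let $b:\mathbb R\to(0,\infty)$ be continuous. There are positive constants $c_1,c_2,c_3,c_4,\kappa$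 depending only on these data such that for all $B$ and all $a>0$ there are $p_0,n_0\in\mathbb N$ and $s_0>0$ (depending on the data, $B$ and $a$) with the following property. If $p\ge p_0$, $n\ge n_0$, $|S|\ge s_0\,p$ and $n^{0.2}/\log n\ge a\,p$, then in the above setting with $b\le\phi^{(2)}$, $|\phi^{(2)}|\le B_2$, $|\phi^{(4)}|\le B_4$, $|\phi^{(3)}|\le B$, $|\phi^{(5)}|\le B$, and for every $t\ge1$ with $\mathbb P(\mathcal E)\ge q$, conditionally on $\mathcal E$, with probability at least $1-c_1e^{-c_2p}$, $$\|\hat\beta^{t+1}-\beta_*\|_2\le\kappa\Big\{\mathfrak D(x,z)+c_3\sqrt{\frac p{\min\{|S|,\,n^{0.2}/\log n\}}}+c_4\,p^{1.5}\,\|\hat\beta^t-\beta_*\|_2\Big\}\|\hat\beta^t-\beta_*\|_2 .$$ -/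

import Mathlib

open MeasureTheory ProbabilityTheory Matrix
open scoped ENNReal RealInnerProductSpace

noncomputable section

namespace NewtonStein

/-- `ℝᵖ` with the Euclidean norm. -/
abbrev Vec (p : ℕ) : Type := EuclideanSpace ℝ (Fin p)

/-- Real `p × p` matrices. -/
abbrev Mat (p : ℕ) : Type := Matrix (Fin p) (Fin p) ℝ

/-! ### Distributional notions -/

/-- The sub-gaussian norm `‖f‖_{ψ₂}` of a real random variable: the smallest `K ∈ [0, ∞]` with
`E[|f|^m]^{1/m} ≤ K √m` for all real `m ≥ 1`. -/
def psiTwoNorm {Ω : Type*} [MeasurableSpace Ω] (f : Ω → ℝ) (P : Measure Ω) : ℝ≥0∞ :=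
  ⨆ m : {m : ℝ // 1 ≤ m}, eLpNorm f (ENNReal.ofReal m) P / ENNReal.ofReal (Real.sqrt m)

/-- The sub-gaussian norm `sup_{‖v‖ = 1} ‖⟨x, v⟩‖_{ψ₂}` of a random vector `x` with law `ν`. -/
def subGaussianNorm {p : ℕ} (ν : Measure (Vec p)) : ℝ≥0∞ :=
  ⨆ v : Metric.sphere (0 : Vec p) 1, psiTwoNorm (fun x => ⟪x, (v : Vec p)⟫) ν

/-- The matrix `E[x xᵀ]` of a random vector `x` with law `ν`. -/
def secondMoment {p : ℕ} (ν : Measure (Vec p)) : Mat p :=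
  Matrix.of fun i j => ∫ x, x i * x j ∂ν

/-- The `r`-spiked model `A = σ² I + ∑_{i ≤ r} θ_i u_i u_iᵀ`,
with orthonormal `u_i` and `θ_i ≥ 0`. -/
def IsSpiked {p : ℕ} (r : ℕ) (σ : ℝ) (A : Mat p) : Prop :=
  ∃ (θ : Fin r → ℝ) (u : Fin r → Vec p), (∀ i, 0 ≤ θ i) ∧ Orthonormal ℝ u ∧
    A = σ ^ 2 • (1 : Mat p) + ∑ i, θ i • vecMulVec (u i) (u i)

/-- The spectral norm of a matrix. -/
def specNorm {p : ℕ} (A : Mat p) : ℝ := ‖Matrix.toEuclideanCLM (𝕜 := ℝ) A‖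

/-- `d_H(x, z) = sup_{h ∈ H} |E h(x) - E h(z)|` for random vectors `x`, `z` with laws `ν`, `γ`. -/
def probDist {p : ℕ} (H : Set (Vec p → ℝ)) (ν γ : Measure (Vec p)) : ℝ :=
  ⨆ h : H, |(∫ x, (h : Vec p → ℝ) x ∂ν) - ∫ z, (h : Vec p → ℝ) z ∂γ|

/-- `{x ↦ φ⁽²⁾(⟨x, β⟩) : ‖β‖ ≤ R}` -/
def classOne (φ : ℝ → ℝ) (p : ℕ) (R : ℝ) : Set (Vec p → ℝ) :=
  {h | ∃ β : Vec p, ‖β‖ ≤ R ∧ h = fun x => iteratedDeriv 2 φ ⟪x, β⟫}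

/-- `{x ↦ φ⁽⁴⁾(⟨x, β⟩) : ‖β‖ ≤ R}` -/
def classTwo (φ : ℝ → ℝ) (p : ℕ) (R : ℝ) : Set (Vec p → ℝ) :=
  {h | ∃ β : Vec p, ‖β‖ ≤ R ∧ h = fun x => iteratedDeriv 4 φ ⟪x, β⟫}

/-- `{x ↦ ⟨v, x⟩² φ⁽²⁾(⟨x, β⟩) : ‖β‖ ≤ R, ‖v‖ = 1}` -/
def classThree (φ : ℝ → ℝ) (p : ℕ) (R : ℝ) : Set (Vec p → ℝ) :=
  {h | ∃ β v : Vec p, ‖β‖ ≤ R ∧ ‖v‖ = 1 ∧ h = fun x => ⟪v, x⟫ ^ 2 * iteratedDeriv 2 φ ⟪x, β⟫}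

/-- The discrepancy `𝔇(x, z)` between a centred `x` with law `ν` and a Gaussian vector `z` with the
same mean and covariance. -/
def gaussDiscrepancy {p : ℕ} (φ : ℝ → ℝ) (R : ℝ) (ν : Measure (Vec p)) : ℝ :=
  let A := secondMoment ν
  let γ := multivariateGaussian (0 : Vec p) A
  specNorm A * probDist (classOne φ p R) ν γ
    + specNorm A ^ 2 * R ^ 2 * probDist (classTwo φ p R) ν γ
    + probDist (classThree φ p R) ν γ

/-- `E[φ⁽ʲ⁾(⟨x, β⟩)]` for `x` with law `ν`; for `j = 2, 4` these are `μ₂(β)` and `μ₄(β)`. -/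
def muPop {p : ℕ} (φ : ℝ → ℝ) (ν : Measure (Vec p)) (j : ℕ) (β : Vec p) : ℝ :=
  ∫ x, iteratedDeriv j φ ⟪x, β⟫ ∂ν

/-! ### The algorithm, for a fixed data set `(x_i, y_i)`, `i < n` -/

/-- The negative log-likelihood `ℓ(β) = n⁻¹ ∑_i [φ(⟨x_i, β⟩) - y_i ⟨x_i, β⟩]`. -/
def negLogLik {n p : ℕ} (φ : ℝ → ℝ) (X : Fin n → Vec p) (y : Fin n → ℝ) (β : Vec p) : ℝ :=
  (n : ℝ)⁻¹ * ∑ i, (φ ⟪X i, β⟫ - y i * ⟪X i, β⟫)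

/-- The sample means `n⁻¹ ∑_i φ⁽ʲ⁾(⟨x_i, β⟩)`. -/
def muHat {n p : ℕ} (φ : ℝ → ℝ) (X : Fin n → Vec p) (j : ℕ) (β : Vec p) : ℝ :=
  (n : ℝ)⁻¹ * ∑ i, iteratedDeriv j φ ⟪X i, β⟫

/-- The sub-sampled covariance estimator `|S|⁻¹ ∑_{i ∈ S} x_i x_iᵀ`. -/
def sampleCov {n p : ℕ} (X : Fin n → Vec p) (S : Finset (Fin n)) : Mat p :=
  (S.card : ℝ)⁻¹ • ∑ i ∈ S, vecMulVec (X i) (X i)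

lemma isHermitian_sampleCov {n p : ℕ} (X : Fin n → Vec p) (S : Finset (Fin n)) :
    (sampleCov X S).IsHermitian := by
  ext i j
  simp [sampleCov, Matrix.sum_apply, vecMulVec_apply, mul_comm]

/-- The `(r+1)`-st largest eigenvalue `λ_{r+1}` of a symmetric matrix, where `r < p`
(`eigenvalues₀` lists the eigenvalues in decreasing order, starting with index `0`). -/
def eigSucc {p : ℕ} {A : Mat p} (hA : A.IsHermitian) (r : Fin p) : ℝ :=
  hA.eigenvalues₀ (Fin.cast (Fintype.card_fin p).symm r)

/-- Eigenvalue thresholding `ζ_r`: the eigenvectors and the `r` largest eigenvalues are kept, and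
all other eigenvalues are set to `λ_{r+1}`, i.e. every eigenvalue `λ` becomes `max λ λ_{r+1}`. -/
def eigThreshold {p : ℕ} {A : Mat p} (hA : A.IsHermitian) (r : Fin p) : Mat p :=
  ∑ i, max (hA.eigenvalues i) (eigSucc hA r) •
    vecMulVec (hA.eigenvectorBasis i) (hA.eigenvectorBasis i)

/-- `Q = m₂⁻¹ [Z⁻¹ - m₄ β βᵀ / (m₂ + m₄ ⟨Zβ, β⟩)]`. For `m₄ ≠ 0` the last term is
`β βᵀ / (m₂ / m₄ + ⟨Zβ, β⟩)`; written this way it also has the right meaning for `m₄ = 0`. -/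
def scaling {p : ℕ} (m₂ m₄ : ℝ) (Z : Mat p) (β : Vec p) : Mat p :=
  m₂⁻¹ • (Z⁻¹ - (m₄ / (m₂ + m₄ * ⟪Matrix.toEuclideanCLM (𝕜 := ℝ) Z β, β⟫)) • vecMulVec β β)

/-- The Euclidean projection onto the closed ball of radius `R` centred at `0`. -/
def projBall {p : ℕ} (R : ℝ) (v : Vec p) : Vec p :=
  if ‖v‖ ≤ R then v else (R / ‖v‖) • v

/-- One step of the Newton-Stein method with step size `γ = 1`. -/
def step {n p : ℕ} (φ : ℝ → ℝ) (R : ℝ) (r : Fin p) (X : Fin n → Vec p) (y : Fin n → ℝ)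
    (S : Finset (Fin n)) (β : Vec p) : Vec p :=
  let Z := eigThreshold (isHermitian_sampleCov X S) r
  let Q := scaling (muHat φ X 2 β) (muHat φ X 4 β) Z β
  projBall R (β - Matrix.toEuclideanCLM (𝕜 := ℝ) Q (gradient (negLogLik φ X y) β))

/-- The iterates `β̂⁰, β̂¹, β̂², …` of the Newton-Stein method. -/
def iter {n p : ℕ} (φ : ℝ → ℝ) (R : ℝ) (r : Fin p) (X : Fin n → Vec p) (y : Fin n → ℝ)
    (S : Finset (Fin n)) (β₀ : Vec p) : ℕ → Vec p
  | 0 => β₀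
  | t + 1 => step φ R r X y S (iter φ R r X y S β₀ t)

/-- The condition defining the event `𝓔` for an iterate `β` and an optimal value `βs`:
`|μ₂(β) + μ₄(β) ⟨Σβ, β⟩| > ξ`, and `βs` is a minimizer of `ℓ` over `ℝᵖ` that lies in the ball of
radius `R`. -/
def GoodIterate {n p : ℕ} (φ : ℝ → ℝ) (R ξ : ℝ) (ν : Measure (Vec p)) (X : Fin n → Vec p)
    (y : Fin n → ℝ) (βs β : Vec p) : Prop :=
  ξ < |muPop φ ν 2 β
        + muPop φ ν 4 β * ⟪Matrix.toEuclideanCLM (𝕜 := ℝ) (secondMoment ν) β, β⟫| ∧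
    IsMinOn (negLogLik φ X y) Set.univ βs ∧ ‖βs‖ ≤ R

end NewtonStein

end

noncomputable section

namespace NewtonStein

/-! ### Symmetric operators and nets -/

/-! Write β for the current iterate, β* for the minimizer, d = β - β*, and Z for the thresholded
covariance. By Sherman–Morrison (`scaling_apply_rankOne`) the scaling Q is the exact inverse of M =
μ̂₂ Z + μ̂₄ (Zβ)(Zβ)ᵀ. Projecting does not increase the distance to β*, so the new error is at most
‖Q(Md - ∇ℓ(β))‖. Since ∇ℓ(β*) = 0, a Taylor expansion of φ' at β turns Md - ∇ℓ(β) into (M - ∇²ℓ(β))d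
plus a quadratic remainder governed by a third empirical moment. This is the deterministic estimate
`norm_step_sub_le`; it asks for bounds on ‖Q‖, on ‖M - ∇²ℓ(β)‖ and on that moment.

M approximates the Hessian because of Stein's identity: for z ~ N(0, Σ), E[z zᵀ φ''(⟨z, β⟩)] equals
E[φ''] Σ + E[φ⁗] Σβ(Σβ)ᵀ. Replacing z by x costs exactly the discrepancy (`abs_stein_sub_le`); the
rest is sampling error. For ‖Q‖, thresholding is stable at spiked matrices
(`norm_eigThreshold_sub_le`), so Z stays above σ²/2; μ₂ is bounded below because ⟨x, β⟩ is mostly in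
a bounded interval (`le_muPop_two`); and the denominator is kept away from 0 by ξ.

The iterate depends on all the data, so the sampling errors are bounded uniformly over ‖β‖ ≤ R
(`GoodSample`). Bernstein's inequality is applied on nets; moving off the net only requires the
fourth empirical moment of ‖x‖. Fourth powers of sub-gaussian variables need not have exponential
moments, so that one is treated by truncation (`fourth_moment_coord`). With N = n^0.2, hence n = N⁵,
truncating at N⁴ gives failure probability of order e^{-N}, and a p log n ≤ N turns this into
e^{-p}. The uniform error 1/N is below √(p log n / N), the second part of the stated rate.

The constants do not involve B or a: these enter only through the thresholds on p and n. In
particular the third moment contributes B T p with T depending on K alone, and B T ≤ √p for large p;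
this produces p^{1.5} with constant one. -/

lemma toEuclideanCLM_vecMulVec {p : ℕ} (u w v : Vec p) :
    toEuclideanCLM (𝕜 := ℝ) (vecMulVec u w) v = ⟪w, v⟫ • u := by
  ext i
  simp [vecMulVec_mulVec, PiLp.inner_apply, dotProduct, mul_comm]

lemma inner_toEuclideanCLM_comm {p : ℕ} {A : Mat p} (hA : A.IsHermitian) (u v : Vec p) :
    ⟪toEuclideanCLM (𝕜 := ℝ) A u, v⟫ = ⟪u, toEuclideanCLM (𝕜 := ℝ) A v⟫ := by
  rw [real_inner_comm, inner_toEuclideanCLM, inner_toEuclideanCLM, dotProduct_mulVec,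
    ← mulVec_transpose, dotProduct_comm]
  have : Aᵀ = A := by rwa [IsHermitian, conjTranspose_eq_transpose_of_trivial] at hA
  rw [this]

section Symmetric

variable {E : Type*} [NormedAddCommGroup E] [InnerProductSpace ℝ E]

/-- The norm of a symmetric operator is bounded by its quadratic form. -/
lemma opNorm_le_of_quadratic {T : E →L[ℝ] E} (hT : ∀ u v, ⟪T u, v⟫ = ⟪u, T v⟫) {c : ℝ}
    (hc : 0 ≤ c) (h : ∀ v, |⟪T v, v⟫| ≤ c * ‖v‖ ^ 2) : ‖T‖ ≤ c := by
  -- Polarization: 4⟪T u, v⟫ is the difference of the quadratic form at u + v and at u - v, and the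
  -- parallelogram law adds up the two bounds.
  have key : ∀ u v : E, ⟪T u, v⟫ ≤ c * (‖u‖ ^ 2 + ‖v‖ ^ 2) / 2 := by
    intro u v
    have h1 := (abs_le.1 (h (u + v))).2
    have h2 := (abs_le.1 (h (u - v))).1
    have h3 : ⟪T v, u⟫ = ⟪T u, v⟫ := by rw [hT v u, real_inner_comm]
    have h4 := parallelogram_law_with_norm ℝ u v
    simp only [map_add, map_sub, inner_add_left, inner_add_right, inner_sub_left,
      inner_sub_right] at h1 h2
    nlinarith
  refine T.opNorm_le_bound hc fun u => ?_
  by_cases hu : u = 0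
  · simp [hu]
  by_cases hTu : T u = 0
  · rw [hTu, norm_zero]; positivity
  have hu' : 0 < ‖u‖ := norm_pos_iff.2 hu
  have hTu' : 0 < ‖T u‖ := norm_pos_iff.2 hTu
  -- Rescaling T u to the norm of u makes the right side c‖u‖², while the left side is ‖u‖‖T u‖.
  have := key u ((‖u‖ / ‖T u‖) • T u)
  rw [inner_smul_right, real_inner_self_eq_norm_sq, norm_smul, Real.norm_of_nonneg (by positivity),
    div_mul_cancel₀ _ hTu'.ne'] at this
  have h5 : ‖u‖ / ‖T u‖ * ‖T u‖ ^ 2 = ‖u‖ * ‖T u‖ := by field_simp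
  rw [h5] at this
  nlinarith

lemma opNorm_le_of_unit {T : E →L[ℝ] E} (hT : ∀ u v, ⟪T u, v⟫ = ⟪u, T v⟫) {c : ℝ}
    (hc : 0 ≤ c) (h : ∀ v, ‖v‖ = 1 → |⟪T v, v⟫| ≤ c) : ‖T‖ ≤ c := by
  refine opNorm_le_of_quadratic hT hc fun v => ?_
  by_cases hv : v = 0
  · simp [hv]
  have hv' : 0 < ‖v‖ := norm_pos_iff.2 hv
  have := h (‖v‖⁻¹ • v) (by rw [norm_smul, norm_inv, norm_norm, inv_mul_cancel₀ hv'.ne'])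
  rw [map_smul, inner_smul_left, inner_smul_right, abs_mul, abs_mul] at this
  simp only [conj_trivial, abs_inv, abs_norm] at this
  rw [← mul_assoc, ← mul_inv, inv_mul_le_iff₀ (by positivity)] at this
  linarith [this, sq ‖v‖]

/-- The norm of a symmetric operator is controlled by its quadratic form on a net. -/
lemma opNorm_le_of_net {T : E →L[ℝ] E} (hT : ∀ u v, ⟪T u, v⟫ = ⟪u, T v⟫) {t : ℝ} (ht : 0 ≤ t)
    {N : Set E} (hN1 : ∀ w ∈ N, ‖w‖ ≤ 1) (hN : ∀ v : E, ‖v‖ ≤ 1 → ∃ w ∈ N, ‖v - w‖ ≤ 1 / 4)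
    (h : ∀ w ∈ N, |⟪T w, w⟫| ≤ t) : ‖T‖ ≤ 2 * t := by
  -- Replacing v by a net point in each of the two slots costs at most ‖T‖/4; the total ‖T‖/2 is
  -- absorbed on the left.
  suffices ‖T‖ ≤ t + ‖T‖ / 2 by linarith
  refine opNorm_le_of_unit hT (by positivity) fun v hv' => ?_
  have hv := hv'.le
  obtain ⟨w, hw, hvw⟩ := hN v hv
  have e : ⟪T v, v⟫ = ⟪T w, w⟫ + ⟪T (v - w), v⟫ + ⟪T w, v - w⟫ := by
    simp only [map_sub, inner_sub_left, inner_sub_right]; ring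
  have b1 : |⟪T (v - w), v⟫| ≤ ‖T‖ / 4 := by
    refine (abs_real_inner_le_norm _ _).trans ?_
    calc ‖T (v - w)‖ * ‖v‖ ≤ (‖T‖ * (1 / 4)) * 1 := by
          gcongr
          exact (T.le_opNorm _).trans (by gcongr)
      _ = ‖T‖ / 4 := by ring
  have b2 : |⟪T w, v - w⟫| ≤ ‖T‖ / 4 := by
    refine (abs_real_inner_le_norm _ _).trans ?_
    calc ‖T w‖ * ‖v - w‖ ≤ (‖T‖ * 1) * (1 / 4) := by
          gcongr
          exact (T.le_opNorm _).trans (by gcongr; exact hN1 w hw)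
      _ = ‖T‖ / 4 := by ring
  rw [e]
  linarith [abs_add_three ⟪T w, w⟫ ⟪T (v - w), v⟫ ⟪T w, v - w⟫, h w hw]

lemma abs_quadratic_le (T : E →L[ℝ] E) (v : E) : |⟪T v, v⟫| ≤ ‖T‖ * ‖v‖ ^ 2 := by
  refine (abs_real_inner_le_norm _ _).trans ?_
  rw [sq, ← mul_assoc]
  gcongr
  exact T.le_opNorm v

end Symmetric

/-- Volume comparison: the balls of radius δ/2 around the points are disjoint and lie in the ball of
radius R + δ/2. -/
lemma card_le_of_separated {p : ℕ} {R δ : ℝ} (hδ : 0 < δ) (hR : 0 ≤ R) (s : Finset (Vec p))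
    (hs : ∀ c ∈ s, ‖c‖ ≤ R) (h : ∀ c ∈ s, ∀ d ∈ s, c ≠ d → δ ≤ ‖c - d‖) :
    (s.card : ℝ) ≤ (1 + 2 * R / δ) ^ p := by
  let μ : Measure (Vec p) := volume
  have hdis : Set.Pairwise (s : Set (Vec p))
      (Function.onFun Disjoint fun c => Metric.ball c (δ / 2)) := by
    rintro c hc d hd hcd
    apply Metric.ball_disjoint_ball
    rw [dist_eq_norm]
    linarith [h c hc d hd hcd]
  have hsub : (⋃ c ∈ s, Metric.ball c (δ / 2)) ⊆ Metric.ball 0 (R + δ / 2) := by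
    refine Set.iUnion₂_subset fun x hx => Metric.ball_subset_ball' ?_
    rw [dist_zero_right]
    linarith [hs x hx]
  have hρ : 0 < R + δ / 2 := by linarith
  have I : (s.card : ℝ≥0∞) * ENNReal.ofReal ((δ / 2) ^ p) * μ (Metric.ball 0 1) ≤
      ENNReal.ofReal ((R + δ / 2) ^ p) * μ (Metric.ball 0 1) := by
    have := measure_mono (μ := μ) hsub
    rw [measure_biUnion_finset hdis fun c _ => measurableSet_ball] at this
    simp only [μ.addHaar_ball_of_pos _ (half_pos hδ), μ.addHaar_ball_of_pos _ hρ] at this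
    simpa [Finset.sum_const, nsmul_eq_mul, mul_assoc] using this
  have J := (ENNReal.mul_le_mul_iff_left (Metric.measure_ball_pos μ _ zero_lt_one).ne'
    measure_ball_lt_top.ne).1 I
  have K := ENNReal.toReal_le_of_le_ofReal (by positivity) J
  rw [ENNReal.toReal_mul, ENNReal.toReal_natCast, ENNReal.toReal_ofReal (by positivity)] at K
  have e : (1 + 2 * R / δ) ^ p = (R + δ / 2) ^ p / (δ / 2) ^ p := by
    rw [← div_pow]; congr 1; field_simp; ring
  rw [e, le_div_iff₀ (by positivity)]
  exact K

/-- Volumetric bound for the size of a net of a Euclidean ball. -/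
lemma exists_net (p : ℕ) {R δ : ℝ} (hδ : 0 < δ) (hR : 0 ≤ R) :
    ∃ N : Finset (Vec p), (∀ w ∈ N, ‖w‖ ≤ R) ∧ (∀ v : Vec p, ‖v‖ ≤ R → ∃ w ∈ N, ‖v - w‖ ≤ δ) ∧
      (N.card : ℝ) ≤ (1 + 2 * R / δ) ^ p := by
  classical
  let Q : Finset (Vec p) → Prop := fun s =>
    (∀ c ∈ s, ‖c‖ ≤ R) ∧ ∀ c ∈ s, ∀ d ∈ s, c ≠ d → δ ≤ ‖c - d‖
  have hb : ∀ s, Q s → s.card ≤ ⌊(1 + 2 * R / δ) ^ p⌋₊ := fun s hs =>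
    Nat.le_floor (card_le_of_separated hδ hR s hs.1 hs.2)
  -- A δ-separated set of maximal cardinality is a δ-net, since a point farther than δ from all of
  -- it could be added.
  obtain ⟨k, ⟨N, hN, rfl⟩, hmax⟩ : ∃ k, (∃ s, Q s ∧ s.card = k) ∧
      ∀ s, Q s → s.card ≤ k := by
    have hne : ({k | ∃ s, Q s ∧ s.card = k} : Set ℕ).Nonempty := ⟨0, ∅, by simp [Q], rfl⟩
    have hbd : BddAbove ({k | ∃ s, Q s ∧ s.card = k} : Set ℕ) :=
      ⟨_, by rintro k ⟨s, hs, rfl⟩; exact hb s hs⟩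
    exact ⟨_, Nat.sSup_mem hne hbd, fun s hs => le_csSup hbd ⟨s, hs, rfl⟩⟩
  refine ⟨N, hN.1, fun v hv => ?_, card_le_of_separated hδ hR N hN.1 hN.2⟩
  by_contra! hcon
  have hvN : v ∉ N := fun hmem => by
    have := hcon v hmem
    simp at this
    linarith
  have hQ : Q (insert v N) := by
    refine ⟨?_, ?_⟩
    · intro c hc
      rcases Finset.mem_insert.1 hc with rfl | hc
      exacts [hv, hN.1 c hc]
    · intro c hc d hd hcd
      rcases Finset.mem_insert.1 hc with hc' | hc' <;> rcases Finset.mem_insert.1 hd with hd' | hd'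
      · exact absurd (hc'.trans hd'.symm) hcd
      · rw [hc']; exact (hcon d hd').le
      · rw [hd', norm_sub_rev]; exact (hcon c hc').le
      · exact hN.2 c hc' d hd' hcd
  have := hmax _ hQ
  rw [Finset.card_insert_of_notMem hvN] at this
  omega

/-! ### Eigenvalue thresholding -/

lemma toEuclideanCLM_eigenvectorBasis {p : ℕ} {A : Mat p} (hA : A.IsHermitian) (i : Fin p) :
    toEuclideanCLM (𝕜 := ℝ) A (hA.eigenvectorBasis i)
      = hA.eigenvalues i • hA.eigenvectorBasis i := by
  ext j
  have := congrFun (hA.mulVec_eigenvectorBasis i) j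
  simpa using this

lemma toEuclideanCLM_eq_sum_eigen {p : ℕ} {A : Mat p} (hA : A.IsHermitian) (v : Vec p) :
    toEuclideanCLM (𝕜 := ℝ) A v
      = ∑ i, (hA.eigenvalues i * ⟪hA.eigenvectorBasis i, v⟫) • hA.eigenvectorBasis i := by
  conv_lhs => rw [← hA.eigenvectorBasis.sum_repr' v, map_sum]
  refine Finset.sum_congr rfl fun i _ => ?_
  rw [map_smul, toEuclideanCLM_eigenvectorBasis, smul_smul, mul_comm]

lemma toEuclideanCLM_eigThreshold {p : ℕ} {A : Mat p} (hA : A.IsHermitian) (r : Fin p)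
    (v : Vec p) :
    toEuclideanCLM (𝕜 := ℝ) (eigThreshold hA r) v
      = ∑ i, (max (hA.eigenvalues i) (eigSucc hA r) * ⟪hA.eigenvectorBasis i, v⟫) •
          hA.eigenvectorBasis i := by
  simp only [eigThreshold, map_sum, map_smul, _root_.sum_apply,
    _root_.smul_apply, toEuclideanCLM_vecMulVec, smul_smul]

lemma isHermitian_eigThreshold {p : ℕ} {A : Mat p} (hA : A.IsHermitian) (r : Fin p) :
    (eigThreshold hA r).IsHermitian := by
  ext i j
  simp [eigThreshold, Matrix.sum_apply, vecMulVec_apply, mul_comm]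

lemma quadratic_spiked {p r : ℕ} {σ : ℝ} {A : Mat p} {θ : Fin r → ℝ} {u : Fin r → Vec p}
    (hA : A = σ ^ 2 • (1 : Mat p) + ∑ i, θ i • vecMulVec (u i) (u i)) (v : Vec p) :
    ⟪toEuclideanCLM (𝕜 := ℝ) A v, v⟫ = σ ^ 2 * ‖v‖ ^ 2 + ∑ i, θ i * ⟪u i, v⟫ ^ 2 := by
  subst hA
  simp only [map_add, map_smul, map_one, map_sum, _root_.add_apply,
    _root_.smul_apply, _root_.sum_apply, toEuclideanCLM_vecMulVec,
    inner_add_left, inner_smul_left, sum_inner, one_apply_eq_self,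
    real_inner_self_eq_norm_sq, conj_trivial]
  congr 1
  refine Finset.sum_congr rfl fun i _ => by ring

lemma isHermitian_of_spiked {p r : ℕ} {σ : ℝ} {A : Mat p} (hA : IsSpiked r σ A) :
    A.IsHermitian := by
  obtain ⟨θ, u, -, -, rfl⟩ := hA
  ext i j
  simp [Matrix.sum_apply, vecMulVec_apply, Matrix.one_apply, mul_comm, eq_comm]

lemma le_quadratic_of_spiked {p r : ℕ} {σ : ℝ} {A : Mat p} (hA : IsSpiked r σ A) (v : Vec p) :
    σ ^ 2 * ‖v‖ ^ 2 ≤ ⟪toEuclideanCLM (𝕜 := ℝ) A v, v⟫ := by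
  obtain ⟨θ, u, hθ, -, h⟩ := hA
  rw [quadratic_spiked h]
  have : 0 ≤ ∑ i, θ i * ⟪u i, v⟫ ^ 2 :=
    Finset.sum_nonneg fun i _ => mul_nonneg (hθ i) (sq_nonneg _)
  linarith

/-- Weyl's inequality for the `(r+1)`-st eigenvalue, for perturbations of a spiked matrix. -/
lemma eigSucc_le {p : ℕ} {σ δ : ℝ} {A S : Mat p} (hA : A.IsHermitian) (r : Fin p)
    (hS : IsSpiked (r : ℕ) σ S)
    (hδ : ‖toEuclideanCLM (𝕜 := ℝ) A - toEuclideanCLM (𝕜 := ℝ) S‖ ≤ δ) :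
    eigSucc hA r ≤ σ ^ 2 + δ := by
  obtain ⟨θ, u, hθ, -, hSeq⟩ := hS
  -- The indices of the r + 1 largest eigenvalues; `eigenvalues` is the sorted list `eigenvalues₀`
  -- reindexed along this equivalence.
  let e : Fin (r + 1) → Fin p := fun k =>
    (Fintype.equivOfCardEq (Fintype.card_fin _)) (Fin.cast (Fintype.card_fin p).symm
      (Fin.castLE r.2 k))
  have he : Function.Injective e := fun a b hab => by
    simpa [e] using hab
  have hev : ∀ k, eigSucc hA r ≤ hA.eigenvalues (e k) := fun k => by
    simp only [eigSucc, IsHermitian.eigenvalues, e, Equiv.symm_apply_apply]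
    refine hA.eigenvalues₀_antitone ?_
    rw [Fin.le_def]
    simpa using Nat.lt_succ_iff.1 k.2
  have hon : Orthonormal ℝ fun k => hA.eigenvectorBasis (e k) :=
    hA.eigenvectorBasis.orthonormal.comp _ he
  let L : (Fin (r + 1) → ℝ) →ₗ[ℝ] (Fin r → ℝ) :=
    LinearMap.pi fun i => (innerSL ℝ (u i)).toLinearMap ∘ₗ
      (Fintype.linearCombination ℝ fun k => hA.eigenvectorBasis (e k))
  -- Dimension count: r orthogonality conditions on an (r + 1)-dimensional span leave a nonzero
  -- vector. It is orthogonal to all spikes, so the form of S is σ²‖v‖² there, while the form of A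
  -- is at least λ_{r+1}‖v‖².
  obtain ⟨c, hc0, hcz⟩ : ∃ c, L c = 0 ∧ c ≠ 0 := by
    have := LinearMap.ker_ne_bot_of_finrank_lt (f := L) (by simp)
    obtain ⟨c, hc, hc'⟩ := Submodule.exists_mem_ne_zero_of_ne_bot this
    exact ⟨c, hc, hc'⟩
  let v : Vec p := ∑ k, c k • hA.eigenvectorBasis (e k)
  have huv : ∀ i, ⟪u i, v⟫ = 0 := fun i => by
    have := congrFun hc0 i
    simpa [L, v, Fintype.linearCombination_apply] using this
  have hvn : ‖v‖ ^ 2 = ∑ k, c k ^ 2 := by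
    rw [← real_inner_self_eq_norm_sq]
    simp only [v]
    rw [hon.inner_sum]
    simp [sq]
  have hAv : ⟪toEuclideanCLM (𝕜 := ℝ) A v, v⟫ = ∑ k, hA.eigenvalues (e k) * c k ^ 2 := by
    have : toEuclideanCLM (𝕜 := ℝ) A v
        = ∑ k, (c k * hA.eigenvalues (e k)) • hA.eigenvectorBasis (e k) := by
      simp only [v, map_sum, map_smul, toEuclideanCLM_eigenvectorBasis, smul_smul]
    rw [this]
    simp only [v]
    rw [hon.inner_sum]
    refine Finset.sum_congr rfl fun k _ => ?_
    simp
    ring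
  have hv0 : 0 < ‖v‖ ^ 2 := by
    rw [hvn]
    obtain ⟨k, hk⟩ := Function.ne_iff.1 hcz
    exact Finset.sum_pos' (fun _ _ => sq_nonneg _) ⟨k, Finset.mem_univ _, by
      have : c k ≠ 0 := hk
      positivity⟩
  have h1 : eigSucc hA r * ‖v‖ ^ 2 ≤ ⟪toEuclideanCLM (𝕜 := ℝ) A v, v⟫ := by
    rw [hAv, hvn, Finset.mul_sum]
    gcongr with k
    exact hev k
  have h2 := (abs_le.1 (abs_quadratic_le
    (toEuclideanCLM (𝕜 := ℝ) A - toEuclideanCLM (𝕜 := ℝ) S) v)).2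
  rw [_root_.sub_apply, inner_sub_left, quadratic_spiked hSeq] at h2
  simp only [huv] at h2
  have h3 := mul_le_mul_of_nonneg_right hδ hv0.le
  have h4 : (0:ℝ) = ∑ i, θ i * 0 ^ 2 := by simp
  rw [← h4] at h2
  exact le_of_mul_le_mul_right (by linarith) hv0

lemma le_eigenvalues {p : ℕ} {σ δ : ℝ} {r : ℕ} {A S : Mat p} (hA : A.IsHermitian)
    (hS : IsSpiked r σ S)
    (hδ : ‖toEuclideanCLM (𝕜 := ℝ) A - toEuclideanCLM (𝕜 := ℝ) S‖ ≤ δ) (i : Fin p) :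
    σ ^ 2 - δ ≤ hA.eigenvalues i := by
  have h1 := (abs_le.1 (abs_quadratic_le
    (toEuclideanCLM (𝕜 := ℝ) A - toEuclideanCLM (𝕜 := ℝ) S) (hA.eigenvectorBasis i))).1
  have h2 := le_quadratic_of_spiked hS (hA.eigenvectorBasis i)
  rw [_root_.sub_apply, inner_sub_left, toEuclideanCLM_eigenvectorBasis,
    inner_smul_left, real_inner_self_eq_norm_sq] at h1
  simp only [OrthonormalBasis.norm_eq_one, conj_trivial] at h1 h2
  linarith

/-- Eigenvalue thresholding is stable at spiked matrices. -/
lemma norm_eigThreshold_sub_le {p : ℕ} {σ δ : ℝ} {A S : Mat p} (hA : A.IsHermitian) (r : Fin p)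
    (hS : IsSpiked (r : ℕ) σ S)
    (hδ : ‖toEuclideanCLM (𝕜 := ℝ) A - toEuclideanCLM (𝕜 := ℝ) S‖ ≤ δ) :
    ‖toEuclideanCLM (𝕜 := ℝ) (eigThreshold hA r) - toEuclideanCLM (𝕜 := ℝ) S‖ ≤ 3 * δ := by
  have hδ0 : 0 ≤ δ := (norm_nonneg _).trans hδ
  -- Thresholding raises only eigenvalues below λ_{r+1}. All eigenvalues are at least σ² - δ and
  -- λ_{r+1} ≤ σ² + δ, so none moves by more than 2δ.
  have h1 : ‖toEuclideanCLM (𝕜 := ℝ) (eigThreshold hA r) - toEuclideanCLM (𝕜 := ℝ) A‖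
      ≤ 2 * δ := by
    refine opNorm_le_of_quadratic (fun u v => ?_) (by positivity) fun v => ?_
    · simp only [_root_.sub_apply, inner_sub_left, inner_sub_right,
        inner_toEuclideanCLM_comm hA, inner_toEuclideanCLM_comm (isHermitian_eigThreshold hA r)]
    · have : ⟪(toEuclideanCLM (𝕜 := ℝ) (eigThreshold hA r) - toEuclideanCLM (𝕜 := ℝ) A) v, v⟫
          = ∑ i, (max (hA.eigenvalues i) (eigSucc hA r) - hA.eigenvalues i)
              * ‖⟪hA.eigenvectorBasis i, v⟫‖ ^ 2 := by
        rw [_root_.sub_apply, toEuclideanCLM_eigThreshold,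
          toEuclideanCLM_eq_sum_eigen hA v, ← Finset.sum_sub_distrib, sum_inner]
        refine Finset.sum_congr rfl fun i _ => ?_
        rw [← sub_smul, inner_smul_left, Real.norm_eq_abs, sq_abs]
        simp only [conj_trivial]
        ring
      rw [this, ← hA.eigenvectorBasis.sum_sq_norm_inner_right v, Finset.mul_sum]
      refine (Finset.abs_sum_le_sum_abs _ _).trans (Finset.sum_le_sum fun i _ => ?_)
      rw [abs_mul, abs_of_nonneg (sq_nonneg ‖_‖)]
      gcongr
      rw [abs_of_nonneg (sub_nonneg.2 (le_max_left _ _)), sub_le_iff_le_add]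
      have := le_eigenvalues hA hS hδ i
      have := eigSucc_le hA r hS hδ
      exact max_le (by linarith) (by linarith)
  calc _ = ‖(toEuclideanCLM (𝕜 := ℝ) (eigThreshold hA r) - toEuclideanCLM (𝕜 := ℝ) A) +
        (toEuclideanCLM (𝕜 := ℝ) A - toEuclideanCLM (𝕜 := ℝ) S)‖ := by congr 1; abel
    _ ≤ 2 * δ + δ := (norm_add_le _ _).trans (add_le_add h1 hδ)
    _ = 3 * δ := by ring

/-! ### Smoothness of the cumulant function -/

lemma hasDerivAt_iteratedDeriv {φ : ℝ → ℝ} (hφ : ContDiff ℝ 5 φ) {k : ℕ} (hk : k < 5) (u : ℝ) :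
    HasDerivAt (iteratedDeriv k φ) (iteratedDeriv (k + 1) φ u) u := by
  rw [iteratedDeriv_succ]
  exact (hφ.differentiable_iteratedDeriv k (by exact_mod_cast hk) u).hasDerivAt

lemma abs_sub_le_of_hasDerivAt {f f' : ℝ → ℝ} (hf : ∀ u, HasDerivAt f (f' u) u) {B : ℝ}
    (hB : ∀ u, |f' u| ≤ B) (a b : ℝ) : |f a - f b| ≤ B * |a - b| :=
  convex_univ.norm_image_sub_le_of_norm_hasDerivWithin_le
    (fun u _ => (hf u).hasDerivWithinAt) (fun u _ => hB u) (Set.mem_univ b) (Set.mem_univ a)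

/-- Mean value inequality for u ↦ f u - f' a * u between b and a. The slope is taken at a, which
will be the current iterate, because the Hessian is evaluated there; the missing factor 1/2 is
immaterial. -/
lemma abs_taylor_le {f f' f'' : ℝ → ℝ} (hf : ∀ u, HasDerivAt f (f' u) u)
    (hf' : ∀ u, HasDerivAt f' (f'' u) u) {B : ℝ} (hB : ∀ u, |f'' u| ≤ B) (a b : ℝ) :
    |f a - f b - f' a * (a - b)| ≤ B * (a - b) ^ 2 := by
  have hB0 : 0 ≤ B := (abs_nonneg _).trans (hB 0)
  have h := (convex_uIcc b a).norm_image_sub_le_of_norm_hasDerivWithin_le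
    (f := fun u => f u - f' a * u) (f' := fun u => f' u - f' a) (C := B * |a - b|)
    (fun u _ => (((hf u).sub ((hasDerivAt_id u).const_mul (f' a))).congr_deriv
      (by simp)).hasDerivWithinAt)
    (fun u hu => by
      refine (abs_sub_le_of_hasDerivAt hf' hB u a).trans ?_
      refine mul_le_mul_of_nonneg_left ?_ hB0
      rw [abs_sub_comm u a]
      exact Set.abs_sub_right_of_mem_uIcc hu) Set.left_mem_uIcc Set.right_mem_uIcc
  rw [Real.norm_eq_abs, Real.norm_eq_abs, mul_assoc, ← sq, sq_abs] at h
  convert h using 2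
  ring

lemma continuous_iteratedDeriv {φ : ℝ → ℝ} (hφ : ContDiff ℝ 5 φ) {k : ℕ} (hk : k ≤ 5) :
    Continuous (iteratedDeriv k φ) :=
  hφ.continuous_iteratedDeriv k (by exact_mod_cast hk)

lemma gradient_negLogLik {n p : ℕ} {φ : ℝ → ℝ} (hφ : ContDiff ℝ 5 φ) (X : Fin n → Vec p)
    (y : Fin n → ℝ) (β : Vec p) :
    gradient (negLogLik φ X y) β
      = (n : ℝ)⁻¹ • ∑ i, (iteratedDeriv 1 φ ⟪X i, β⟫ - y i) • X i := by
  refine HasGradientAt.gradient ?_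
  rw [hasGradientAt_iff_hasFDerivAt]
  have h1 : ∀ i, HasFDerivAt (fun β : Vec p => φ ⟪X i, β⟫ - y i * ⟪X i, β⟫)
      ((iteratedDeriv 1 φ ⟪X i, β⟫ - y i) • innerSL ℝ (X i)) β := fun i => by
    have hl : HasFDerivAt (fun β : Vec p => ⟪X i, β⟫) (innerSL ℝ (X i)) β :=
      (innerSL ℝ (X i)).hasFDerivAt
    have hd := hasDerivAt_iteratedDeriv hφ (k := 0) (by norm_num) ⟪X i, β⟫
    rw [iteratedDeriv_zero] at hd
    rw [sub_smul]
    exact (hd.comp_hasFDerivAt β hl).sub (hl.const_mul (y i))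
  have h2 := (HasFDerivAt.fun_sum (u := Finset.univ) fun i _ => h1 i).const_mul ((n : ℝ)⁻¹)
  refine h2.congr_fderiv ?_
  ext v
  simp

lemma gradient_eq_zero_of_isMinOn {p : ℕ} {f : Vec p → ℝ} {b : Vec p}
    (h : IsMinOn f Set.univ b) : gradient f b = 0 := by
  have := (h.isLocalMin Filter.univ_mem).fderiv_eq_zero
  simp [gradient, this]

/-! ### The projection onto a ball -/

lemma norm_projBall_le {p : ℕ} {R : ℝ} (hR : 0 ≤ R) (v : Vec p) : ‖projBall R v‖ ≤ R := by
  unfold projBall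
  split_ifs with h
  · exact h
  · push Not at h
    have : 0 < ‖v‖ := hR.trans_lt h
    rw [norm_smul, Real.norm_of_nonneg (by positivity), div_mul_cancel₀ _ this.ne']

/-- Outside the ball, Cauchy–Schwarz shows that the squared distance drops by at least (‖v‖ - R)².
-/
lemma norm_projBall_sub_le {p : ℕ} {R : ℝ} (v w : Vec p) (hw : ‖w‖ ≤ R) :
    ‖projBall R v - w‖ ≤ ‖v - w‖ := by
  unfold projBall
  split_ifs with h
  · exact le_rfl
  · push Not at h
    have hR : 0 ≤ R := (norm_nonneg _).trans hw
    have hv : 0 < ‖v‖ := hR.trans_lt h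
    refine pow_le_pow_iff_left₀ (norm_nonneg _) (norm_nonneg _) two_ne_zero |>.1 ?_
    rw [norm_sub_sq_real, norm_sub_sq_real, inner_smul_left, norm_smul,
      Real.norm_of_nonneg (by positivity), div_mul_cancel₀ _ hv.ne', conj_trivial]
    have h1 : ⟪v, w⟫ ≤ ‖v‖ * R := (real_inner_le_norm _ _).trans (by gcongr)
    have h2 : 0 ≤ 1 - R / ‖v‖ := by rw [sub_nonneg, div_le_one hv]; exact h.le
    have h3 := mul_le_mul_of_nonneg_left h1 h2
    have h4 : (1 - R / ‖v‖) * (‖v‖ * R) = ‖v‖ * R - R ^ 2 := by field_simp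
    nlinarith [sq_nonneg (‖v‖ - R)]

lemma norm_iter_le {n p : ℕ} {φ : ℝ → ℝ} {R : ℝ} (hR : 0 ≤ R) {r : Fin p} {X : Fin n → Vec p}
    {y : Fin n → ℝ} {S : Finset (Fin n)} {β₀ : Vec p} {t : ℕ} (ht : 0 < t) :
    ‖iter φ R r X y S β₀ t‖ ≤ R := by
  obtain ⟨t, rfl⟩ := Nat.exists_eq_succ_of_ne_zero ht.ne'
  exact norm_projBall_le hR _

/-! ### The scaling matrix -/

lemma inv_mul_cancel_of_coercive {p : ℕ} {Z : Mat p} {c : ℝ} (hc : 0 < c)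
    (hZ : ∀ v : Vec p, c * ‖v‖ ^ 2 ≤ ⟪toEuclideanCLM (𝕜 := ℝ) Z v, v⟫) : Z⁻¹ * Z = 1 := by
  have hu : IsUnit Z := by
    rw [← mulVec_injective_iff_isUnit]
    intro a b hab
    have h := hZ (WithLp.toLp 2 (a - b))
    have h0 : toEuclideanCLM (𝕜 := ℝ) Z (WithLp.toLp 2 (a - b)) = 0 := by
      simp only [toEuclideanCLM_toLp, mulVec_sub]
      have : Z *ᵥ a = Z *ᵥ b := hab
      rw [this, sub_self, WithLp.toLp_zero]
    rw [h0, inner_zero_left] at h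
    have h1 : ‖(WithLp.toLp 2 (a - b) : Vec p)‖ ^ 2 ≤ 0 := by
      by_contra! hcon
      nlinarith
    have h2 : (WithLp.toLp 2 (a - b) : Vec p) = 0 := by
      rw [← norm_eq_zero]
      exact pow_eq_zero_iff two_ne_zero |>.1 (le_antisymm h1 (sq_nonneg _))
    have h3 := congrArg WithLp.ofLp h2
    exact sub_eq_zero.1 h3
  exact nonsing_inv_mul Z ((isUnit_iff_isUnit_det Z).1 hu)

lemma inv_apply_of_coercive {p : ℕ} {Z : Mat p} {c : ℝ} (hc : 0 < c)
    (hZ : ∀ v : Vec p, c * ‖v‖ ^ 2 ≤ ⟪toEuclideanCLM (𝕜 := ℝ) Z v, v⟫) (v : Vec p) :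
    toEuclideanCLM (𝕜 := ℝ) Z⁻¹ (toEuclideanCLM (𝕜 := ℝ) Z v) = v := by
  rw [← ContinuousLinearMap.comp_apply, ← ContinuousLinearMap.mul_def, ← map_mul,
    inv_mul_cancel_of_coercive hc hZ, map_one, one_apply_eq_self]

lemma norm_inv_apply_le {p : ℕ} {Z : Mat p} {c : ℝ} (hc : 0 < c)
    (hZ : ∀ v : Vec p, c * ‖v‖ ^ 2 ≤ ⟪toEuclideanCLM (𝕜 := ℝ) Z v, v⟫) (w : Vec p) :
    ‖toEuclideanCLM (𝕜 := ℝ) Z⁻¹ w‖ ≤ c⁻¹ * ‖w‖ := by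
  have e : toEuclideanCLM (𝕜 := ℝ) Z (toEuclideanCLM (𝕜 := ℝ) Z⁻¹ w) = w := by
    rw [← ContinuousLinearMap.comp_apply, ← ContinuousLinearMap.mul_def, ← map_mul,
      mul_eq_one_comm.1 (inv_mul_cancel_of_coercive hc hZ), map_one, one_apply_eq_self]
  have h := hZ (toEuclideanCLM (𝕜 := ℝ) Z⁻¹ w)
  rw [e] at h
  set v := toEuclideanCLM (𝕜 := ℝ) Z⁻¹ w
  have h1 := h.trans (real_inner_le_norm _ _)
  by_cases hv : ‖v‖ = 0
  · rw [hv]; positivity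
  have hv' : 0 < ‖v‖ := lt_of_le_of_ne (norm_nonneg _) (Ne.symm hv)
  rw [le_inv_mul_iff₀ hc]
  nlinarith

lemma toEuclideanCLM_scaling {p : ℕ} (m₂ m₄ : ℝ) (Z : Mat p) (β w : Vec p) :
    toEuclideanCLM (𝕜 := ℝ) (scaling m₂ m₄ Z β) w
      = m₂⁻¹ • (toEuclideanCLM (𝕜 := ℝ) Z⁻¹ w
        - (m₄ / (m₂ + m₄ * ⟪toEuclideanCLM (𝕜 := ℝ) Z β, β⟫) * ⟪β, w⟫) • β) := by
  simp only [scaling, map_smul, map_sub, _root_.smul_apply, _root_.sub_apply,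
    toEuclideanCLM_vecMulVec, smul_smul]

/-- The Sherman-Morrison formula. -/
lemma scaling_apply_rankOne {p : ℕ} {m₂ m₄ : ℝ} {Z : Mat p} {c : ℝ} (hc : 0 < c)
    (hZs : Z.IsHermitian)
    (hZ : ∀ v : Vec p, c * ‖v‖ ^ 2 ≤ ⟪toEuclideanCLM (𝕜 := ℝ) Z v, v⟫) (hm : m₂ ≠ 0) (β u : Vec p)
    (hD : m₂ + m₄ * ⟪toEuclideanCLM (𝕜 := ℝ) Z β, β⟫ ≠ 0) :
    toEuclideanCLM (𝕜 := ℝ) (scaling m₂ m₄ Z β) (m₂ • toEuclideanCLM (𝕜 := ℝ) Z u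
      + (m₄ * ⟪toEuclideanCLM (𝕜 := ℝ) Z β, u⟫) • toEuclideanCLM (𝕜 := ℝ) Z β) = u := by
  rw [toEuclideanCLM_scaling, map_add, map_smul, map_smul, inv_apply_of_coercive hc hZ,
    inv_apply_of_coercive hc hZ, inner_add_right, inner_smul_right, inner_smul_right,
    ← inner_toEuclideanCLM_comm hZs, real_inner_comm (toEuclideanCLM (𝕜 := ℝ) Z β) β]
  set s := ⟪toEuclideanCLM (𝕜 := ℝ) Z β, u⟫
  set b := ⟪toEuclideanCLM (𝕜 := ℝ) Z β, β⟫
  have e : m₄ / (m₂ + m₄ * b) * (m₂ * s + m₄ * s * b) = m₄ * s := by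
    field_simp
  rw [e, add_sub_cancel_right, smul_smul, inv_mul_cancel₀ hm, one_smul]

lemma norm_scaling_apply_le {p : ℕ} {m₂ m₄ : ℝ} {Z : Mat p} {c b ξ M R : ℝ} (hc : 0 < c)
    (hZ : ∀ v : Vec p, c * ‖v‖ ^ 2 ≤ ⟪toEuclideanCLM (𝕜 := ℝ) Z v, v⟫) (hb : 0 < b) (hm : b ≤ m₂)
    (hM : |m₄| ≤ M) (hξ : 0 < ξ) {β : Vec p} (hβ : ‖β‖ ≤ R)
    (hD : ξ ≤ |m₂ + m₄ * ⟪toEuclideanCLM (𝕜 := ℝ) Z β, β⟫|) (w : Vec p) :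
    ‖toEuclideanCLM (𝕜 := ℝ) (scaling m₂ m₄ Z β) w‖ ≤ b⁻¹ * (c⁻¹ + M * R ^ 2 / ξ) * ‖w‖ := by
  have hM0 : 0 ≤ M := (abs_nonneg _).trans hM
  have hR : 0 ≤ R := (norm_nonneg _).trans hβ
  rw [toEuclideanCLM_scaling, norm_smul, Real.norm_eq_abs, abs_inv, mul_assoc]
  refine mul_le_mul (inv_anti₀ hb (hm.trans (le_abs_self _))) ?_ (norm_nonneg _) (by positivity)
  refine (norm_sub_le _ _).trans ?_
  rw [add_mul]
  refine add_le_add (norm_inv_apply_le hc hZ w) ?_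
  rw [norm_smul, norm_mul, norm_div, Real.norm_eq_abs, Real.norm_eq_abs, Real.norm_eq_abs]
  calc |m₄| / |m₂ + m₄ * ⟪toEuclideanCLM (𝕜 := ℝ) Z β, β⟫| * |⟪β, w⟫| * ‖β‖
      ≤ M / ξ * (R * ‖w‖) * R := by
        gcongr
        exact (abs_real_inner_le_norm _ _).trans (by gcongr)
    _ = M * R ^ 2 / ξ * ‖w‖ := by ring

/-! ### One step for a fixed data set -/

/-- The error of one Newton-Stein step in terms of the distance between the inverse of the scaling
matrix and the Hessian, and of a third empirical moment. -/
lemma norm_step_sub_le {n p : ℕ} {φ : ℝ → ℝ} (hφ : ContDiff ℝ 5 φ) {B R : ℝ}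
    (hB : ∀ u, |iteratedDeriv 3 φ u| ≤ B) (r : Fin p) (X : Fin n → Vec p) (y : Fin n → ℝ)
    (S : Finset (Fin n)) {β βs : Vec p} (hβ : ‖β‖ ≤ R) (hβs : ‖βs‖ ≤ R)
    (hmin : IsMinOn (negLogLik φ X y) Set.univ βs) {Z : Mat p}
    (hZeq : Z = eigThreshold (isHermitian_sampleCov X S) r) {c b ξ M τ L : ℝ} (hc : 0 < c)
    (hZ : ∀ v : Vec p, c * ‖v‖ ^ 2 ≤ ⟪toEuclideanCLM (𝕜 := ℝ) Z v, v⟫) (hb : 0 < b)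
    (hm : b ≤ muHat φ X 2 β) (hM : |muHat φ X 4 β| ≤ M) (hξ : 0 < ξ)
    (hD : ξ ≤ |muHat φ X 2 β + muHat φ X 4 β * ⟪toEuclideanCLM (𝕜 := ℝ) Z β, β⟫|) (hτ : 0 ≤ τ)
    (hquad : ∀ u : Vec p, ‖u‖ = 1 → |muHat φ X 2 β * ⟪toEuclideanCLM (𝕜 := ℝ) Z u, u⟫
        + muHat φ X 4 β * ⟪toEuclideanCLM (𝕜 := ℝ) Z β, u⟫ ^ 2
        - (n : ℝ)⁻¹ * ∑ i, ⟪u, X i⟫ ^ 2 * iteratedDeriv 2 φ ⟪X i, β⟫| ≤ τ)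
    (hL : ∀ u w : Vec p, ‖u‖ = 1 → ‖w‖ = 1 →
        (n : ℝ)⁻¹ * ∑ i, |⟪X i, u⟫| * ⟪X i, w⟫ ^ 2 ≤ L) :
    ‖step φ R r X y S β - βs‖
      ≤ b⁻¹ * (c⁻¹ + M * R ^ 2 / ξ) * ((τ + B * L * ‖β - βs‖) * ‖β - βs‖) := by
  have hB0 : 0 ≤ B := (abs_nonneg _).trans (hB 0)
  have hZs : Z.IsHermitian := hZeq ▸ isHermitian_eigThreshold _ _
  have hM0 : 0 ≤ M := (abs_nonneg _).trans hM
  set m₂ := muHat φ X 2 β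
  set m₄ := muHat φ X 4 β
  set g := gradient (negLogLik φ X y) β with hg
  set d := β - βs with hd
  have hDne : m₂ + m₄ * ⟪toEuclideanCLM (𝕜 := ℝ) Z β, β⟫ ≠ 0 := fun h => by
    rw [h, abs_zero] at hD; linarith
  have hstep : step φ R r X y S β
      = projBall R (β - toEuclideanCLM (𝕜 := ℝ) (scaling m₂ m₄ Z β) g) := by
    rw [hZeq]; rfl
  rw [hstep]
  refine (norm_projBall_sub_le _ _ hβs).trans ?_
  let Md : Vec p := m₂ • toEuclideanCLM (𝕜 := ℝ) Z d
      + (m₄ * ⟪toEuclideanCLM (𝕜 := ℝ) Z β, d⟫) • toEuclideanCLM (𝕜 := ℝ) Z β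
  -- Since Q inverts M, d = Q(Md), so the unprojected error d - Qg is Q(Md - g).
  have e1 : β - toEuclideanCLM (𝕜 := ℝ) (scaling m₂ m₄ Z β) g - βs
      = toEuclideanCLM (𝕜 := ℝ) (scaling m₂ m₄ Z β) (Md - g) := by
    rw [map_sub, scaling_apply_rankOne hc hZs hZ (hb.trans_le hm).ne' β d hDne, hd]
    abel
  rw [e1]
  refine (norm_scaling_apply_le hc hZ hb hm hM hξ hβ hD _).trans ?_
  have hR : 0 ≤ R := (norm_nonneg _).trans hβ
  gcongr
  -- the Hessian as an operator
  let A : Vec p →L[ℝ] Vec p := m₂ • toEuclideanCLM (𝕜 := ℝ) Z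
    + m₄ • toEuclideanCLM (𝕜 := ℝ) (vecMulVec (toEuclideanCLM (𝕜 := ℝ) Z β)
        (toEuclideanCLM (𝕜 := ℝ) Z β))
    - (n : ℝ)⁻¹ • ∑ i, iteratedDeriv 2 φ ⟪X i, β⟫ • toEuclideanCLM (𝕜 := ℝ) (vecMulVec (X i) (X i))
  have hA : ∀ u, A u = m₂ • toEuclideanCLM (𝕜 := ℝ) Z u
      + (m₄ * ⟪toEuclideanCLM (𝕜 := ℝ) Z β, u⟫) • toEuclideanCLM (𝕜 := ℝ) Z β
      - (n : ℝ)⁻¹ • ∑ i, (iteratedDeriv 2 φ ⟪X i, β⟫ * ⟪X i, u⟫) • X i := fun u => by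
    simp only [A, _root_.sub_apply, _root_.add_apply, _root_.smul_apply, _root_.sum_apply,
      toEuclideanCLM_vecMulVec, smul_smul]
  have hAin : ∀ u v, ⟪A u, v⟫ = m₂ * ⟪toEuclideanCLM (𝕜 := ℝ) Z u, v⟫
      + m₄ * ⟪toEuclideanCLM (𝕜 := ℝ) Z β, u⟫ * ⟪toEuclideanCLM (𝕜 := ℝ) Z β, v⟫
      - (n : ℝ)⁻¹ * ∑ i, iteratedDeriv 2 φ ⟪X i, β⟫ * ⟪X i, u⟫ * ⟪X i, v⟫ := fun u v => by
    rw [hA]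
    simp only [inner_add_left, inner_sub_left, inner_smul_left, sum_inner, conj_trivial]
  have hAsymm : ∀ u v, ⟪A u, v⟫ = ⟪u, A v⟫ := fun u v => by
    rw [real_inner_comm (A v) u, hAin, hAin, inner_toEuclideanCLM_comm hZs u v,
      real_inner_comm (toEuclideanCLM (𝕜 := ℝ) Z v) u]
    congr 1
    · ring
    · congr 1
      exact Finset.sum_congr rfl fun i _ => by ring
  have hAn : ‖A‖ ≤ τ := by
    refine opNorm_le_of_unit hAsymm hτ fun u hu => ?_
    refine le_trans (le_of_eq ?_) (hquad u hu)
    rw [hAin]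
    congr 2
    · ring
    · congr 1
      refine Finset.sum_congr rfl fun i _ => ?_
      rw [real_inner_comm u (X i)]; ring
  -- the Taylor remainder
  let ρ : Fin n → ℝ := fun i => iteratedDeriv 1 φ ⟪X i, β⟫ - iteratedDeriv 1 φ ⟪X i, βs⟫
    - iteratedDeriv 2 φ ⟪X i, β⟫ * ⟪X i, d⟫
  have hρ : ∀ i, |ρ i| ≤ B * ⟪X i, d⟫ ^ 2 := fun i => by
    have := abs_taylor_le (hasDerivAt_iteratedDeriv hφ (k := 1) (by norm_num))
      (hasDerivAt_iteratedDeriv hφ (k := 2) (by norm_num)) hB ⟪X i, β⟫ ⟪X i, βs⟫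
    simpa only [ρ, hd, inner_sub_right] using this
  -- The vanishing gradient at βs is subtracted from g. The responses y cancel and differences of φ'
  -- remain, whose linear part is the Hessian contained in A.
  have e2 : Md - g = A d - (n : ℝ)⁻¹ • ∑ i, ρ i • X i := by
    have h0 := gradient_eq_zero_of_isMinOn hmin
    rw [gradient_negLogLik hφ] at h0
    rw [hA, hg, gradient_negLogLik hφ, sub_sub, ← smul_add, ← Finset.sum_add_distrib]
    simp only [Md]
    congr 1
    rw [← sub_zero (_ • _), ← h0, ← smul_sub, ← Finset.sum_sub_distrib]
    congr 1
    refine Finset.sum_congr rfl fun i _ => ?_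
    rw [← sub_smul, ← add_smul]
    congr 1
    simp only [ρ]
    ring
  have hrem : ‖(n : ℝ)⁻¹ • ∑ i, ρ i • X i‖ ≤ B * L * ‖d‖ * ‖d‖ := by
    obtain ⟨v, hv⟩ : ∃ v, v = (n : ℝ)⁻¹ • ∑ i, ρ i • X i := ⟨_, rfl⟩
    rw [← hv]
    by_cases hv0 : v = 0
    -- The sign of L is not assumed; it follows from the moment bound as soon as a unit vector is
    -- available.
    · have hL0 : d ≠ 0 → 0 ≤ L := fun hd0 => by
        have h1 : ‖‖d‖⁻¹ • d‖ = 1 := by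
          rw [norm_smul, norm_inv, norm_norm, inv_mul_cancel₀ (norm_ne_zero_iff.2 hd0)]
        exact le_trans (by positivity) (hL _ _ h1 h1)
      by_cases hd0 : d = 0
      · simp [hv0, hd0]
      · have := hL0 hd0
        rw [hv0, norm_zero]; positivity
    by_cases hd0 : d = 0
    · exfalso
      apply hv0
      rw [hv]
      have : ∀ i, ρ i = 0 := fun i => by
        have := hρ i
        rw [hd0, inner_zero_right] at this
        simpa using this
      simp [this]
    have hvn : 0 < ‖v‖ := norm_pos_iff.2 hv0
    have hdn : 0 < ‖d‖ := norm_pos_iff.2 hd0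
    -- Pairing the remainder v with itself produces the third moment in the directions v and d;
    -- after normalizing both, one factor ‖v‖ cancels.
    have h1 : ‖v‖ ^ 2 ≤ (n : ℝ)⁻¹ * ∑ i, B * (|⟪X i, v⟫| * ⟪X i, d⟫ ^ 2) := by
      rw [← real_inner_self_eq_norm_sq]
      conv_lhs => rw [hv, inner_smul_left, sum_inner, ← hv]
      rw [conj_trivial]
      gcongr with i
      rw [inner_smul_left, conj_trivial]
      calc ρ i * ⟪X i, v⟫ ≤ |ρ i| * |⟪X i, v⟫| := by rw [← abs_mul]; exact le_abs_self _
        _ ≤ B * ⟪X i, d⟫ ^ 2 * |⟪X i, v⟫| := by gcongr; exact hρ i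
        _ = _ := by ring
    have h2 := hL (‖v‖⁻¹ • v) (‖d‖⁻¹ • d)
      (by rw [norm_smul, norm_inv, norm_norm, inv_mul_cancel₀ hvn.ne'])
      (by rw [norm_smul, norm_inv, norm_norm, inv_mul_cancel₀ hdn.ne'])
    have e3 : (n : ℝ)⁻¹ * ∑ i, B * (|⟪X i, v⟫| * ⟪X i, d⟫ ^ 2) = B * ‖v‖ * ‖d‖ ^ 2 *
        ((n : ℝ)⁻¹ * ∑ i, |⟪X i, ‖v‖⁻¹ • v⟫| * ⟪X i, ‖d‖⁻¹ • d⟫ ^ 2) := by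
      rw [mul_left_comm _ (n : ℝ)⁻¹, Finset.mul_sum (a := B * ‖v‖ * ‖d‖ ^ 2)]
      congr 1
      refine Finset.sum_congr rfl fun i _ => ?_
      rw [inner_smul_right, inner_smul_right, abs_mul, abs_inv, abs_norm]
      field_simp
    rw [e3] at h1
    have h3 := h1.trans (mul_le_mul_of_nonneg_left h2 (by positivity))
    have h4 : ‖v‖ * ‖v‖ ≤ ‖v‖ * (B * L * ‖d‖ * ‖d‖) := by nlinarith
    exact le_of_mul_le_mul_left h4 hvn
  rw [e2, add_mul]
  exact (norm_sub_le _ _).trans (add_le_add ((A.le_opNorm d).trans (by gcongr)) hrem)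

/-- The third empirical moment in terms of the second and fourth. -/
lemma third_moment_le {n p : ℕ} (hp : 0 < p) (X : Fin n → Vec p) {C₂ C₄ : ℝ}
    (h2 : ∀ u : Vec p, ‖u‖ = 1 → (n : ℝ)⁻¹ * ∑ i, ⟪X i, u⟫ ^ 2 ≤ C₂)
    (h4 : (n : ℝ)⁻¹ * ∑ i, ‖X i‖ ^ 4 ≤ C₄ * p ^ 2) (u w : Vec p) (hu : ‖u‖ = 1) (hw : ‖w‖ = 1) :
    (n : ℝ)⁻¹ * ∑ i, |⟪X i, u⟫| * ⟪X i, w⟫ ^ 2 ≤ (C₂ + C₄) * p := by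
  have hp' : (0 : ℝ) < p := by exact_mod_cast hp
  have h : ∀ i, |⟪X i, u⟫| * ⟪X i, w⟫ ^ 2 ≤ p * ⟪X i, w⟫ ^ 2 + (p : ℝ)⁻¹ * ‖X i‖ ^ 4 := by
    intro i
    have a1 : |⟪X i, u⟫| ≤ ‖X i‖ := by simpa [hu] using abs_real_inner_le_norm (X i) u
    have a2 : ⟪X i, w⟫ ^ 2 ≤ ‖X i‖ ^ 2 := by
      rw [← sq_abs]; gcongr; simpa [hw] using abs_real_inner_le_norm (X i) w
    -- The weight p balances the two contributions: p times a bounded second moment, and p⁻¹ times a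
    -- fourth moment of the norm of order p².
    have a3 : |⟪X i, u⟫| ≤ p + (p : ℝ)⁻¹ * ‖X i‖ ^ 2 := by
      refine a1.trans ?_
      have e : (p : ℝ) + (p : ℝ)⁻¹ * ‖X i‖ ^ 2 - ‖X i‖
          = (p : ℝ)⁻¹ * ((p - ‖X i‖) ^ 2 + p * ‖X i‖) := by field_simp; ring
      have : 0 ≤ (p : ℝ)⁻¹ * ((p - ‖X i‖) ^ 2 + p * ‖X i‖) := by positivity
      linarith
    calc |⟪X i, u⟫| * ⟪X i, w⟫ ^ 2 ≤ (p + (p : ℝ)⁻¹ * ‖X i‖ ^ 2) * ⟪X i, w⟫ ^ 2 := by gcongr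
      _ = p * ⟪X i, w⟫ ^ 2 + (p : ℝ)⁻¹ * ‖X i‖ ^ 2 * ⟪X i, w⟫ ^ 2 := by ring
      _ ≤ p * ⟪X i, w⟫ ^ 2 + (p : ℝ)⁻¹ * ‖X i‖ ^ 2 * ‖X i‖ ^ 2 := by gcongr
      _ = _ := by ring
  calc (n : ℝ)⁻¹ * ∑ i, |⟪X i, u⟫| * ⟪X i, w⟫ ^ 2
      ≤ (n : ℝ)⁻¹ * ∑ i, (p * ⟪X i, w⟫ ^ 2 + (p : ℝ)⁻¹ * ‖X i‖ ^ 4) := by gcongr with i; exact h i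
    _ = p * ((n : ℝ)⁻¹ * ∑ i, ⟪X i, w⟫ ^ 2) + (p : ℝ)⁻¹ * ((n : ℝ)⁻¹ * ∑ i, ‖X i‖ ^ 4) := by
        rw [Finset.sum_add_distrib, ← Finset.mul_sum, ← Finset.mul_sum]; ring
    _ ≤ p * C₂ + (p : ℝ)⁻¹ * (C₄ * p ^ 2) := by gcongr; exact h2 w hw
    _ = (C₂ + C₄) * p := by field_simp

/-! ### Stein's identity for the Gaussian distribution -/

lemma hasDerivAt_gaussianPDFReal {v : NNReal} (hv : v ≠ 0) (x : ℝ) :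
    HasDerivAt (gaussianPDFReal 0 v) (-(x / v) * gaussianPDFReal 0 v x) x := by
  have hv' : (v : ℝ) ≠ 0 := by exact_mod_cast hv
  rw [gaussianPDFReal_def]
  have h1 : HasDerivAt (fun x : ℝ => -(x - 0) ^ 2 / (2 * v)) (-(x / v)) x := by
    have := (((hasDerivAt_id x).sub_const (0 : ℝ)).pow 2).neg.div_const (2 * (v : ℝ))
    refine this.congr_deriv ?_
    simp
    field_simp
  refine (h1.exp.const_mul _).congr_deriv ?_
  ring

lemma integrable_gaussianReal_iff {v : NNReal} (hv : v ≠ 0) {f : ℝ → ℝ} :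
    Integrable f (gaussianReal 0 v) ↔ Integrable (fun x => gaussianPDFReal 0 v x * f x) := by
  rw [gaussianReal_of_var_ne_zero _ hv, integrable_withDensity_iff_integrable_smul'
    (measurable_gaussianPDF _ _) (by simp [gaussianPDF])]
  simp only [toReal_gaussianPDF, smul_eq_mul]

/-- Integration by parts against a centred Gaussian measure. -/
lemma integral_id_mul_gaussianReal (v : NNReal) {f f' : ℝ → ℝ}
    (hf : ∀ x, HasDerivAt f (f' x) x) (h0 : Integrable f (gaussianReal 0 v))
    (h1 : Integrable (fun x => x * f x) (gaussianReal 0 v))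
    (h2 : Integrable f' (gaussianReal 0 v)) :
    ∫ x, x * f x ∂(gaussianReal 0 v) = v * ∫ x, f' x ∂(gaussianReal 0 v) := by
  by_cases hv : v = 0
  · simp [hv]
  have hv' : (v : ℝ) ≠ 0 := by exact_mod_cast hv
  rw [integrable_gaussianReal_iff hv] at h0 h1 h2
  rw [integral_gaussianReal_eq_integral_smul hv, integral_gaussianReal_eq_integral_smul hv]
  have h := integral_mul_deriv_eq_deriv_mul_of_integrable (u := f) (u' := f')
    (v := gaussianPDFReal 0 v) (v' := fun x => -(x / v) * gaussianPDFReal 0 v x)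
    (fun x _ => hf x) (fun x _ => hasDerivAt_gaussianPDFReal hv x)
    ((h1.const_mul (-(v : ℝ)⁻¹)).congr (.of_forall fun x => by
      simp only [Pi.mul_apply]; ring))
    (h2.congr (.of_forall fun x => by simp only [Pi.mul_apply]; ring))
    (h0.congr (.of_forall fun x => by simp only [Pi.mul_apply]; ring))
  have e1 : ∫ x, f x * (-(x / v) * gaussianPDFReal 0 v x)
      = -(v : ℝ)⁻¹ * ∫ x, gaussianPDFReal 0 v x • (x * f x) := by
    rw [← integral_const_mul]
    congr 1 with x
    simp only [smul_eq_mul]; ring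
  have e2 : ∫ x, f' x * gaussianPDFReal 0 v x = ∫ x, gaussianPDFReal 0 v x • f' x := by
    congr 1 with x
    simp only [smul_eq_mul]; ring
  rw [e1, e2] at h
  field_simp at h
  linarith

lemma integrable_pow_mul_bdd_gaussianReal (v : NNReal) (k : ℕ) {f : ℝ → ℝ} (hf : Continuous f)
    {C : ℝ} (hC : ∀ x, |f x| ≤ C) : Integrable (fun x => x ^ k * f x) (gaussianReal 0 v) := by
  have h : Integrable (fun x : ℝ => x ^ k) (gaussianReal 0 v) := by
    have h := (memLp_id_gaussianReal (μ := 0) (v := v) (k : NNReal)).integrable_norm_pow'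
    refine (integrable_norm_iff (by fun_prop)).1 (h.congr (.of_forall fun x => ?_))
    simp
  exact h.mul_bdd (c := C) hf.aestronglyMeasurable (.of_forall hC)

/-- The second-order Stein identity in dimension one. -/
lemma integral_sq_mul_gaussianReal (v : NNReal) {h h' h'' : ℝ → ℝ}
    (hh : ∀ x, HasDerivAt h (h' x) x) (hh' : ∀ x, HasDerivAt h' (h'' x) x)
    (hh'' : Continuous h'') {C : ℝ} (hC : ∀ x, |h x| ≤ C) (hC' : ∀ x, |h' x| ≤ C)
    (hC'' : ∀ x, |h'' x| ≤ C) :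
    ∫ x, x ^ 2 * h x ∂(gaussianReal 0 v)
      = v * ∫ x, h x ∂(gaussianReal 0 v) + v ^ 2 * ∫ x, h'' x ∂(gaussianReal 0 v) := by
  have c : Continuous h := continuous_iff_continuousAt.2 fun x => (hh x).continuousAt
  have c' : Continuous h' := continuous_iff_continuousAt.2 fun x => (hh' x).continuousAt
  have i0 := integrable_pow_mul_bdd_gaussianReal v 0 c hC
  have i1 := integrable_pow_mul_bdd_gaussianReal v 1 c hC
  have i2 := integrable_pow_mul_bdd_gaussianReal v 2 c hC
  have i0' := integrable_pow_mul_bdd_gaussianReal v 0 c' hC'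
  have i1' := integrable_pow_mul_bdd_gaussianReal v 1 c' hC'
  have i0'' := integrable_pow_mul_bdd_gaussianReal v 0 hh'' hC''
  simp only [pow_zero, one_mul, pow_one] at i0 i1 i0' i1' i0''
  -- Integration by parts twice: first for x h(x), then for h', which leaves h and h''.
  have e1 := integral_id_mul_gaussianReal v (f := fun x => x * h x)
    (f' := fun x => h x + x * h' x) (fun x => ((hasDerivAt_id x).mul (hh x)).congr_deriv (by simp))
    i1 (i2.congr (.of_forall fun x => by simp only; ring)) (i0.add i1')
  have e2 := integral_id_mul_gaussianReal v hh' i0' i1' i0''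
  rw [integral_add i0 i1', e2] at e1
  rw [show (fun x => x ^ 2 * h x) = fun x => x * (x * h x) by ext; ring, e1]
  ring

lemma memLp_inner_gaussian {p : ℕ} (A : Mat p) (u : Vec p) :
    MemLp (fun z => ⟪u, z⟫) 2 (multivariateGaussian (0 : Vec p) A) :=
  (IsGaussian.memLp_two_id (μ := multivariateGaussian (0 : Vec p) A)).const_inner u

lemma integral_inner_gaussian {p : ℕ} (A : Mat p) (u : Vec p) :
    ∫ z, ⟪u, z⟫ ∂(multivariateGaussian (0 : Vec p) A) = 0 := by
  have h := (innerSL ℝ u).integral_comp_id_comm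
    (IsGaussian.integrable_id (μ := multivariateGaussian (0 : Vec p) A))
  rw [integral_id_multivariateGaussian] at h
  simpa using h

lemma cov_inner_gaussian {p : ℕ} {A : Mat p} (hA : A.PosSemidef) (u v : Vec p) :
    cov[fun z => ⟪u, z⟫, fun z => ⟪v, z⟫; multivariateGaussian (0 : Vec p) A]
      = ⟪toEuclideanCLM (𝕜 := ℝ) A u, v⟫ := by
  rw [← covarianceBilin_apply_eq_cov IsGaussian.memLp_two_id,
    covarianceBilin_multivariateGaussian hA, inner_toEuclideanCLM_comm hA.1, inner_toEuclideanCLM]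

lemma integral_inner_mul_inner_gaussian {p : ℕ} {A : Mat p} (hA : A.PosSemidef) (u v : Vec p) :
    ∫ z, ⟪u, z⟫ * ⟪v, z⟫ ∂(multivariateGaussian (0 : Vec p) A)
      = ⟪toEuclideanCLM (𝕜 := ℝ) A u, v⟫ := by
  rw [← cov_inner_gaussian hA, covariance_eq_sub (memLp_inner_gaussian A u)
    (memLp_inner_gaussian A v)]
  simp [integral_inner_gaussian]

lemma hasGaussianLaw_inner {p : ℕ} (A : Mat p) (u : Vec p) :
    HasGaussianLaw (fun z => ⟪u, z⟫) (multivariateGaussian (0 : Vec p) A) :=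
  (IsGaussian.hasGaussianLaw_id (μ := multivariateGaussian (0 : Vec p) A)).map_fun (innerSL ℝ u)

lemma map_inner_gaussian {p : ℕ} {A : Mat p} (hA : A.PosSemidef) (u : Vec p) :
    (multivariateGaussian (0 : Vec p) A).map (fun z => ⟪u, z⟫)
      = gaussianReal 0 (⟪toEuclideanCLM (𝕜 := ℝ) A u, u⟫).toNNReal := by
  rw [(hasGaussianLaw_inner A u).map_eq_gaussianReal, integral_inner_gaussian,
    ← covariance_self (by fun_prop), cov_inner_gaussian hA]

/-- Stein's identity `E[z zᵀ h(⟨z, β⟩)] = E[h] A + E[h''] A β βᵀ A` for `z ~ N(0, A)`, as an identity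
of quadratic forms. -/
lemma stein_identity {p : ℕ} {A : Mat p} (hA : A.PosSemidef) {β : Vec p}
    (hβ : β ≠ 0 → 0 < ⟪toEuclideanCLM (𝕜 := ℝ) A β, β⟫) (v : Vec p) {h h' h'' : ℝ → ℝ}
    (hh : ∀ x, HasDerivAt h (h' x) x) (hh' : ∀ x, HasDerivAt h' (h'' x) x)
    (hh'' : Continuous h'') {C : ℝ} (hC : ∀ x, |h x| ≤ C) (hC' : ∀ x, |h' x| ≤ C)
    (hC'' : ∀ x, |h'' x| ≤ C) :
    ∫ z, ⟪v, z⟫ ^ 2 * h ⟪z, β⟫ ∂(multivariateGaussian (0 : Vec p) A)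
      = (∫ z, h ⟪z, β⟫ ∂(multivariateGaussian (0 : Vec p) A)) * ⟪toEuclideanCLM (𝕜 := ℝ) A v, v⟫
        + (∫ z, h'' ⟪z, β⟫ ∂(multivariateGaussian (0 : Vec p) A)) *
            ⟪toEuclideanCLM (𝕜 := ℝ) A β, v⟫ ^ 2 := by
  have c : Continuous h := continuous_iff_continuousAt.2 fun x => (hh x).continuousAt
  set γ := multivariateGaussian (0 : Vec p) A with hγ
  by_cases hβ0 : β = 0
  · subst hβ0
    simp only [inner_zero_right, map_zero, inner_zero_left, integral_const, probReal_univ,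
      one_smul, integral_mul_const]
    have := integral_inner_mul_inner_gaussian hA v v
    rw [← hγ] at this
    simp only [← sq] at this
    rw [this]; ring
  have hs := hβ hβ0
  set s := ⟪toEuclideanCLM (𝕜 := ℝ) A β, β⟫ with hs_def
  set k := ⟪toEuclideanCLM (𝕜 := ℝ) A β, v⟫ with hk_def
  -- The residual of regressing ⟪v, z⟫ on ⟪β, z⟫. It is uncorrelated with ⟪β, z⟫, hence independent
  -- by joint Gaussianity, which reduces the identity to dimension one.
  set w : Vec p := v - (k / s) • β with hw
  have hAβw : ⟪toEuclideanCLM (𝕜 := ℝ) A β, w⟫ = 0 := by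
    rw [hw, inner_sub_right, inner_smul_right, ← hs_def, ← hk_def, div_mul_cancel₀ _ hs.ne',
      sub_self]
  have hind : IndepFun (fun z => ⟪β, z⟫) (fun z => ⟪w, z⟫) γ := by
    refine HasGaussianLaw.indepFun_of_covariance_eq_zero ?_ ?_
    · exact (IsGaussian.hasGaussianLaw_id (μ := γ)).map_fun ((innerSL ℝ β).prod (innerSL ℝ w))
    · rw [cov_inner_gaussian hA, hAβw]
  have hW2 : ∫ z, ⟪w, z⟫ ^ 2 ∂γ = ⟪toEuclideanCLM (𝕜 := ℝ) A v, v⟫ - k ^ 2 / s := by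
    have := integral_inner_mul_inner_gaussian hA w w
    rw [← hγ] at this
    simp only [← sq] at this
    rw [this]
    conv_lhs => rw [hw, inner_sub_right, inner_smul_right]
    rw [map_sub, map_smul, inner_sub_left, inner_sub_left, inner_smul_left, inner_smul_left,
      ← hk_def, ← hs_def, conj_trivial, inner_toEuclideanCLM_comm hA.1 v β, real_inner_comm _ v,
      ← hk_def]
    field_simp
    ring
  have hmap := map_inner_gaussian hA β
  rw [← hγ, ← hs_def] at hmap
  have hpush : ∀ f : ℝ → ℝ, Continuous f →
      ∫ z, f ⟪β, z⟫ ∂γ = ∫ x, f x ∂(gaussianReal 0 s.toNNReal) := fun f hf => by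
    rw [← hmap, integral_map (by fun_prop) hf.aestronglyMeasurable]
  have hpushi : ∀ f : ℝ → ℝ, Continuous f → Integrable f (gaussianReal 0 s.toNNReal) →
      Integrable (fun z => f ⟪β, z⟫) γ := fun f hf hfi => by
    rw [← hmap] at hfi
    exact hfi.comp_measurable (by fun_prop)
  have i0 := hpushi h c (by simpa using integrable_pow_mul_bdd_gaussianReal s.toNNReal 0 c hC)
  have i1 := hpushi (fun x => x * h x) (by fun_prop)
    (by simpa using integrable_pow_mul_bdd_gaussianReal s.toNNReal 1 c hC)
  have i2 := hpushi (fun x => x ^ 2 * h x) (by fun_prop)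
    (integrable_pow_mul_bdd_gaussianReal s.toNNReal 2 c hC)
  have iw1 : Integrable (fun z => ⟪w, z⟫) γ := (memLp_inner_gaussian A w).integrable (by simp)
  have iw2 : Integrable (fun z => ⟪w, z⟫ ^ 2) γ := (memLp_inner_gaussian A w).integrable_sq
  have ind1 : IndepFun (fun z => ⟪β, z⟫ * h ⟪β, z⟫) (fun z => ⟪w, z⟫) γ :=
    hind.comp (φ := fun x => x * h x) (ψ := fun x => x) (by fun_prop) (by fun_prop)
  have ind2 : IndepFun (fun z => h ⟪β, z⟫) (fun z => ⟪w, z⟫ ^ 2) γ :=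
    hind.comp (φ := h) (ψ := fun x => x ^ 2) c.measurable (by fun_prop)
  have e1 := ind1.integral_fun_mul_eq_mul_integral i1.aestronglyMeasurable iw1.aestronglyMeasurable
  have e2 := ind2.integral_fun_mul_eq_mul_integral i0.aestronglyMeasurable iw2.aestronglyMeasurable
  have j1 : Integrable (fun z => ⟪β, z⟫ * h ⟪β, z⟫ * ⟪w, z⟫) γ := ind1.integrable_mul i1 iw1
  have j2 : Integrable (fun z => h ⟪β, z⟫ * ⟪w, z⟫ ^ 2) γ := ind2.integrable_mul i0 iw2
  have hdecomp : ∀ z, ⟪v, z⟫ ^ 2 * h ⟪z, β⟫ = (k / s) ^ 2 * (⟪β, z⟫ ^ 2 * h ⟪β, z⟫)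
      + 2 * (k / s) * (⟪β, z⟫ * h ⟪β, z⟫ * ⟪w, z⟫) + h ⟪β, z⟫ * ⟪w, z⟫ ^ 2 := fun z => by
    have : ⟪v, z⟫ = (k / s) * ⟪β, z⟫ + ⟪w, z⟫ := by
      rw [hw, inner_sub_left, inner_smul_left, conj_trivial]; ring
    rw [this, real_inner_comm β z]
    ring
  simp_rw [hdecomp]
  have j3 : Integrable (fun z => (k / s) ^ 2 * (⟪β, z⟫ ^ 2 * h ⟪β, z⟫)
      + 2 * (k / s) * (⟪β, z⟫ * h ⟪β, z⟫ * ⟪w, z⟫)) γ := (i2.const_mul _).add (j1.const_mul _)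
  rw [integral_add j3 j2,
    integral_add (i2.const_mul _) (j1.const_mul _), integral_const_mul, integral_const_mul, e1, e2,
    hW2, integral_inner_gaussian, hpush (fun x => x ^ 2 * h x) (by fun_prop),
    integral_sq_mul_gaussianReal _ hh hh' hh'' hC hC' hC'']
  simp_rw [real_inner_comm β]
  rw [hpush h c, hpush h'' hh'', Real.coe_toNNReal _ hs.le]
  field_simp
  ring

/-! ### Moments of sub-gaussian vectors -/

section Moments

variable {p : ℕ} {ν : Measure (Vec p)} {K : ℝ}

lemma eLpNorm_inner_le (hK : 0 ≤ K) (hν : subGaussianNorm ν ≤ ENNReal.ofReal K) {u : Vec p}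
    (hu : ‖u‖ = 1) {m : ℝ} (hm : 1 ≤ m) :
    eLpNorm (fun x => ⟪x, u⟫) (ENNReal.ofReal m) ν ≤ ENNReal.ofReal (K * √m) := by
  have h1 : psiTwoNorm (fun x => ⟪x, u⟫) ν ≤ ENNReal.ofReal K :=
    (le_iSup (fun v : Metric.sphere (0 : Vec p) 1 => psiTwoNorm (fun x => ⟪x, (v : Vec p)⟫) ν)
      ⟨u, by simpa using hu⟩).trans hν
  have h2 := (le_iSup (fun m : {m : ℝ // 1 ≤ m} => eLpNorm (fun x => ⟪x, u⟫)
    (ENNReal.ofReal m) ν / ENNReal.ofReal (Real.sqrt m)) ⟨m, hm⟩).trans h1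
  have hs : 0 < √m := Real.sqrt_pos.2 (by linarith)
  rw [ENNReal.div_le_iff (by simpa using hs) ENNReal.ofReal_ne_top] at h2
  rwa [ENNReal.ofReal_mul hK]

/-- The even moments of a sub-gaussian vector. -/
lemma lintegral_inner_pow_le [IsProbabilityMeasure ν] (hK : 0 ≤ K)
    (hν : subGaussianNorm ν ≤ ENNReal.ofReal K) (v : Vec p) (k : ℕ) :
    ∫⁻ x, ENNReal.ofReal (⟪x, v⟫ ^ (2 * k)) ∂ν
      ≤ ENNReal.ofReal ((2 * K ^ 2 * k * ‖v‖ ^ 2) ^ k) := by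
  rcases Nat.eq_zero_or_pos k with rfl | hk
  · simp
  have unit : ∀ u : Vec p, ‖u‖ = 1 → ∫⁻ x, ENNReal.ofReal (⟪x, u⟫ ^ (2 * k)) ∂ν
      ≤ ENNReal.ofReal ((2 * K ^ 2 * k) ^ k) := by
    intro u hu
    have hm : (1 : ℝ) ≤ ((2 * k : ℕ) : ℝ) := by exact_mod_cast (by omega : 1 ≤ 2 * k)
    have h := eLpNorm_inner_le hK hν hu hm
    have hpos : (0 : ℝ) < ((2 * k : ℕ) : ℝ) := by linarith
    rw [eLpNorm_eq_lintegral_rpow_enorm_toReal (by simpa using hk.ne') ENNReal.ofReal_ne_top,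
      ENNReal.toReal_ofReal hpos.le, one_div, ENNReal.rpow_inv_le_iff hpos, ENNReal.rpow_natCast,
      ← ENNReal.ofReal_pow (by positivity)] at h
    have e1 : (K * √((2 * k : ℕ) : ℝ)) ^ (2 * k) = (2 * K ^ 2 * k) ^ k := by
      rw [pow_mul, mul_pow, Real.sq_sqrt hpos.le]
      push_cast
      ring
    rw [e1] at h
    refine le_trans (lintegral_mono fun x => ?_) h
    rw [ENNReal.rpow_natCast, Real.enorm_eq_ofReal_abs, ← ENNReal.ofReal_pow (abs_nonneg _)]
    refine ENNReal.ofReal_le_ofReal ?_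
    rw [← abs_pow]
    exact le_abs_self _
  by_cases hv : v = 0
  · subst hv
    simp [hk.ne']
  have hv' : 0 < ‖v‖ := norm_pos_iff.2 hv
  have h1 := unit (‖v‖⁻¹ • v) (by rw [norm_smul, norm_inv, norm_norm, inv_mul_cancel₀ hv'.ne'])
  calc ∫⁻ x, ENNReal.ofReal (⟪x, v⟫ ^ (2 * k)) ∂ν
      = ∫⁻ x, ENNReal.ofReal (‖v‖ ^ (2 * k)) *
          ENNReal.ofReal (⟪x, ‖v‖⁻¹ • v⟫ ^ (2 * k)) ∂ν := by
        refine lintegral_congr fun x => ?_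
        rw [← ENNReal.ofReal_mul (by positivity), ← mul_pow, inner_smul_right,
          mul_inv_cancel_left₀ hv'.ne']
    _ = ENNReal.ofReal (‖v‖ ^ (2 * k)) * ∫⁻ x, ENNReal.ofReal (⟪x, ‖v‖⁻¹ • v⟫ ^ (2 * k)) ∂ν :=
        lintegral_const_mul _ (by fun_prop)
    _ ≤ ENNReal.ofReal (‖v‖ ^ (2 * k)) * ENNReal.ofReal ((2 * K ^ 2 * k) ^ k) := by gcongr
    _ = _ := by
        rw [← ENNReal.ofReal_mul (by positivity)]
        congr 1
        rw [pow_mul, ← mul_pow]; ring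

lemma integrable_and_integral_le_of_lintegral {Ω : Type*} [MeasurableSpace Ω] {μ : Measure Ω}
    {f : Ω → ℝ} (hf : Measurable f) (h0 : ∀ x, 0 ≤ f x) {C : ℝ} (hC : 0 ≤ C)
    (h : ∫⁻ x, ENNReal.ofReal (f x) ∂μ ≤ ENNReal.ofReal C) :
    Integrable f μ ∧ ∫ x, f x ∂μ ≤ C := by
  refine ⟨⟨hf.aestronglyMeasurable, ?_⟩, ?_⟩
  · rw [hasFiniteIntegral_iff_ofReal (.of_forall h0)]
    exact h.trans_lt ENNReal.ofReal_lt_top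
  · rw [integral_eq_lintegral_of_nonneg_ae (.of_forall h0) hf.aestronglyMeasurable]
    exact ENNReal.toReal_le_of_le_ofReal hC h

lemma integral_inner_sq_le [IsProbabilityMeasure ν] (hK : 0 ≤ K)
    (hν : subGaussianNorm ν ≤ ENNReal.ofReal K) (v : Vec p) :
    Integrable (fun x => ⟪x, v⟫ ^ 2) ν ∧ ∫ x, ⟪x, v⟫ ^ 2 ∂ν ≤ 2 * K ^ 2 * ‖v‖ ^ 2 := by
  refine integrable_and_integral_le_of_lintegral (by fun_prop) (fun x => sq_nonneg _)
    (by positivity) ?_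
  simpa using lintegral_inner_pow_le hK hν v 1

lemma integral_inner_pow_four_le [IsProbabilityMeasure ν] (hK : 0 ≤ K)
    (hν : subGaussianNorm ν ≤ ENNReal.ofReal K) (v : Vec p) :
    Integrable (fun x => ⟪x, v⟫ ^ 4) ν ∧ ∫ x, ⟪x, v⟫ ^ 4 ∂ν ≤ 16 * K ^ 4 * ‖v‖ ^ 4 := by
  refine integrable_and_integral_le_of_lintegral (by fun_prop) (fun x => by positivity)
    (by positivity) ?_
  have := lintegral_inner_pow_le hK hν v 2
  norm_num at this
  convert this using 2
  ring

/-- The square of a sub-gaussian variable has exponential moments. -/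
lemma integral_exp_inner_sq_le [IsProbabilityMeasure ν] (hK : 0 < K)
    (hν : subGaussianNorm ν ≤ ENNReal.ofReal K) {v : Vec p} (hv : ‖v‖ ≤ 1) :
    Integrable (fun x => Real.exp (⟪x, v⟫ ^ 2 / (12 * K ^ 2))) ν ∧
      ∫ x, Real.exp (⟪x, v⟫ ^ 2 / (12 * K ^ 2)) ∂ν ≤ 2 := by
  refine integrable_and_integral_le_of_lintegral (by fun_prop) (fun x => (Real.exp_pos _).le)
    (by norm_num) ?_
  have hterm : ∀ k : ℕ, ∫⁻ x, ENNReal.ofReal ((⟪x, v⟫ ^ 2 / (12 * K ^ 2)) ^ k / k.factorial) ∂ν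
      ≤ ENNReal.ofReal ((1 / 2) ^ k) := fun k => by
    have e : ∀ x : Vec p, (⟪x, v⟫ ^ 2 / (12 * K ^ 2)) ^ k / k.factorial
        = ((12 * K ^ 2) ^ k * k.factorial)⁻¹ * ⟪x, v⟫ ^ (2 * k) := fun x => by
      rw [div_pow, ← pow_mul]; field_simp
    simp_rw [e]
    have : ∀ x : Vec p, ENNReal.ofReal (((12 * K ^ 2) ^ k * k.factorial)⁻¹ * ⟪x, v⟫ ^ (2 * k))
        = ENNReal.ofReal (((12 * K ^ 2) ^ k * k.factorial)⁻¹)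
          * ENNReal.ofReal (⟪x, v⟫ ^ (2 * k)) := fun x => ENNReal.ofReal_mul (by positivity)
    simp_rw [this]
    rw [lintegral_const_mul _ (by fun_prop)]
    refine (mul_le_mul_right (lintegral_inner_pow_le hK.le hν v k) _).trans ?_
    rw [← ENNReal.ofReal_mul (by positivity)]
    refine ENNReal.ofReal_le_ofReal ?_
    -- This fixes the scale 12K² = 6 · 2K²: the k-th term of the exponential series is at most
    -- (1/6)^k · 3^k = 2^{-k}, and these sum to 2.
    have hkk : (k : ℝ) ^ k / k.factorial ≤ 3 ^ k := by
      refine (Real.pow_div_factorial_le_exp (k : ℝ) (by positivity) k).trans ?_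
      rw [← Real.exp_one_pow]
      gcongr
      linarith [Real.exp_one_lt_d9]
    calc ((12 * K ^ 2) ^ k * k.factorial)⁻¹ * (2 * K ^ 2 * k * ‖v‖ ^ 2) ^ k
        ≤ ((12 * K ^ 2) ^ k * k.factorial)⁻¹ * (2 * K ^ 2 * k * 1 ^ 2) ^ k := by gcongr
      _ = (1 / 6) ^ k * ((k : ℝ) ^ k / k.factorial) := by
          have : (12 * K ^ 2) ^ k = 6 ^ k * (2 * K ^ 2) ^ k := by rw [← mul_pow]; ring
          rw [this, one_pow, mul_one, mul_pow _ (k : ℝ), div_pow, one_pow]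
          field_simp
      _ ≤ (1 / 6) ^ k * 3 ^ k := by gcongr
      _ = (1 / 2) ^ k := by rw [← mul_pow]; norm_num
  have hexp : ∀ x : Vec p, ENNReal.ofReal (Real.exp (⟪x, v⟫ ^ 2 / (12 * K ^ 2)))
      = ∑' k : ℕ, ENNReal.ofReal ((⟪x, v⟫ ^ 2 / (12 * K ^ 2)) ^ k / k.factorial) := fun x => by
    rw [← ENNReal.ofReal_tsum_of_nonneg (fun k => by positivity)
      (Real.summable_pow_div_factorial _), Real.exp_eq_exp_ℝ, NormedSpace.exp_eq_tsum_div]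
  simp_rw [hexp]
  rw [lintegral_tsum (fun k => by fun_prop)]
  refine (ENNReal.tsum_le_tsum hterm).trans ?_
  rw [← ENNReal.ofReal_tsum_of_nonneg (fun k => by positivity) summable_geometric_two,
    tsum_geometric_two]

/-- Cauchy–Schwarz over the coordinates. It reduces fourth moments of the norm to those of single
coordinates. -/
lemma norm_pow_four_le {p : ℕ} (x : Vec p) : ‖x‖ ^ 4 ≤ p * ∑ j, x j ^ 4 := by
  have h1 : ‖x‖ ^ 4 = (∑ j, x j ^ 2) ^ 2 := by
    rw [← EuclideanSpace.real_norm_sq_eq]; ring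
  have h2 := sq_sum_le_card_mul_sum_sq (s := Finset.univ) (f := fun j => x j ^ 2)
  rw [h1]
  refine h2.trans_eq ?_
  simp [← pow_mul]

lemma inner_single_one {p : ℕ} (x : Vec p) (j : Fin p) :
    ⟪x, EuclideanSpace.single j (1 : ℝ)⟫ = x j := by
  simp [PiLp.inner_apply]

lemma integral_norm_pow_four_le [IsProbabilityMeasure ν] (hK : 0 ≤ K)
    (hν : subGaussianNorm ν ≤ ENNReal.ofReal K) :
    Integrable (fun x => ‖x‖ ^ 4) ν ∧ ∫ x, ‖x‖ ^ 4 ∂ν ≤ 16 * K ^ 4 * p ^ 2 := by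
  have h : ∀ j : Fin p, Integrable (fun x : Vec p => x j ^ 4) ν ∧
      ∫ x, x j ^ 4 ∂ν ≤ 16 * K ^ 4 := fun j => by
    simpa [inner_single_one] using
      integral_inner_pow_four_le hK hν (EuclideanSpace.single j (1 : ℝ))
  have hi : Integrable (fun x : Vec p => (p : ℝ) * ∑ j, x j ^ 4) ν :=
    (integrable_finsetSum _ fun j _ => (h j).1).const_mul _
  refine ⟨hi.mono' (by fun_prop) (.of_forall fun x => ?_), ?_⟩
  · rw [Real.norm_of_nonneg (by positivity)]
    exact norm_pow_four_le x
  · refine (integral_mono_of_nonneg (.of_forall fun x => by positivity) hi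
      (.of_forall norm_pow_four_le)).trans ?_
    rw [integral_const_mul, integral_finsetSum _ fun j _ => (h j).1]
    calc (p : ℝ) * ∑ j, ∫ x, x j ^ 4 ∂ν ≤ p * ∑ j : Fin p, 16 * K ^ 4 := by
          gcongr with j; exact (h j).2
      _ = _ := by simp; ring

lemma memLp_inner [IsProbabilityMeasure ν] (hK : 0 ≤ K)
    (hν : subGaussianNorm ν ≤ ENNReal.ofReal K) (v : Vec p) : MemLp (fun x => ⟪x, v⟫) 2 ν :=
  (memLp_two_iff_integrable_sq (by fun_prop)).2 (integral_inner_sq_le hK hν v).1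

/-- The matrix `E[h(x) x xᵀ]`. -/
def weightedMoment {p : ℕ} (ν : Measure (Vec p)) (h : Vec p → ℝ) : Mat p :=
  Matrix.of fun i j => ∫ x, h x * (x i * x j) ∂ν

lemma isHermitian_weightedMoment (h : Vec p → ℝ) : (weightedMoment ν h).IsHermitian := by
  ext i j
  simp [weightedMoment, mul_comm]

lemma inner_weightedMoment [IsProbabilityMeasure ν] (hK : 0 ≤ K)
    (hν : subGaussianNorm ν ≤ ENNReal.ofReal K) {h : Vec p → ℝ} (hh : Measurable h) {C : ℝ}
    (hC : ∀ x, |h x| ≤ C) (u v : Vec p) :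
    ⟪toEuclideanCLM (𝕜 := ℝ) (weightedMoment ν h) u, v⟫ = ∫ x, h x * (⟪x, u⟫ * ⟪x, v⟫) ∂ν := by
  have hint : ∀ i j : Fin p, Integrable (fun x : Vec p => h x * (x i * x j)) ν := fun i j => by
    have h1 := (memLp_inner hK hν (EuclideanSpace.single i (1 : ℝ))).integrable_mul
      (memLp_inner hK hν (EuclideanSpace.single j (1 : ℝ)))
    simp only [inner_single_one] at h1
    exact h1.bdd_mul (c := C) hh.aestronglyMeasurable (.of_forall hC)
  have e : ∀ x : Vec p, h x * (⟪x, u⟫ * ⟪x, v⟫)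
      = ∑ i, ∑ j, v i * u j * (h x * (x i * x j)) := fun x => by
    simp only [PiLp.inner_apply, RCLike.inner_apply, conj_trivial]
    rw [mul_comm (∑ _, _) (∑ _, _), Finset.sum_mul_sum, Finset.mul_sum]
    refine Finset.sum_congr rfl fun i _ => ?_
    rw [Finset.mul_sum]
    exact Finset.sum_congr rfl fun j _ => by ring
  simp_rw [e]
  rw [integral_finsetSum _ fun i _ => integrable_finsetSum _ fun j _ => (hint i j).const_mul _]
  rw [real_inner_comm, inner_toEuclideanCLM]
  simp only [dotProduct, mulVec, Finset.mul_sum]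
  refine Finset.sum_congr rfl fun i _ => ?_
  rw [integral_finsetSum _ fun j _ => (hint i j).const_mul _]
  refine Finset.sum_congr rfl fun j _ => ?_
  rw [integral_const_mul]
  simp only [weightedMoment, of_apply]
  ring

lemma secondMoment_eq_weightedMoment : secondMoment ν = weightedMoment ν fun _ => 1 := by
  ext i j
  simp [secondMoment, weightedMoment]

lemma inner_secondMoment [IsProbabilityMeasure ν] (hK : 0 ≤ K)
    (hν : subGaussianNorm ν ≤ ENNReal.ofReal K) (u v : Vec p) :
    ⟪toEuclideanCLM (𝕜 := ℝ) (secondMoment ν) u, v⟫ = ∫ x, ⟪x, u⟫ * ⟪x, v⟫ ∂ν := by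
  rw [secondMoment_eq_weightedMoment, inner_weightedMoment hK hν measurable_const (C := 1) (by simp)]
  simp

lemma norm_secondMoment_le [IsProbabilityMeasure ν] (hK : 0 ≤ K)
    (hν : subGaussianNorm ν ≤ ENNReal.ofReal K) :
    ‖toEuclideanCLM (𝕜 := ℝ) (secondMoment ν)‖ ≤ 2 * K ^ 2 := by
  refine opNorm_le_of_unit (inner_toEuclideanCLM_comm ?_) (by positivity) fun v hv => ?_
  · rw [secondMoment_eq_weightedMoment]; exact isHermitian_weightedMoment _
  · rw [inner_secondMoment hK hν]
    simp only [← sq]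
    rw [abs_of_nonneg (integral_nonneg fun x => sq_nonneg _)]
    simpa [hv] using (integral_inner_sq_le hK hν v).2

end Moments

/-! ### Concentration of empirical means -/

section Chernoff

variable {E : Type*} [MeasurableSpace E] {ν : Measure E} [IsProbabilityMeasure ν]
  {Ω : Type*} [MeasurableSpace Ω] {P : Measure Ω} [IsProbabilityMeasure P]
  {ι : Type*} {x : ι → Ω → E}

omit [IsProbabilityMeasure ν] in
/-- Chernoff's bound for sums of functions of i.i.d. variables. -/
lemma chernoff_iid (hx : ∀ i, Measurable (x i)) (hind : iIndepFun x P)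
    (hlaw : ∀ i, P.map (x i) = ν) {g : E → ℝ} (hg : Measurable g) {l c : ℝ} (hl : 0 ≤ l)
    (hint : Integrable (fun z => Real.exp (l * g z)) ν)
    (hc : ∫ z, Real.exp (l * g z) ∂ν ≤ Real.exp c) (T : Finset ι) (ε : ℝ) :
    P.real {ω | ε ≤ ∑ i ∈ T, g (x i ω)} ≤ Real.exp (-l * ε + T.card * c) := by
  have hY : iIndepFun (fun i => g ∘ x i) P := hind.comp (fun _ => g) fun _ => hg
  have hYm : ∀ i, Measurable (g ∘ x i) := fun i => hg.comp (hx i)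
  have hYi : ∀ i, Integrable (fun ω => Real.exp (l * (g ∘ x i) ω)) P := fun i => by
    rw [← hlaw i] at hint
    exact hint.comp_measurable (hx i)
  have hmgf : ∀ i, mgf (g ∘ x i) P l ≤ Real.exp c := fun i => by
    refine le_trans (le_of_eq ?_) hc
    rw [← hlaw i, integral_map (hx i).aemeasurable (by fun_prop)]
    rfl
  have h := measure_ge_le_exp_mul_mgf (X := ∑ i ∈ T, g ∘ x i) (μ := P) (t := l) ε hl
    (hY.integrable_exp_mul_sum hYm fun i _ => hYi i)
  rw [hY.mgf_sum hYm] at h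
  simp only [Finset.sum_apply, Function.comp_apply] at h
  refine h.trans ?_
  rw [Real.exp_add]
  gcongr
  rw [Real.exp_nat_mul, ← Finset.prod_const]
  exact Finset.prod_le_prod (fun i _ => mgf_nonneg) fun i _ => hmgf i

/-- `f` has a two-sided exponential moment at scale `lam⁻¹`. -/
structure HasExpMoment (f : E → ℝ) (lam : ℝ) (ν : Measure E) : Prop where
  measurable : Measurable f
  integrable : Integrable (fun z => Real.exp (2 * lam * |f z|)) ν
  integral_le : ∫ z, Real.exp (2 * lam * |f z|) ∂ν ≤ 2

omit [IsProbabilityMeasure ν] in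
lemma HasExpMoment.neg {f : E → ℝ} {lam : ℝ} (h : HasExpMoment f lam ν) :
    HasExpMoment (fun z => -f z) lam ν :=
  ⟨h.measurable.neg, by simpa using h.integrable, by simpa using h.integral_le⟩

omit [IsProbabilityMeasure ν] in
lemma HasExpMoment.of_le {f g : E → ℝ} {lam : ℝ} (hf : Measurable f)
    (hg : Integrable (fun z => Real.exp (g z)) ν) (hg2 : ∫ z, Real.exp (g z) ∂ν ≤ 2)
    (h : ∀ z, 2 * lam * |f z| ≤ g z) : HasExpMoment f lam ν := by
  have hi : Integrable (fun z => Real.exp (2 * lam * |f z|)) ν :=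
    hg.mono' (by fun_prop) (.of_forall fun z => by
      rw [Real.norm_of_nonneg (Real.exp_pos _).le]
      exact Real.exp_le_exp.2 (h z))
  exact ⟨hf, hi, (integral_mono hi hg fun z => Real.exp_le_exp.2 (h z)).trans hg2⟩

/-- The second-order Taylor remainder of the exponential, on the whole line; it keeps the linear
term, which centring will cancel. -/
lemma exp_le_one_add (w : ℝ) : Real.exp w ≤ 1 + w + w ^ 2 * Real.exp |w| := by
  have h := Complex.norm_exp_sub_sum_le_norm_mul_exp (w : ℂ) 2
  rw [Finset.sum_range_succ, Finset.sum_range_one] at h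
  have e : Complex.exp w - ((w : ℂ) ^ 0 / (Nat.factorial 0 : ℂ)
      + (w : ℂ) ^ 1 / (Nat.factorial 1 : ℂ)) = ((Real.exp w - (1 + w) : ℝ) : ℂ) := by
    push_cast; simp
  rw [e, Complex.norm_real, Complex.norm_real, Real.norm_eq_abs, Real.norm_eq_abs, sq_abs] at h
  linarith [(abs_le.1 h).2]

omit [IsProbabilityMeasure ν] in
lemma HasExpMoment.integrable_self {f : E → ℝ} {lam : ℝ} (hlam : 0 < lam)
    (h : HasExpMoment f lam ν) : Integrable f ν := by
  refine (h.integrable.const_mul (2 * lam)⁻¹).mono' h.measurable.aestronglyMeasurable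
    (.of_forall fun z => ?_)
  rw [Real.norm_eq_abs, le_inv_mul_iff₀ (by positivity)]
  linarith [Real.add_one_le_exp (2 * lam * |f z|)]

/-- In the second-order expansion of exp(l f), the quadratic factor and exp|l f| are each absorbed
by one factor exp(lam |f|), which is why `HasExpMoment` carries 2 * lam. The linear term integrates
to l m and is removed by exp(-l m). -/
lemma HasExpMoment.mgf_sub_le {f : E → ℝ} {lam l : ℝ} (hlam : 0 < lam)
    (h : HasExpMoment f lam ν) (hl : |l| ≤ lam) :
    Integrable (fun z => Real.exp (l * (f z - ∫ y, f y ∂ν))) ν ∧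
      ∫ z, Real.exp (l * (f z - ∫ y, f y ∂ν)) ∂ν ≤ Real.exp (4 * l ^ 2 / lam ^ 2) := by
  have hf := h.measurable
  have hfi := h.integrable_self hlam
  set m := ∫ y, f y ∂ν
  have hpt : ∀ z, Real.exp (l * f z)
      ≤ 1 + l * f z + 2 * l ^ 2 / lam ^ 2 * Real.exp (2 * lam * |f z|) := fun z => by
    have h1 := exp_le_one_add (l * f z)
    have h2 : |l * f z| ≤ lam * |f z| := by rw [abs_mul]; gcongr
    have h3 : (lam * |f z|) ^ 2 ≤ 2 * Real.exp (lam * |f z|) := by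
      have := Real.quadratic_le_exp_of_nonneg (x := lam * |f z|) (by positivity)
      nlinarith [mul_nonneg hlam.le (abs_nonneg (f z))]
    have h4 : (l * f z) ^ 2 * Real.exp |l * f z|
        ≤ 2 * l ^ 2 / lam ^ 2 * Real.exp (2 * lam * |f z|) := by
      calc (l * f z) ^ 2 * Real.exp |l * f z|
          ≤ (l * f z) ^ 2 * Real.exp (lam * |f z|) := by gcongr
        _ = l ^ 2 / lam ^ 2 * ((lam * |f z|) ^ 2 * Real.exp (lam * |f z|)) := by
            rw [mul_pow, mul_pow, sq_abs]; field_simp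
        _ ≤ l ^ 2 / lam ^ 2 * (2 * Real.exp (lam * |f z|) * Real.exp (lam * |f z|)) := by gcongr
        _ = 2 * l ^ 2 / lam ^ 2 * Real.exp (2 * lam * |f z|) := by
            rw [mul_assoc 2, ← Real.exp_add]; ring_nf
    linarith
  have hint : Integrable (fun z => Real.exp (l * f z)) ν := by
    refine h.integrable.mono' (by fun_prop) (.of_forall fun z => ?_)
    rw [Real.norm_of_nonneg (Real.exp_pos _).le]
    refine Real.exp_le_exp.2 ((le_abs_self _).trans ?_)
    rw [abs_mul]
    gcongr
    linarith
  have e : ∀ z, Real.exp (l * (f z - m)) = Real.exp (-l * m) * Real.exp (l * f z) := fun z => by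
    rw [← Real.exp_add]; ring_nf
  simp_rw [e]
  refine ⟨hint.const_mul _, ?_⟩
  rw [integral_const_mul]
  have hi1 : Integrable (fun z => 1 + l * f z) ν := (integrable_const _).add (hfi.const_mul l)
  have hb : ∫ z, Real.exp (l * f z) ∂ν ≤ 1 + l * m + 4 * l ^ 2 / lam ^ 2 := by
    refine (integral_mono hint (hi1.add (h.integrable.const_mul (2 * l ^ 2 / lam ^ 2)))
      hpt).trans ?_
    simp only [Pi.add_apply]
    rw [integral_add hi1 (h.integrable.const_mul _), integral_add (integrable_const _)
      (hfi.const_mul l), integral_const_mul, integral_const_mul]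
    simp only [integral_const, probReal_univ, one_smul]
    have := mul_le_mul_of_nonneg_left h.integral_le (by positivity : 0 ≤ 2 * l ^ 2 / lam ^ 2)
    have e2 : 2 * l ^ 2 / lam ^ 2 * 2 = 4 * l ^ 2 / lam ^ 2 := by ring
    change 1 + l * m + _ ≤ _
    linarith
  calc Real.exp (-l * m) * ∫ z, Real.exp (l * f z) ∂ν
      ≤ Real.exp (-l * m) * Real.exp (l * m + 4 * l ^ 2 / lam ^ 2) := by
        gcongr
        refine hb.trans ?_
        linarith [Real.add_one_le_exp (l * m + 4 * l ^ 2 / lam ^ 2)]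
    _ = _ := by rw [← Real.exp_add]; ring_nf

lemma bernstein_one_sided (hx : ∀ i, Measurable (x i)) (hind : iIndepFun x P)
    (hlaw : ∀ i, P.map (x i) = ν) {f : E → ℝ} {lam t : ℝ} (hlam : 0 < lam)
    (hf : HasExpMoment f lam ν) (ht : 0 ≤ t) (ht' : t ≤ 8 / lam) (T : Finset ι)
    (hT : 0 < T.card) :
    P.real {ω | t ≤ (T.card : ℝ)⁻¹ * ∑ i ∈ T, f (x i ω) - ∫ z, f z ∂ν}
      ≤ Real.exp (-(T.card * lam ^ 2 * t ^ 2 / 16)) := by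
  set m := ∫ z, f z ∂ν
  have hc : (0 : ℝ) < T.card := by exact_mod_cast hT
  -- This value of l minimizes -l t + 4 l² / lam², with minimum -lam² t² / 16; the condition t ≤ 8 /
  -- lam says precisely that l ≤ lam.
  have hl0 : 0 ≤ lam ^ 2 * t / 8 := by positivity
  have hl : |lam ^ 2 * t / 8| ≤ lam := by
    rw [abs_of_nonneg hl0]
    rw [le_div_iff₀ hlam] at ht'
    nlinarith
  obtain ⟨h1, h2⟩ := hf.mgf_sub_le hlam hl
  have h := chernoff_iid hx hind hlaw (hf.measurable.sub_const m) hl0 h1 h2 T (T.card * t)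
  refine le_trans (le_of_eq ?_) (h.trans (Real.exp_le_exp.2 (le_of_eq ?_)))
  · congr 1
    ext ω
    simp only [Set.mem_ofPred_eq, Finset.sum_sub_distrib, Finset.sum_const, nsmul_eq_mul]
    rw [le_sub_iff_add_le, le_inv_mul_iff₀ hc, le_sub_iff_add_le, mul_add]
  · field_simp
    ring

/-- Bernstein's inequality. -/
lemma bernstein (hx : ∀ i, Measurable (x i)) (hind : iIndepFun x P)
    (hlaw : ∀ i, P.map (x i) = ν) {f : E → ℝ} {lam t : ℝ} (hlam : 0 < lam)
    (hf : HasExpMoment f lam ν) (ht : 0 ≤ t) (ht' : t ≤ 8 / lam) (T : Finset ι)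
    (hT : 0 < T.card) :
    P.real {ω | t ≤ |(T.card : ℝ)⁻¹ * ∑ i ∈ T, f (x i ω) - ∫ z, f z ∂ν|}
      ≤ 2 * Real.exp (-(T.card * lam ^ 2 * t ^ 2 / 16)) := by
  have h1 := bernstein_one_sided hx hind hlaw hlam hf ht ht' T hT
  have h2 := bernstein_one_sided hx hind hlaw hlam hf.neg ht ht' T hT
  have hsub : {ω | t ≤ |(T.card : ℝ)⁻¹ * ∑ i ∈ T, f (x i ω) - ∫ z, f z ∂ν|}
      ⊆ {ω | t ≤ (T.card : ℝ)⁻¹ * ∑ i ∈ T, f (x i ω) - ∫ z, f z ∂ν} ∪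
        {ω | t ≤ (T.card : ℝ)⁻¹ * ∑ i ∈ T, -f (x i ω) - ∫ z, -f z ∂ν} := by
    intro ω hω
    simp only [Set.mem_ofPred_eq, Set.mem_union, Finset.sum_neg_distrib, integral_neg,
      mul_neg] at hω ⊢
    rcases le_abs.1 hω with h | h
    · exact Or.inl h
    · right; linarith
  have := (measureReal_mono (μ := P) hsub (measure_ne_top _ _)).trans (measureReal_union_le _ _)
  linarith

end Chernoff

/-! ### Sub-gaussian samples: fourth moments and sample covariance -/

section SubGaussian

variable {p : ℕ} {ν : Measure (Vec p)} [IsProbabilityMeasure ν] {K : ℝ}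
  {Ω : Type*} [MeasurableSpace Ω] {P : Measure Ω} [IsProbabilityMeasure P]
  {n : ℕ} {x : Fin n → Ω → Vec p}

/-- The exponent is dominated by ⟪z, v⟫² / (12 K²). Using K² + 1 instead of K² gives a scale that
also serves bounded functions, however small K is. -/
lemma hasExpMoment_sq (hK : 0 < K) (hν : subGaussianNorm ν ≤ ENNReal.ofReal K) {M : ℝ}
    (hM : 0 < M) {v : Vec p} (hv : ‖v‖ ≤ 1) {g : Vec p → ℝ} (hg : Measurable g)
    (hgM : ∀ x, |g x| ≤ M) :
    HasExpMoment (fun x => ⟪v, x⟫ ^ 2 * g x) (1 / (24 * (K ^ 2 + 1) * M)) ν := by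
  obtain ⟨h1, h2⟩ := integral_exp_inner_sq_le hK hν hv
  refine HasExpMoment.of_le (by fun_prop) h1 h2 fun z => ?_
  rw [abs_mul, abs_of_nonneg (sq_nonneg _), real_inner_comm]
  calc 2 * (1 / (24 * (K ^ 2 + 1) * M)) * (⟪z, v⟫ ^ 2 * |g z|)
      ≤ 2 * (1 / (24 * (K ^ 2 + 1) * M)) * (⟪z, v⟫ ^ 2 * M) := by gcongr; exact hgM z
    _ = ⟪z, v⟫ ^ 2 / (12 * (K ^ 2 + 1)) := by field_simp; ring
    _ ≤ ⟪z, v⟫ ^ 2 / (12 * K ^ 2) := by gcongr; linarith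

/-- At this scale the exponent is at most 1/2, and e^{1/2} ≤ 2. The factor 1 is the trivial weight
in `uniform_deviation`. -/
lemma hasExpMoment_bdd (K : ℝ) {M : ℝ}
    (hM : 0 < M) {g : Vec p → ℝ} (hg : Measurable g) (hgM : ∀ x, |g x| ≤ M) :
    HasExpMoment (fun x => 1 * g x) (1 / (24 * (K ^ 2 + 1) * M)) ν := by
  refine HasExpMoment.of_le (g := fun _ => 1 / 2) (by fun_prop) (integrable_const _) ?_ fun z => ?_
  · have h1 : Real.exp (1 / 2) ≤ 2 := by
      have h2 : Real.exp (1 / 2) ^ 2 < 2 ^ 2 := by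
        rw [← Real.exp_nat_mul]
        norm_num
        linarith [Real.exp_one_lt_d9]
      exact (lt_of_pow_lt_pow_left₀ 2 (by norm_num) h2).le
    simpa using h1
  · rw [one_mul]
    calc 2 * (1 / (24 * (K ^ 2 + 1) * M)) * |g z| ≤ 2 * (1 / (24 * (K ^ 2 + 1) * M)) * M := by
          gcongr; exact hgM z
      _ = 1 / (12 * (K ^ 2 + 1)) := by field_simp; norm_num
      _ ≤ 1 / 2 := by
          gcongr
          nlinarith [sq_nonneg K]

/-- High-probability bound for the fourth empirical moment of a single coordinate. -/
lemma fourth_moment_coord (hK : 0 < K) (hν : subGaussianNorm ν ≤ ENNReal.ofReal K)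
    (hx : ∀ i, Measurable (x i)) (hind : iIndepFun x P) (hlaw : ∀ i, P.map (x i) = ν)
    {v : Vec p} (hv : ‖v‖ ≤ 1) {N : ℝ} (hN : 1 ≤ N) (hn : (n : ℝ) = N ^ 5) :
    P.real {ω | 3 * (16 * K ^ 4 + 1) * n ≤ ∑ i, ⟪x i ω, v⟫ ^ 4}
      ≤ Real.exp (-N) + n * Real.exp (1 - N ^ 2 / (12 * K ^ 2)) := by
  set m₀ := 16 * K ^ 4 + 1 with hm₀
  have hm1 : 1 ≤ m₀ := by rw [hm₀]; linarith [pow_pos hK 4]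
  have hN0 : 0 < N := by linarith
  have h4 := integral_inner_pow_four_le hK.le hν v
  have hEm : ∫ z, ⟪z, v⟫ ^ 4 ∂ν ≤ m₀ := by
    refine h4.2.trans ?_
    calc 16 * K ^ 4 * ‖v‖ ^ 4 ≤ 16 * K ^ 4 * 1 ^ 4 := by gcongr
      _ ≤ m₀ := by rw [hm₀]; linarith
  -- Truncation at N⁴ allows Chernoff with parameter N⁻⁴, where exp(y) ≤ 1 + 2y is available on [0,
  -- 1].
  set g : Vec p → ℝ := fun z => min (⟪z, v⟫ ^ 4) (N ^ 4) with hg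
  have hgm : Measurable g := by fun_prop
  have hg0 : ∀ z, 0 ≤ g z := fun z => le_min (by positivity) (by positivity)
  have hgN : ∀ z, (N ^ 4)⁻¹ * g z ≤ 1 := fun z => by
    rw [inv_mul_le_iff₀ (by positivity), mul_one]; exact min_le_right _ _
  have hpt : ∀ z, Real.exp ((N ^ 4)⁻¹ * g z) ≤ 1 + 2 * ((N ^ 4)⁻¹ * ⟪z, v⟫ ^ 4) := fun z => by
    have h0 : 0 ≤ (N ^ 4)⁻¹ * g z := mul_nonneg (by positivity) (hg0 z)
    have := Real.abs_exp_sub_one_le (x := (N ^ 4)⁻¹ * g z) (by rw [abs_of_nonneg h0]; exact hgN z)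
    rw [abs_of_nonneg h0] at this
    have h2 : (N ^ 4)⁻¹ * g z ≤ (N ^ 4)⁻¹ * ⟪z, v⟫ ^ 4 := by gcongr; exact min_le_left _ _
    linarith [(abs_le.1 this).2]
  have hint : Integrable (fun z => Real.exp ((N ^ 4)⁻¹ * g z)) ν := by
    refine (integrable_const (Real.exp 1)).mono' (by fun_prop) (.of_forall fun z => ?_)
    rw [Real.norm_of_nonneg (Real.exp_pos _).le]
    exact Real.exp_le_exp.2 (hgN z)
  have hc : ∫ z, Real.exp ((N ^ 4)⁻¹ * g z) ∂ν ≤ Real.exp (2 * ((N ^ 4)⁻¹ * m₀)) := by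
    refine (integral_mono hint ((integrable_const _).add ((h4.1.const_mul _).const_mul _))
      hpt).trans ?_
    simp only [Pi.add_apply]
    rw [integral_add (integrable_const _) ((h4.1.const_mul _).const_mul _), integral_const_mul,
      integral_const_mul]
    simp only [integral_const, probReal_univ, one_smul]
    have : 2 * ((N ^ 4)⁻¹ * ∫ z, ⟪z, v⟫ ^ 4 ∂ν) ≤ 2 * ((N ^ 4)⁻¹ * m₀) := by gcongr
    linarith [Real.add_one_le_exp (2 * ((N ^ 4)⁻¹ * m₀))]
  -- As n = N⁵, the exponent is -3 m₀ N + 2 m₀ N = -m₀ N, and m₀ ≥ 1.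
  have b1 : P.real {ω | 3 * m₀ * n ≤ ∑ i, g (x i ω)} ≤ Real.exp (-N) := by
    refine (chernoff_iid hx hind hlaw hgm (by positivity) hint hc Finset.univ _).trans
      (Real.exp_le_exp.2 ?_)
    rw [Finset.card_univ, Fintype.card_fin, hn]
    have : -(N ^ 4)⁻¹ * (3 * m₀ * N ^ 5) + N ^ 5 * (2 * ((N ^ 4)⁻¹ * m₀)) = -(N * m₀) := by
      field_simp; ring
    rw [this]
    nlinarith
  obtain ⟨e1, e2⟩ := integral_exp_inner_sq_le hK hν hv
  -- The chance that truncation acts on a given observation: exponential Markov, as Chernoff for a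
  -- one-element sum.
  have b2 : ∀ i, P.real {ω | N ^ 2 ≤ ⟪x i ω, v⟫ ^ 2} ≤ Real.exp (1 - N ^ 2 / (12 * K ^ 2)) := by
    intro i
    have := chernoff_iid hx hind hlaw (g := fun z => ⟪z, v⟫ ^ 2) (by fun_prop)
      (l := 1 / (12 * K ^ 2)) (c := 1) (by positivity)
      (by simpa only [one_div_mul_eq_div] using e1)
      (by
        simp only [one_div_mul_eq_div]
        linarith [Real.add_one_le_exp (1 : ℝ)]) {i} (N ^ 2)
    simp only [Finset.sum_singleton, Finset.card_singleton] at this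
    refine this.trans (Real.exp_le_exp.2 (le_of_eq ?_))
    push_cast; ring
  have hsub : {ω | 3 * m₀ * n ≤ ∑ i, ⟪x i ω, v⟫ ^ 4}
      ⊆ {ω | 3 * m₀ * n ≤ ∑ i, g (x i ω)} ∪ ⋃ i, {ω | N ^ 2 ≤ ⟪x i ω, v⟫ ^ 2} := by
    intro ω hω
    by_cases h : ∃ i, N ^ 2 ≤ ⟪x i ω, v⟫ ^ 2
    · right; simpa using h
    · left
      push Not at h
      simp only [Set.mem_ofPred_eq] at hω ⊢
      refine hω.trans_eq (Finset.sum_congr rfl fun i _ => ?_)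
      simp only [hg]
      rw [min_eq_left]
      calc ⟪x i ω, v⟫ ^ 4 = (⟪x i ω, v⟫ ^ 2) ^ 2 := by ring
        _ ≤ (N ^ 2) ^ 2 := pow_le_pow_left₀ (sq_nonneg _) (h i).le 2
        _ = N ^ 4 := by ring
  refine (measureReal_mono hsub (measure_ne_top _ _)).trans
    ((measureReal_union_le _ _).trans (add_le_add b1 ?_))
  refine (measureReal_iUnion_fintype_le _).trans ?_
  calc ∑ i, P.real {ω | N ^ 2 ≤ ⟪x i ω, v⟫ ^ 2}
      ≤ ∑ _i : Fin n, Real.exp (1 - N ^ 2 / (12 * K ^ 2)) := Finset.sum_le_sum fun i _ => b2 i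
    _ = _ := by simp

/-- High-probability bound for the fourth empirical moment of the norm. -/
lemma fourth_moment_norm (hK : 0 < K) (hν : subGaussianNorm ν ≤ ENNReal.ofReal K)
    (hx : ∀ i, Measurable (x i)) (hind : iIndepFun x P) (hlaw : ∀ i, P.map (x i) = ν)
    {N : ℝ} (hN : 1 ≤ N) (hn : (n : ℝ) = N ^ 5) :
    P.real {ω | ¬ (n : ℝ)⁻¹ * ∑ i, ‖x i ω‖ ^ 4 ≤ 3 * (16 * K ^ 4 + 1) * p ^ 2}
      ≤ p * (Real.exp (-N) + n * Real.exp (1 - N ^ 2 / (12 * K ^ 2))) := by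
  have hn0 : (0 : ℝ) < n := by rw [hn]; positivity
  have hsub : {ω | ¬ (n : ℝ)⁻¹ * ∑ i, ‖x i ω‖ ^ 4 ≤ 3 * (16 * K ^ 4 + 1) * p ^ 2}
      ⊆ ⋃ j : Fin p, {ω | 3 * (16 * K ^ 4 + 1) * n
        ≤ ∑ i, ⟪x i ω, EuclideanSpace.single j (1 : ℝ)⟫ ^ 4} := by
    intro ω hω
    by_contra hcon
    simp only [Set.mem_iUnion, Set.mem_ofPred_eq, not_exists, not_le, inner_single_one] at hcon
    apply hω
    rw [inv_mul_le_iff₀ hn0]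
    calc ∑ i, ‖x i ω‖ ^ 4 ≤ ∑ i, p * ∑ j, x i ω j ^ 4 :=
          Finset.sum_le_sum fun i _ => norm_pow_four_le _
      _ = p * ∑ j, ∑ i, x i ω j ^ 4 := by rw [← Finset.mul_sum, Finset.sum_comm]
      _ ≤ p * ∑ _j : Fin p, 3 * (16 * K ^ 4 + 1) * n := by gcongr with j; exact (hcon j).le
      _ = _ := by simp; ring
  refine (measureReal_mono hsub (measure_ne_top _ _)).trans
    ((measureReal_iUnion_fintype_le _).trans ?_)
  refine (Finset.sum_le_sum fun j _ =>
    fourth_moment_coord hK hν hx hind hlaw (v := EuclideanSpace.single j (1 : ℝ)) (by simp)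
      hN hn).trans ?_
  simp [mul_add]

/-- The operator `s⁻¹ ∑_{i ∈ T} a_i X_i X_iᵀ - E[h(x) x xᵀ]`. -/
def devOp (ν : Measure (Vec p)) (h : Vec p → ℝ) (X : Fin n → Vec p) (T : Finset (Fin n)) :
    Vec p →L[ℝ] Vec p :=
  (T.card : ℝ)⁻¹ • ∑ i ∈ T, h (X i) • toEuclideanCLM (𝕜 := ℝ) (vecMulVec (X i) (X i))
    - toEuclideanCLM (𝕜 := ℝ) (weightedMoment ν h)

omit [IsProbabilityMeasure ν] in
lemma devOp_symm (h : Vec p → ℝ) (X : Fin n → Vec p) (T : Finset (Fin n)) (u v : Vec p) :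
    ⟪devOp ν h X T u, v⟫ = ⟪u, devOp ν h X T v⟫ := by
  simp only [devOp, _root_.sub_apply, _root_.smul_apply, _root_.sum_apply, inner_sub_left,
    inner_sub_right, inner_smul_left, inner_smul_right, sum_inner, inner_sum,
    toEuclideanCLM_vecMulVec, inner_toEuclideanCLM_comm (isHermitian_weightedMoment h),
    conj_trivial]
  congr 2
  refine Finset.sum_congr rfl fun i _ => ?_
  rw [real_inner_comm u (X i)]; ring

lemma inner_devOp (hK : 0 ≤ K) (hν : subGaussianNorm ν ≤ ENNReal.ofReal K) {h : Vec p → ℝ}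
    (hh : Measurable h) {C : ℝ} (hC : ∀ x, |h x| ≤ C) (X : Fin n → Vec p) (T : Finset (Fin n))
    (v : Vec p) :
    ⟪devOp ν h X T v, v⟫ = (T.card : ℝ)⁻¹ * ∑ i ∈ T, ⟪v, X i⟫ ^ 2 * h (X i)
      - ∫ z, ⟪v, z⟫ ^ 2 * h z ∂ν := by
  simp only [devOp, _root_.sub_apply, _root_.smul_apply, _root_.sum_apply, inner_sub_left,
    inner_smul_left, sum_inner, toEuclideanCLM_vecMulVec, conj_trivial]
  rw [inner_weightedMoment hK hν hh hC]
  congr 1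
  · congr 1
    refine Finset.sum_congr rfl fun i _ => ?_
    rw [real_inner_comm v (X i)]; ring
  · refine integral_congr_ae (.of_forall fun z => ?_)
    simp only
    rw [real_inner_comm z v]; ring

omit [IsProbabilityMeasure ν] in
lemma devOp_one (X : Fin n → Vec p) (T : Finset (Fin n)) :
    devOp ν (fun _ => 1) X T = toEuclideanCLM (𝕜 := ℝ) (sampleCov X T)
      - toEuclideanCLM (𝕜 := ℝ) (secondMoment ν) := by
  simp [devOp, sampleCov, secondMoment_eq_weightedMoment]

lemma unit_ball_net (p : ℕ) : ∃ N : Finset (Vec p), (∀ w ∈ N, ‖w‖ ≤ 1) ∧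
    (∀ v : Vec p, ‖v‖ ≤ 1 → ∃ w ∈ N, ‖v - w‖ ≤ 1 / 4) ∧ (N.card : ℝ) ≤ 9 ^ p := by
  obtain ⟨N, h1, h2, h3⟩ := exists_net p (R := 1) (δ := 1 / 4) (by norm_num) (by norm_num)
  exact ⟨N, h1, h2, by norm_num at h3; exact h3⟩

/-- Concentration of the sample covariance for a random subsample independent of the data. -/
lemma sampleCov_concentration (hK : 0 < K) (hν : subGaussianNorm ν ≤ ENNReal.ofReal K)
    (hx : ∀ i, Measurable (x i)) (hind : iIndepFun x P) (hlaw : ∀ i, P.map (x i) = ν)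
    {S : Ω → Finset (Fin n)} (hS : Measurable S) {s : ℕ} (hs : 0 < s) (hcard : ∀ ω, (S ω).card = s)
    (hSi : IndepFun (fun ω i => x i ω) S P) {t : ℝ} (ht : 0 ≤ t)
    (ht' : t ≤ 8 / (1 / (24 * (K ^ 2 + 1) * 1))) :
    P.real {ω | ¬ ‖toEuclideanCLM (𝕜 := ℝ) (sampleCov (fun i => x i ω) (S ω))
        - toEuclideanCLM (𝕜 := ℝ) (secondMoment ν)‖ ≤ 2 * t}
      ≤ 9 ^ p * (2 * Real.exp (-(s * (1 / (24 * (K ^ 2 + 1) * 1)) ^ 2 * t ^ 2 / 16))) := by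
  obtain ⟨N, hN1, hN2, hN3⟩ := unit_ball_net p
  set lam := 1 / (24 * (K ^ 2 + 1) * (1:ℝ)) with hlam_def
  have hlam : 0 < lam := by positivity
  set ε := 2 * Real.exp (-(s * lam ^ 2 * t ^ 2 / 16)) with hε
  let F : Vec p → Vec p → ℝ := fun v z => ⟪v, z⟫ ^ 2 * 1
  let D : Finset (Fin n) → Set (Fin n → Vec p) := fun T =>
    ⋃ v ∈ N, {X | t ≤ |(T.card : ℝ)⁻¹ * ∑ i ∈ T, F v (X i) - ∫ z, F v z ∂ν|}
  have hDm : ∀ T, MeasurableSet (D T) := fun T => by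
    refine Finset.measurableSet_biUnion _ fun v _ => ?_
    refine measurableSet_le measurable_const ?_
    simp only [F]
    fun_prop
  have hD : ∀ T : Finset (Fin n), T.card = s →
      P.real ((fun ω i => x i ω) ⁻¹' D T) ≤ 9 ^ p * ε := fun T hT => by
    have : (fun ω i => x i ω) ⁻¹' D T
        = ⋃ v ∈ N, {ω | t ≤ |(T.card : ℝ)⁻¹ * ∑ i ∈ T, F v (x i ω) - ∫ z, F v z ∂ν|} := by
      ext ω; simp [D]
    rw [this]
    refine (measureReal_biUnion_finset_le _ _).trans ?_
    calc ∑ v ∈ N, P.real {ω | t ≤ |(T.card : ℝ)⁻¹ * ∑ i ∈ T, F v (x i ω) - ∫ z, F v z ∂ν|}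
        ≤ ∑ _v ∈ N, ε := Finset.sum_le_sum fun v hv => by
          have := bernstein hx hind hlaw hlam (hasExpMoment_sq hK hν one_pos (hN1 v hv)
            (g := fun _ => 1) measurable_const (by simp)) ht ht' T (by omega)
          rw [hT] at this ⊢
          exact this
      _ = N.card * ε := by simp
      _ ≤ 9 ^ p * ε := by gcongr
  -- Splitting by the value T of S and using independence, each fixed-set bound is weighted by P(S =
  -- T). The weights sum to one, so no union bound over subsets is paid.
  have hsub : {ω | ¬ ‖toEuclideanCLM (𝕜 := ℝ) (sampleCov (fun i => x i ω) (S ω))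
        - toEuclideanCLM (𝕜 := ℝ) (secondMoment ν)‖ ≤ 2 * t}
      ⊆ ⋃ T ∈ (Finset.univ.filter fun T : Finset (Fin n) => T.card = s),
        ((fun ω i => x i ω) ⁻¹' D T) ∩ (S ⁻¹' {T}) := by
    intro ω hω
    simp only [Finset.mem_filter, Finset.mem_univ, true_and, Set.mem_iUnion, Set.mem_inter_iff,
      Set.mem_preimage, Set.mem_singleton_iff]
    refine ⟨S ω, hcard ω, ?_, rfl⟩
    by_contra hcon
    apply hω
    rw [← devOp_one]
    refine opNorm_le_of_net (devOp_symm _ _ _) ht (N := (N : Set (Vec p))) hN1 hN2 fun w hw => ?_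
    rw [inner_devOp hK.le hν measurable_const (C := 1) (by simp)]
    simp only [D, Set.mem_iUnion, not_exists, Set.mem_ofPred_eq, not_le] at hcon
    exact (hcon w hw).le
  refine (measureReal_mono hsub (measure_ne_top _ _)).trans
    ((measureReal_biUnion_finset_le _ _).trans ?_)
  calc ∑ T ∈ (Finset.univ.filter fun T : Finset (Fin n) => T.card = s),
        P.real (((fun ω i => x i ω) ⁻¹' D T) ∩ (S ⁻¹' {T}))
      ≤ ∑ T ∈ (Finset.univ.filter fun T : Finset (Fin n) => T.card = s),
        9 ^ p * ε * P.real (S ⁻¹' {T}) := by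
        refine Finset.sum_le_sum fun T hT => ?_
        have h := hSi.measure_inter_preimage_eq_mul (D T) {T} (hDm T) (measurableSet_singleton T)
        rw [measureReal_def, h, ENNReal.toReal_mul]
        exact mul_le_mul_of_nonneg_right (hD T (Finset.mem_filter.1 hT).2) ENNReal.toReal_nonneg
    _ ≤ ∑ T : Finset (Fin n), 9 ^ p * ε * P.real (S ⁻¹' {T}) :=
        Finset.sum_le_univ_sum_of_nonneg fun T => by positivity
    _ = 9 ^ p * ε * ∑ T : Finset (Fin n), P.real (S ⁻¹' {T}) := by rw [Finset.mul_sum]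
    _ = 9 ^ p * ε := by
        rw [sum_measureReal_preimage_singleton _ fun T _ => hS (measurableSet_singleton T)]
        simp

end SubGaussian

/-! ### Uniform deviation bounds over a ball of parameters -/

section Uniform

variable {p : ℕ} {ν : Measure (Vec p)} [IsProbabilityMeasure ν]
  {Ω : Type*} [MeasurableSpace Ω] {P : Measure Ω} [IsProbabilityMeasure P]
  {n : ℕ} {x : Fin n → Ω → Vec p}

omit [IsProbabilityMeasure ν] in
-- The Lipschitz bound contributes ‖z‖δ and the weight 1 + ‖z‖²; their product is dominated by 1 +
-- ‖z‖⁴, so a fourth moment controls the oscillation in β.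
lemma abs_weight_mul_sub_le {w : Vec p → ℝ} (hw : ∀ z, |w z| ≤ 1 + ‖z‖ ^ 2) {g : ℝ → ℝ} {B δ : ℝ}
    (hB0 : 0 ≤ B) (hB : ∀ a b, |g a - g b| ≤ B * |a - b|) {β β' : Vec p} (hβ : ‖β - β'‖ ≤ δ)
    (z : Vec p) :
    |w z * g ⟪z, β⟫ - w z * g ⟪z, β'⟫| ≤ 2 * B * δ * (1 + ‖z‖ ^ 4) := by
  have hδ : 0 ≤ δ := (norm_nonneg _).trans hβ
  have h1 : |⟪z, β⟫ - ⟪z, β'⟫| ≤ ‖z‖ * δ := by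
    rw [← inner_sub_right]
    exact (abs_real_inner_le_norm _ _).trans (by gcongr)
  have h2 : (1 + ‖z‖ ^ 2) * ‖z‖ ≤ 2 * (1 + ‖z‖ ^ 4) := by
    have := norm_nonneg z
    nlinarith [sq_nonneg (‖z‖ - 1), sq_nonneg (‖z‖ ^ 2 - ‖z‖), sq_nonneg (‖z‖ ^ 2 - 1),
      sq_nonneg (‖z‖ ^ 2)]
  rw [← mul_sub, abs_mul]
  calc |w z| * |g ⟪z, β⟫ - g ⟪z, β'⟫| ≤ (1 + ‖z‖ ^ 2) * (B * (‖z‖ * δ)) := by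
        gcongr
        · exact hw z
        · exact (hB _ _).trans (by gcongr)
    _ = B * δ * ((1 + ‖z‖ ^ 2) * ‖z‖) := by ring
    _ ≤ B * δ * (2 * (1 + ‖z‖ ^ 4)) := by gcongr
    _ = _ := by ring

/-- Uniform concentration, over `‖β‖ ≤ R` and a finite family of weights `w`, of the empirical means
of `w(x) g(⟨x, β⟩)`, on the event that the fourth empirical moment is at most `A`. -/
lemma uniform_deviation (hx : ∀ i, Measurable (x i)) (hind : iIndepFun x P)
    (hlaw : ∀ i, P.map (x i) = ν) (hn : 0 < n) {κ : Type*} (W : Finset κ) {w : κ → Vec p → ℝ}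
    (hw : ∀ j ∈ W, ∀ z, |w j z| ≤ 1 + ‖z‖ ^ 2) {g : ℝ → ℝ} {B : ℝ} (hB0 : 0 ≤ B)
    (hB : ∀ a b, |g a - g b| ≤ B * |a - b|) {R δ lam t A : ℝ} (hR : 0 ≤ R) (hδ : 0 < δ)
    (hlam : 0 < lam) (ht : 0 ≤ t) (ht' : t ≤ 8 / lam)
    (hexp : ∀ j ∈ W, ∀ β : Vec p, HasExpMoment (fun z => w j z * g ⟪z, β⟫) lam ν)
    (hAi : Integrable (fun z => ‖z‖ ^ 4) ν) (hA : ∫ z, ‖z‖ ^ 4 ∂ν ≤ A) :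
    P.real {ω | (n : ℝ)⁻¹ * ∑ i, ‖x i ω‖ ^ 4 ≤ A ∧ ¬ ∀ j ∈ W, ∀ β : Vec p, ‖β‖ ≤ R →
        |(n : ℝ)⁻¹ * ∑ i, w j (x i ω) * g ⟪x i ω, β⟫ - ∫ z, w j z * g ⟪z, β⟫ ∂ν|
          ≤ t + 4 * B * δ * (1 + A)}
      ≤ W.card * (1 + 2 * R / δ) ^ p * (2 * Real.exp (-(n * lam ^ 2 * t ^ 2 / 16))) := by
  obtain ⟨N, hN1, hN2, hN3⟩ := exists_net p hδ hR
  have hn0 : (0 : ℝ) < n := by exact_mod_cast hn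
  have hsub : {ω | (n : ℝ)⁻¹ * ∑ i, ‖x i ω‖ ^ 4 ≤ A ∧ ¬ ∀ j ∈ W, ∀ β : Vec p, ‖β‖ ≤ R →
        |(n : ℝ)⁻¹ * ∑ i, w j (x i ω) * g ⟪x i ω, β⟫ - ∫ z, w j z * g ⟪z, β⟫ ∂ν|
          ≤ t + 4 * B * δ * (1 + A)} ⊆
      ⋃ j ∈ W, ⋃ β ∈ N, {ω | t ≤ |((Finset.univ : Finset (Fin n)).card : ℝ)⁻¹ *
        ∑ i, w j (x i ω) * g ⟪x i ω, β⟫ - ∫ z, w j z * g ⟪z, β⟫ ∂ν|} := by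
    rintro ω ⟨hω4, hω⟩
    by_contra hcon
    simp only [Set.mem_iUnion, not_exists, Set.mem_ofPred_eq, not_le, Finset.card_univ,
      Fintype.card_fin] at hcon
    apply hω
    intro j hj β hβ
    obtain ⟨β', hβ', hd⟩ := hN2 β hβ
    have h0 := (hcon j hj β' hβ').le
    -- Moving to the net point costs this much in the empirical mean and again in the population
    -- mean (`h2`), hence the 4 in the statement.
    have h1 : |(n : ℝ)⁻¹ * ∑ i, w j (x i ω) * g ⟪x i ω, β⟫
        - (n : ℝ)⁻¹ * ∑ i, w j (x i ω) * g ⟪x i ω, β'⟫| ≤ 2 * B * δ * (1 + A) := by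
      rw [← mul_sub, ← Finset.sum_sub_distrib, abs_mul, abs_of_nonneg (by positivity)]
      calc (n : ℝ)⁻¹ * |∑ i, (w j (x i ω) * g ⟪x i ω, β⟫ - w j (x i ω) * g ⟪x i ω, β'⟫)|
          ≤ (n : ℝ)⁻¹ * ∑ i, 2 * B * δ * (1 + ‖x i ω‖ ^ 4) := by
            gcongr
            exact (Finset.abs_sum_le_sum_abs _ _).trans (Finset.sum_le_sum fun i _ =>
              abs_weight_mul_sub_le (hw j hj) hB0 hB hd _)
        _ = 2 * B * δ * (1 + (n : ℝ)⁻¹ * ∑ i, ‖x i ω‖ ^ 4) := by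
            rw [← Finset.mul_sum, Finset.sum_add_distrib]
            simp
            field_simp
        _ ≤ _ := by gcongr
    have i1 := (hexp j hj β).integrable_self hlam
    have i2 := (hexp j hj β').integrable_self hlam
    have h2 : |∫ z, w j z * g ⟪z, β⟫ ∂ν - ∫ z, w j z * g ⟪z, β'⟫ ∂ν|
        ≤ 2 * B * δ * (1 + A) := by
      rw [← integral_sub i1 i2]
      refine (abs_integral_le_integral_abs).trans ?_
      have i3 : Integrable (fun z : Vec p => 2 * B * δ * (1 + ‖z‖ ^ 4)) ν :=
        ((integrable_const _).add hAi).const_mul _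
      refine (integral_mono (i1.sub i2).abs i3
        (abs_weight_mul_sub_le (hw j hj) hB0 hB hd)).trans ?_
      rw [integral_const_mul, integral_add (integrable_const _) hAi]
      simp only [integral_const, probReal_univ, one_smul]
      gcongr
    have h3 := abs_add_three
      ((n : ℝ)⁻¹ * ∑ i, w j (x i ω) * g ⟪x i ω, β⟫
        - (n : ℝ)⁻¹ * ∑ i, w j (x i ω) * g ⟪x i ω, β'⟫)
      ((n : ℝ)⁻¹ * ∑ i, w j (x i ω) * g ⟪x i ω, β'⟫ - ∫ z, w j z * g ⟪z, β'⟫ ∂ν)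
      (∫ z, w j z * g ⟪z, β'⟫ ∂ν - ∫ z, w j z * g ⟪z, β⟫ ∂ν)
    rw [abs_sub_comm (∫ z, w j z * g ⟪z, β'⟫ ∂ν)] at h3
    rw [show ∀ a b c d : ℝ, (a - b) + (b - c) + (c - d) = a - d by intros; ring] at h3
    linarith
  refine (measureReal_mono hsub (measure_ne_top _ _)).trans
    ((measureReal_biUnion_finset_le _ _).trans ?_)
  calc ∑ j ∈ W, P.real (⋃ β ∈ N, {ω | t ≤ |((Finset.univ : Finset (Fin n)).card : ℝ)⁻¹ *
        ∑ i, w j (x i ω) * g ⟪x i ω, β⟫ - ∫ z, w j z * g ⟪z, β⟫ ∂ν|})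
      ≤ ∑ _j ∈ W, ∑ _β ∈ N, 2 * Real.exp (-(n * lam ^ 2 * t ^ 2 / 16)) := by
        refine Finset.sum_le_sum fun j hj => (measureReal_biUnion_finset_le _ _).trans
          (Finset.sum_le_sum fun β hβ => ?_)
        have := bernstein hx hind hlaw hlam (hexp j hj β) ht ht' Finset.univ
          (by simpa using hn)
        simpa only [Finset.card_univ, Fintype.card_fin] using this
    _ = W.card * N.card * (2 * Real.exp (-(n * lam ^ 2 * t ^ 2 / 16))) := by
        simp; ring
    _ ≤ _ := by gcongr

end Uniform

/-! ### The Gaussian discrepancy -/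

lemma posSemidef_of_spiked {p r : ℕ} {σ : ℝ} {A : Mat p} (hA : IsSpiked r σ A) :
    A.PosSemidef := by
  refine PosSemidef.of_dotProduct_mulVec_nonneg (isHermitian_of_spiked hA) fun v => ?_
  have h := le_quadratic_of_spiked hA (WithLp.toLp 2 v)
  rw [real_inner_comm, inner_toEuclideanCLM] at h
  have : 0 ≤ σ ^ 2 * ‖(WithLp.toLp 2 v : Vec p)‖ ^ 2 := by positivity
  simpa using this.trans h

lemma probDist_nonneg {p : ℕ} (H : Set (Vec p → ℝ)) (ν γ : Measure (Vec p)) :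
    0 ≤ probDist H ν γ := Real.iSup_nonneg fun _ => abs_nonneg _

lemma gaussDiscrepancy_nonneg {p : ℕ} (φ : ℝ → ℝ) (R : ℝ) (ν : Measure (Vec p)) :
    0 ≤ gaussDiscrepancy φ R ν := by
  have h : 0 ≤ specNorm (secondMoment ν) := norm_nonneg _
  have := probDist_nonneg (classOne φ p R) ν (multivariateGaussian 0 (secondMoment ν))
  have := probDist_nonneg (classTwo φ p R) ν (multivariateGaussian 0 (secondMoment ν))
  have := probDist_nonneg (classThree φ p R) ν (multivariateGaussian 0 (secondMoment ν))
  unfold gaussDiscrepancy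
  positivity

/-- The uniform bound C is essential: a real supremum of an unbounded family has the default value
0, and would then bound nothing. -/
lemma abs_sub_le_probDist {p : ℕ} {H : Set (Vec p → ℝ)} {ν γ : Measure (Vec p)} {C : ℝ}
    (hC : ∀ h ∈ H, |∫ x, h x ∂ν| ≤ C ∧ |∫ x, h x ∂γ| ≤ C) {h : Vec p → ℝ} (hh : h ∈ H) :
    |∫ x, h x ∂ν - ∫ x, h x ∂γ| ≤ probDist H ν γ := by
  refine le_ciSup (f := fun h : H => |(∫ x, (h : Vec p → ℝ) x ∂ν) - ∫ z, (h : Vec p → ℝ) z ∂γ|)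
    ⟨C + C, ?_⟩ ⟨h, hh⟩
  rintro _ ⟨k, rfl⟩
  exact (abs_sub _ _).trans (add_le_add (hC k k.2).1 (hC k k.2).2)

lemma abs_integral_le_of_abs_le {p : ℕ} {μ : Measure (Vec p)} [IsProbabilityMeasure μ]
    {f : Vec p → ℝ} {C : ℝ} (hf : ∀ x, |f x| ≤ C) : |∫ x, f x ∂μ| ≤ C := by
  simpa using norm_integral_le_of_norm_le_const (μ := μ) (f := f) (C := C) (.of_forall hf)

lemma abs_integral_sq_mul_le {p : ℕ} {μ : Measure (Vec p)} {v : Vec p}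
    (hi : Integrable (fun x => ⟪v, x⟫ ^ 2) μ) {f : Vec p → ℝ} {M C : ℝ} (hM : 0 ≤ M)
    (hf : ∀ x, |f x| ≤ M) (hC : ∫ x, ⟪v, x⟫ ^ 2 ∂μ ≤ C) :
    |∫ x, ⟪v, x⟫ ^ 2 * f x ∂μ| ≤ M * C := by
  refine (norm_integral_le_of_norm_le (f := fun x => ⟪v, x⟫ ^ 2 * f x) (hi.const_mul M)
    (.of_forall fun x => ?_)).trans ?_
  · rw [norm_mul, Real.norm_eq_abs, Real.norm_eq_abs, abs_of_nonneg (sq_nonneg _), mul_comm]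
    gcongr
    exact hf x
  · rw [integral_const_mul]
    gcongr

section Discrepancy

variable {p : ℕ} {ν : Measure (Vec p)} [IsProbabilityMeasure ν] {K : ℝ}

/-- The Stein-type approximation of the population Hessian. -/
lemma abs_stein_sub_le {r : ℕ} {σ R M B : ℝ} {φ : ℝ → ℝ} (hK : 0 < K)
    (hν : subGaussianNorm ν ≤ ENNReal.ofReal K) (hσ : 0 < σ) (hS : IsSpiked r σ (secondMoment ν))
    (hφ : ContDiff ℝ 5 φ) (h2 : ∀ u, |iteratedDeriv 2 φ u| ≤ M)
    (h3 : ∀ u, |iteratedDeriv 3 φ u| ≤ B) (h4 : ∀ u, |iteratedDeriv 4 φ u| ≤ M) {β u : Vec p}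
    (hβ : ‖β‖ ≤ R) (hu : ‖u‖ = 1) :
    |muPop φ ν 2 β * ⟪toEuclideanCLM (𝕜 := ℝ) (secondMoment ν) u, u⟫
        + muPop φ ν 4 β * ⟪toEuclideanCLM (𝕜 := ℝ) (secondMoment ν) β, u⟫ ^ 2
        - ∫ z, ⟪u, z⟫ ^ 2 * iteratedDeriv 2 φ ⟪z, β⟫ ∂ν| ≤ gaussDiscrepancy φ R ν := by
  set A := secondMoment ν with hA
  set γ := multivariateGaussian (0 : Vec p) A with hγ
  have hM : 0 ≤ M := (abs_nonneg _).trans (h2 0)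
  have hpsd : A.PosSemidef := posSemidef_of_spiked hS
  have hcoer : β ≠ 0 → 0 < ⟪toEuclideanCLM (𝕜 := ℝ) A β, β⟫ := fun h =>
    (by have := norm_pos_iff.2 h; positivity : 0 < σ ^ 2 * ‖β‖ ^ 2).trans_le
      (le_quadratic_of_spiked hS β)
  have hB0 : 0 ≤ B := (abs_nonneg _).trans (h3 0)
  have stein := stein_identity hpsd hcoer u
    (hasDerivAt_iteratedDeriv hφ (k := 2) (by norm_num))
    (hasDerivAt_iteratedDeriv hφ (k := 3) (by norm_num))
    (continuous_iteratedDeriv hφ (by norm_num)) (C := M + B)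
    (fun x => (h2 x).trans (by linarith)) (fun x => (h3 x).trans (by linarith))
    (fun x => (h4 x).trans (by linarith))
  rw [← hγ] at stein
  have d1 : |muPop φ ν 2 β - ∫ z, iteratedDeriv 2 φ ⟪z, β⟫ ∂γ|
      ≤ probDist (classOne φ p R) ν γ :=
    abs_sub_le_probDist (C := M) (by
      rintro _ ⟨b, -, rfl⟩
      exact ⟨abs_integral_le_of_abs_le fun x => h2 _, abs_integral_le_of_abs_le fun x => h2 _⟩)
      ⟨β, hβ, rfl⟩
  have d2 : |muPop φ ν 4 β - ∫ z, iteratedDeriv 4 φ ⟪z, β⟫ ∂γ|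
      ≤ probDist (classTwo φ p R) ν γ :=
    abs_sub_le_probDist (C := M) (by
      rintro _ ⟨b, -, rfl⟩
      exact ⟨abs_integral_le_of_abs_le fun x => h4 _, abs_integral_le_of_abs_le fun x => h4 _⟩)
      ⟨β, hβ, rfl⟩
  have d3 : |∫ z, ⟪u, z⟫ ^ 2 * iteratedDeriv 2 φ ⟪z, β⟫ ∂ν
      - ∫ z, ⟪u, z⟫ ^ 2 * iteratedDeriv 2 φ ⟪z, β⟫ ∂γ| ≤ probDist (classThree φ p R) ν γ :=
    abs_sub_le_probDist (C := M * (2 * K ^ 2)) (by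
      rintro _ ⟨b, v, -, hv, rfl⟩
      have hs := integral_inner_sq_le hK.le hν v
      simp only [real_inner_comm v] at hs
      rw [hv, one_pow, mul_one] at hs
      refine ⟨abs_integral_sq_mul_le hs.1 hM (fun x => h2 _) hs.2,
        abs_integral_sq_mul_le (memLp_inner_gaussian A v).integrable_sq hM (fun x => h2 _) ?_⟩
      have e := integral_inner_mul_inner_gaussian hpsd v v
      simp only [← sq] at e
      rw [← hγ] at e
      rw [e]
      have := (abs_le.1 (abs_quadratic_le (toEuclideanCLM (𝕜 := ℝ) A) v)).2
      rw [hv, one_pow, mul_one] at this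
      exact this.trans (norm_secondMoment_le hK.le hν))
      ⟨β, u, hβ, hu, rfl⟩
  have q1 : |⟪toEuclideanCLM (𝕜 := ℝ) A u, u⟫| ≤ specNorm A := by
    simpa [hu, specNorm] using abs_quadratic_le (toEuclideanCLM (𝕜 := ℝ) A) u
  have q2 : ⟪toEuclideanCLM (𝕜 := ℝ) A β, u⟫ ^ 2 ≤ specNorm A ^ 2 * R ^ 2 := by
    rw [← mul_pow, ← sq_abs]
    gcongr
    refine (abs_real_inner_le_norm _ _).trans ?_
    rw [hu, mul_one]
    exact ((toEuclideanCLM (𝕜 := ℝ) A).le_opNorm β).trans (mul_le_mul le_rfl hβ (norm_nonneg _) (norm_nonneg _))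
  -- Subtracting the Gaussian identity, whose analogue of the left side vanishes, leaves one
  -- expectation difference for each class in the discrepancy.
  have e : muPop φ ν 2 β * ⟪toEuclideanCLM (𝕜 := ℝ) A u, u⟫
        + muPop φ ν 4 β * ⟪toEuclideanCLM (𝕜 := ℝ) A β, u⟫ ^ 2
        - ∫ z, ⟪u, z⟫ ^ 2 * iteratedDeriv 2 φ ⟪z, β⟫ ∂ν
      = (muPop φ ν 2 β - ∫ z, iteratedDeriv 2 φ ⟪z, β⟫ ∂γ) * ⟪toEuclideanCLM (𝕜 := ℝ) A u, u⟫
        + (muPop φ ν 4 β - ∫ z, iteratedDeriv 4 φ ⟪z, β⟫ ∂γ)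
          * ⟪toEuclideanCLM (𝕜 := ℝ) A β, u⟫ ^ 2
        + -(∫ z, ⟪u, z⟫ ^ 2 * iteratedDeriv 2 φ ⟪z, β⟫ ∂ν
          - ∫ z, ⟪u, z⟫ ^ 2 * iteratedDeriv 2 φ ⟪z, β⟫ ∂γ) := by
    rw [stein]; ring
  rw [e]
  refine (abs_add_three _ _ _).trans ?_
  rw [abs_mul, abs_mul, abs_neg, abs_of_nonneg (sq_nonneg ⟪toEuclideanCLM (𝕜 := ℝ) A β, u⟫)]
  have p1 := probDist_nonneg (classOne φ p R) ν γ
  have p2 := probDist_nonneg (classTwo φ p R) ν γ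
  calc _ ≤ probDist (classOne φ p R) ν γ * specNorm A
        + probDist (classTwo φ p R) ν γ * (specNorm A ^ 2 * R ^ 2)
        + probDist (classThree φ p R) ν γ := by gcongr
    _ = gaussDiscrepancy φ R ν := by
        simp only [gaussDiscrepancy, ← hA, ← hγ]; ring

/-- A lower bound for `E[φ''(⟨x, β⟩)]`. -/
lemma le_muPop_two {R b₁ M : ℝ} {φ : ℝ → ℝ} (hK : 0 < K) (hR : 0 < R)
    (hν : subGaussianNorm ν ≤ ENNReal.ofReal K) (hφ : ContDiff ℝ 5 φ)
    (hpos : ∀ u, 0 ≤ iteratedDeriv 2 φ u) (hb₁ : 0 ≤ b₁)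
    (hb : ∀ u, |u| ≤ 2 * K * R → b₁ ≤ iteratedDeriv 2 φ u)
    (h2 : ∀ u, |iteratedDeriv 2 φ u| ≤ M) {β : Vec p} (hβ : ‖β‖ ≤ R) :
    b₁ / 2 ≤ muPop φ ν 2 β := by
  obtain ⟨i1, i2⟩ := integral_inner_sq_le hK.le hν β
  set L := 2 * K * R with hL
  have hL0 : 0 < L := by positivity
  -- Chebyshev in pointwise form. The cutoff L = 2KR is chosen so that the second moment bound 2K²R²
  -- is L²/2, which loses half of b₁.
  have hpt : ∀ z : Vec p, b₁ - b₁ * (L ^ 2)⁻¹ * ⟪z, β⟫ ^ 2 ≤ iteratedDeriv 2 φ ⟪z, β⟫ := fun z => by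
    by_cases h : |⟪z, β⟫| ≤ L
    · have : 0 ≤ b₁ * (L ^ 2)⁻¹ * ⟪z, β⟫ ^ 2 := by positivity
      linarith [hb _ h]
    · push Not at h
      have h1 : L ^ 2 ≤ ⟪z, β⟫ ^ 2 := by rw [← sq_abs ⟪z, β⟫]; gcongr
      have h2 : 1 ≤ (L ^ 2)⁻¹ * ⟪z, β⟫ ^ 2 := by
        rw [le_inv_mul_iff₀ (by positivity), mul_one]; exact h1
      have := mul_le_mul_of_nonneg_left h2 hb₁
      linarith [hpos ⟪z, β⟫]
  have hi : Integrable (fun z : Vec p => iteratedDeriv 2 φ ⟪z, β⟫) ν := by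
    have hc := continuous_iteratedDeriv hφ (k := 2) (by norm_num)
    exact (integrable_const M).mono' (by fun_prop) (.of_forall fun z => h2 _)
  have h := integral_mono ((integrable_const b₁).sub (i1.const_mul (b₁ * (L ^ 2)⁻¹))) hi hpt
  simp only [Pi.sub_apply] at h
  rw [integral_sub (integrable_const _) (i1.const_mul _), integral_const_mul] at h
  simp only [integral_const, probReal_univ, one_smul] at h
  have h5 : b₁ * (L ^ 2)⁻¹ * ∫ z, ⟪z, β⟫ ^ 2 ∂ν ≤ b₁ * (L ^ 2)⁻¹ * (2 * K ^ 2 * R ^ 2) := by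
    gcongr
    exact i2.trans (by gcongr)
  have h6 : b₁ * (L ^ 2)⁻¹ * (2 * K ^ 2 * R ^ 2) = b₁ / 2 := by
    rw [hL]; field_simp
  have h7 : ∫ z, iteratedDeriv 2 φ ⟪z, β⟫ ∂ν = muPop φ ν 2 β := rfl
  linarith

end Discrepancy

/-! ### The good event -/

/-- The sample quantities used by the method are close to their population counterparts. -/
structure GoodSample {n p : ℕ} (φ : ℝ → ℝ) (R : ℝ) (ν : Measure (Vec p)) (X : Fin n → Vec p)
    (S : Finset (Fin n)) (η δ C₀ C₄ : ℝ) : Prop where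
  cov : ‖toEuclideanCLM (𝕜 := ℝ) (sampleCov X S) - toEuclideanCLM (𝕜 := ℝ) (secondMoment ν)‖ ≤ δ
  cov_univ : ‖toEuclideanCLM (𝕜 := ℝ) (sampleCov X Finset.univ)
    - toEuclideanCLM (𝕜 := ℝ) (secondMoment ν)‖ ≤ C₀
  fourth : (n : ℝ)⁻¹ * ∑ i, ‖X i‖ ^ 4 ≤ C₄ * p ^ 2
  muHat_two : ∀ β : Vec p, ‖β‖ ≤ R → |muHat φ X 2 β - muPop φ ν 2 β| ≤ η
  muHat_four : ∀ β : Vec p, ‖β‖ ≤ R → |muHat φ X 4 β - muPop φ ν 4 β| ≤ η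
  hessian : ∀ β : Vec p, ‖β‖ ≤ R → ∀ u : Vec p, ‖u‖ = 1 →
    |(n : ℝ)⁻¹ * ∑ i, ⟪u, X i⟫ ^ 2 * iteratedDeriv 2 φ ⟪X i, β⟫
      - ∫ z, ⟪u, z⟫ ^ 2 * iteratedDeriv 2 φ ⟪z, β⟫ ∂ν| ≤ 2 * η

lemma abs_muHat_le {n p : ℕ} (hn : 0 < n) {φ : ℝ → ℝ} {j : ℕ} {M : ℝ}
    (hM : ∀ u, |iteratedDeriv j φ u| ≤ M) (X : Fin n → Vec p) (β : Vec p) :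
    |muHat φ X j β| ≤ M := by
  have hn0 : (0 : ℝ) < n := by exact_mod_cast hn
  rw [muHat, abs_mul, abs_of_nonneg (by positivity), inv_mul_le_iff₀ hn0]
  refine (Finset.abs_sum_le_sum_abs _ _).trans ((Finset.sum_le_sum fun i _ => hM _).trans ?_)
  simp

/-- The bound for one step on the good event. -/
lemma GoodSample.norm_step_sub_le {n p : ℕ} (hn : 0 < n) (hp : 0 < p) {φ : ℝ → ℝ}
    {K σ R ξ M B b₁ η δ C₀ C₄ : ℝ} {r : Fin p} {ν : Measure (Vec p)} [IsProbabilityMeasure ν]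
    {X : Fin n → Vec p} {S : Finset (Fin n)} (hG : GoodSample φ R ν X S η δ C₀ C₄)
    (hK : 0 < K) (hσ : 0 < σ) (hR : 0 < R) (hξ : 0 < ξ) (hφ : ContDiff ℝ 5 φ)
    (hb₁ : 0 < b₁) (hpos : ∀ u, 0 ≤ iteratedDeriv 2 φ u)
    (hb : ∀ u, |u| ≤ 2 * K * R → b₁ ≤ iteratedDeriv 2 φ u)
    (h2 : ∀ u, |iteratedDeriv 2 φ u| ≤ M) (h3 : ∀ u, |iteratedDeriv 3 φ u| ≤ B)
    (h4 : ∀ u, |iteratedDeriv 4 φ u| ≤ M)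
    (hν : subGaussianNorm ν ≤ ENNReal.ofReal K) (hS : IsSpiked (r : ℕ) σ (secondMoment ν))
    (hη : η ≤ b₁ / 4) (hδ1 : 3 * δ ≤ 1) (hδσ : 3 * δ ≤ σ ^ 2 / 2)
    (hηδ : (1 + 2 * K ^ 2 * R ^ 2) * η + M * R ^ 2 * (3 * δ) ≤ ξ / 2)
    {y : Fin n → ℝ} {β βs : Vec p} (hβ : ‖β‖ ≤ R) (hgood : GoodIterate φ R ξ ν X y βs β) :
    ‖step φ R r X y S β - βs‖ ≤
      (b₁ / 4)⁻¹ * ((σ ^ 2 / 2)⁻¹ + M * R ^ 2 / (ξ / 2)) *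
        ((gaussDiscrepancy φ R ν
          + ((2 * K ^ 2 + 4 * K ^ 4 * R ^ 2 + 2) * η + (M + M * R ^ 2 * (4 * K ^ 2 + 1)) * (3 * δ))
          + B * ((2 * K ^ 2 + C₀ + C₄) * p) * ‖β - βs‖) * ‖β - βs‖) := by
  obtain ⟨hD, hmin, hβs⟩ := hgood
  have hM0 : 0 ≤ M := (abs_nonneg _).trans (h2 0)
  have hη0 : 0 ≤ η := (abs_nonneg _).trans (hG.muHat_two β hβ)
  have hδ0 : 0 ≤ δ := (norm_nonneg _).trans hG.cov
  set A := secondMoment ν with hA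
  set TA := toEuclideanCLM (𝕜 := ℝ) A with hTA
  have hTAn : ‖TA‖ ≤ 2 * K ^ 2 := norm_secondMoment_le hK.le hν
  set Z := eigThreshold (isHermitian_sampleCov X S) r with hZ
  set TZ := toEuclideanCLM (𝕜 := ℝ) Z with hTZ
  have hZA : ‖TZ - TA‖ ≤ 3 * δ := norm_eigThreshold_sub_le _ r hS hG.cov
  have hTZn : ‖TZ‖ ≤ 2 * K ^ 2 + 1 := by
    have := norm_add_le (TZ - TA) TA
    rw [sub_add_cancel] at this
    linarith
  have hcoer : ∀ v : Vec p, σ ^ 2 / 2 * ‖v‖ ^ 2 ≤ ⟪TZ v, v⟫ := fun v => by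
    have h1 := le_quadratic_of_spiked hS v
    have h2 := (abs_le.1 (abs_quadratic_le (TZ - TA) v)).1
    rw [_root_.sub_apply, inner_sub_left] at h2
    have h3 : ‖TZ - TA‖ * ‖v‖ ^ 2 ≤ σ ^ 2 / 2 * ‖v‖ ^ 2 := by
      gcongr; exact hZA.trans hδσ
    linarith
  set m₂ := muHat φ X 2 β with hm₂
  set m₄ := muHat φ X 4 β with hm₄
  have e2 := hG.muHat_two β hβ
  have e4 := hG.muHat_four β hβ
  rw [← hm₂] at e2
  rw [← hm₄] at e4
  have hmu2 := le_muPop_two hK hR hν hφ hpos hb₁.le hb h2 hβ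
  have hm₂b : b₁ / 4 ≤ m₂ := by linarith [(abs_le.1 e2).1]
  have hm₂M : |m₂| ≤ M := abs_muHat_le hn h2 X β
  have hm₄M : |m₄| ≤ M := abs_muHat_le hn h4 X β
  have hquadZA : ∀ v : Vec p, |⟪TZ v, v⟫ - ⟪TA v, v⟫| ≤ 3 * δ * ‖v‖ ^ 2 := fun v => by
    have := abs_quadratic_le (TZ - TA) v
    rw [_root_.sub_apply, inner_sub_left] at this
    exact this.trans (by gcongr)
  have hquadA : ∀ v : Vec p, |⟪TA v, v⟫| ≤ 2 * K ^ 2 * ‖v‖ ^ 2 := fun v =>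
    (abs_quadratic_le TA v).trans (by gcongr)
  -- The event bounds the population denominator by ξ from below; the smallness assumption on η and
  -- δ lets the sample version lose at most half.
  have hDen : ξ / 2 ≤ |m₂ + m₄ * ⟪TZ β, β⟫| := by
    have e : muPop φ ν 2 β + muPop φ ν 4 β * ⟪TA β, β⟫
        = (m₂ + m₄ * ⟪TZ β, β⟫) + (-(m₂ - muPop φ ν 2 β) + (-(m₄ - muPop φ ν 4 β)) * ⟪TA β, β⟫
          + (-m₄) * (⟪TZ β, β⟫ - ⟪TA β, β⟫)) := by ring
    have hD' := hD
    rw [e] at hD'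
    have t1 := abs_add_le (m₂ + m₄ * ⟪TZ β, β⟫) (-(m₂ - muPop φ ν 2 β)
      + (-(m₄ - muPop φ ν 4 β)) * ⟪TA β, β⟫ + (-m₄) * (⟪TZ β, β⟫ - ⟪TA β, β⟫))
    have t2 := abs_add_three (-(m₂ - muPop φ ν 2 β)) ((-(m₄ - muPop φ ν 4 β)) * ⟪TA β, β⟫)
      ((-m₄) * (⟪TZ β, β⟫ - ⟪TA β, β⟫))
    rw [abs_mul, abs_mul, abs_neg, abs_neg, abs_neg] at t2
    have t3 : |m₄ - muPop φ ν 4 β| * |⟪TA β, β⟫| ≤ η * (2 * K ^ 2 * R ^ 2) := by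
      gcongr
      exact (hquadA β).trans (by gcongr)
    have t4 : |m₄| * |⟪TZ β, β⟫ - ⟪TA β, β⟫| ≤ M * (3 * δ * R ^ 2) := by
      gcongr
      exact (hquadZA β).trans (by gcongr)
    linarith
  have hτ : 0 ≤ gaussDiscrepancy φ R ν
      + ((2 * K ^ 2 + 4 * K ^ 4 * R ^ 2 + 2) * η
        + (M + M * R ^ 2 * (4 * K ^ 2 + 1)) * (3 * δ)) := by
    have := gaussDiscrepancy_nonneg φ R ν
    positivity
  refine NewtonStein.norm_step_sub_le hφ h3 r X y S hβ hβs hmin hZ (by positivity) hcoer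
    (by positivity) hm₂b hm₄M (by positivity) hDen hτ ?_ ?_
  · intro u hu
    have s1 := abs_stein_sub_le hK hν hσ hS hφ h2 h3 h4 hβ hu
    have s2 := hG.hessian β hβ u hu
    have a1 : |⟪TA β, u⟫| ≤ 2 * K ^ 2 * R := by
      refine (abs_real_inner_le_norm _ _).trans ?_
      rw [hu, mul_one]
      exact (TA.le_opNorm β).trans (by gcongr)
    have a2 : |⟪TZ β, u⟫| ≤ (2 * K ^ 2 + 1) * R := by
      refine (abs_real_inner_le_norm _ _).trans ?_
      rw [hu, mul_one]
      exact (TZ.le_opNorm β).trans (by gcongr)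
    have a3 : |⟪TZ β, u⟫ - ⟪TA β, u⟫| ≤ 3 * δ * R := by
      rw [← inner_sub_left, ← _root_.sub_apply]
      refine (abs_real_inner_le_norm _ _).trans ?_
      rw [hu, mul_one]
      exact ((TZ - TA).le_opNorm β).trans (by gcongr)
    have b1 : |(m₂ - muPop φ ν 2 β) * ⟪TA u, u⟫| ≤ η * (2 * K ^ 2) := by
      rw [abs_mul]
      gcongr
      simpa [hu] using hquadA u
    have b2 : |m₂ * (⟪TZ u, u⟫ - ⟪TA u, u⟫)| ≤ M * (3 * δ) := by
      rw [abs_mul]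
      gcongr
      simpa [hu] using hquadZA u
    have b3 : |(m₄ - muPop φ ν 4 β) * ⟪TA β, u⟫ ^ 2| ≤ η * (2 * K ^ 2 * R) ^ 2 := by
      rw [abs_mul, abs_pow]
      gcongr
    have b4 : |m₄ * ((⟪TZ β, u⟫ - ⟪TA β, u⟫) * (⟪TZ β, u⟫ + ⟪TA β, u⟫))|
        ≤ M * (3 * δ * R * ((2 * K ^ 2 + 1) * R + 2 * K ^ 2 * R)) := by
      rw [abs_mul, abs_mul]
      gcongr
      exact (abs_add_le _ _).trans (add_le_add a2 a1)
    -- The sample quantities are exchanged for population ones one at a time; what remains is the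
    -- Stein error and the Hessian deviation.
    have e : m₂ * ⟪TZ u, u⟫ + m₄ * ⟪TZ β, u⟫ ^ 2
        - (n : ℝ)⁻¹ * ∑ i, ⟪u, X i⟫ ^ 2 * iteratedDeriv 2 φ ⟪X i, β⟫
        = (m₂ - muPop φ ν 2 β) * ⟪TA u, u⟫ + m₂ * (⟪TZ u, u⟫ - ⟪TA u, u⟫)
          + (m₄ - muPop φ ν 4 β) * ⟪TA β, u⟫ ^ 2
          + m₄ * ((⟪TZ β, u⟫ - ⟪TA β, u⟫) * (⟪TZ β, u⟫ + ⟪TA β, u⟫))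
          + (muPop φ ν 2 β * ⟪TA u, u⟫ + muPop φ ν 4 β * ⟪TA β, u⟫ ^ 2
            - ∫ z, ⟪u, z⟫ ^ 2 * iteratedDeriv 2 φ ⟪z, β⟫ ∂ν)
          - ((n : ℝ)⁻¹ * ∑ i, ⟪u, X i⟫ ^ 2 * iteratedDeriv 2 φ ⟪X i, β⟫
            - ∫ z, ⟪u, z⟫ ^ 2 * iteratedDeriv 2 φ ⟪z, β⟫ ∂ν) := by ring
    rw [e, abs_le]
    rw [abs_le] at b1 b2 b3 b4 s1 s2
    constructor <;> linarith [b1.1, b1.2, b2.1, b2.2, b3.1, b3.2, b4.1, b4.2, s1.1, s1.2, s2.1, s2.2]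
  · refine third_moment_le hp X (fun u hu => ?_) hG.fourth
    have h1 := (abs_le.1 (abs_quadratic_le (toEuclideanCLM (𝕜 := ℝ) (sampleCov X Finset.univ) - TA)
      u)).2
    have h2' := (abs_le.1 (hquadA u)).2
    rw [_root_.sub_apply, inner_sub_left] at h1
    rw [hu, one_pow, mul_one] at h1 h2'
    have e : ⟪toEuclideanCLM (𝕜 := ℝ) (sampleCov X Finset.univ) u, u⟫
        = (n : ℝ)⁻¹ * ∑ i, ⟪X i, u⟫ ^ 2 := by
      simp only [sampleCov, map_smul, map_sum, _root_.smul_apply, _root_.sum_apply,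
        toEuclideanCLM_vecMulVec, inner_smul_left, sum_inner, conj_trivial, Finset.card_univ,
        Fintype.card_fin, sq]
    rw [e] at h1
    linarith [hG.cov_univ]

/-! ### Probability of the good event -/

section Probability

variable {p : ℕ} {ν : Measure (Vec p)} [IsProbabilityMeasure ν] {K : ℝ}
  {Ω : Type*} [MeasurableSpace Ω] {P : Measure Ω} [IsProbabilityMeasure P]
  {n : ℕ} {x : Fin n → Ω → Vec p}

/-- The good event has overwhelming probability. -/
lemma goodSample_probability (hK : 0 < K) (hν : subGaussianNorm ν ≤ ENNReal.ofReal K)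
    (hx : ∀ i, Measurable (x i)) (hind : iIndepFun x P) (hlaw : ∀ i, P.map (x i) = ν)
    {S : Ω → Finset (Fin n)} (hS : Measurable S) {s : ℕ} (hs : 0 < s) (hcard : ∀ ω, (S ω).card = s)
    (hSi : IndepFun (fun ω i => x i ω) S P) {φ : ℝ → ℝ} (hφ : ContDiff ℝ 5 φ) {M B R : ℝ}
    (hM : 1 ≤ M) (hR : 0 < R)
    (h2 : ∀ u, |iteratedDeriv 2 φ u| ≤ M) (h3 : ∀ u, |iteratedDeriv 3 φ u| ≤ B)
    (h4 : ∀ u, |iteratedDeriv 4 φ u| ≤ M) (h5 : ∀ u, |iteratedDeriv 5 φ u| ≤ B)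
    {N : ℝ} (hN : 1 ≤ N) (hn : (n : ℝ) = N ^ 5) (hps : p ≤ s) (hpn : p ≤ n)
    (c1 : 9 ^ p * (1 + 2 * R * n) ^ p *
      Real.exp (-(n * (1 / (24 * (K ^ 2 + 1) * M)) ^ 2 * (1 / (2 * N)) ^ 2 / 16)) ≤ Real.exp (-p))
    (c2 : 4 * B * (1 / n) * (1 + 3 * (16 * K ^ 4 + 1) * p ^ 2) ≤ 1 / (2 * N))
    (c3 : p * (Real.exp (-N) + n * Real.exp (1 - N ^ 2 / (12 * K ^ 2))) ≤ 2 * Real.exp (-p)) :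
    P.real {ω | ¬ GoodSample φ R ν (fun i => x i ω) (S ω) (1 / N)
        (384 * (K ^ 2 + 1) * √(p / s)) (384 * (K ^ 2 + 1)) (3 * (16 * K ^ 4 + 1))}
      ≤ 12 * Real.exp (-p) := by
  have hN0 : 0 < N := by linarith
  have hM0 : 0 < M := by linarith
  have hB0 : 0 ≤ B := (abs_nonneg _).trans (h3 0)
  have hnpos : (0 : ℝ) < n := by rw [hn]; positivity
  have hn0 : 0 < n := by exact_mod_cast hnpos
  have hs0 : (0 : ℝ) < s := by exact_mod_cast hs
  have hlog9 : (9 : ℝ) ^ p * Real.exp (-(4 * p)) ≤ Real.exp (-p) := by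
    have h9 : (9 : ℝ) ≤ Real.exp 3 := by
      have h27 : (2.7 : ℝ) ^ 3 ≤ Real.exp 1 ^ 3 := by
        gcongr
        linarith [Real.exp_one_gt_d9]
      rw [← Real.exp_nat_mul] at h27
      norm_num at h27
      linarith
    calc (9 : ℝ) ^ p * Real.exp (-(4 * p)) ≤ Real.exp 3 ^ p * Real.exp (-(4 * p)) := by gcongr
      _ = Real.exp (-p) := by rw [← Real.exp_nat_mul, ← Real.exp_add]; ring_nf
  -- covariance of the subsample
  have p1 : P.real {ω | ¬ ‖toEuclideanCLM (𝕜 := ℝ) (sampleCov (fun i => x i ω) (S ω))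
      - toEuclideanCLM (𝕜 := ℝ) (secondMoment ν)‖ ≤ 384 * (K ^ 2 + 1) * √(p / s)}
      ≤ 2 * Real.exp (-p) := by
    have hsq : √((p : ℝ) / s) ≤ 1 := by
      rw [Real.sqrt_le_one, div_le_one hs0]
      exact_mod_cast hps
    -- This t makes the Bernstein exponent exactly 4p, which beats the net size 9^p ≤ e^{3p} and
    -- leaves e^{-p}.
    have h := sampleCov_concentration hK hν hx hind hlaw hS hs hcard hSi
      (t := 192 * (K ^ 2 + 1) * √(p / s)) (by positivity) (by
        rw [div_div_eq_mul_div, div_one]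
        nlinarith [sq_nonneg K])
    rw [← mul_assoc, ← mul_assoc] at h
    norm_num only at h
    refine h.trans ?_
    have e : (s : ℝ) * (1 / (24 * (K ^ 2 + 1) * 1)) ^ 2 * (192 * (K ^ 2 + 1) * √(p / s)) ^ 2 / 16
        = 4 * p := by
      rw [mul_pow _ √_, Real.sq_sqrt (by positivity)]
      field_simp
      ring
    rw [e]
    linarith
  have p2 : P.real {ω | ¬ ‖toEuclideanCLM (𝕜 := ℝ) (sampleCov (fun i => x i ω) Finset.univ)
      - toEuclideanCLM (𝕜 := ℝ) (secondMoment ν)‖ ≤ 384 * (K ^ 2 + 1)}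
      ≤ 2 * Real.exp (-p) := by
    -- The full sample is only needed to bound second moments, so a constant deviation suffices; the
    -- exponent 4n is at least 4p.
    have h := sampleCov_concentration hK hν hx hind hlaw (S := fun _ => Finset.univ)
      measurable_const (s := n) hn0 (by simp) (indepFun_const_right _ _)
      (t := 192 * (K ^ 2 + 1)) (by positivity) (by
        rw [div_div_eq_mul_div, div_one]
        nlinarith [sq_nonneg K])
    rw [← mul_assoc] at h
    norm_num only at h
    refine h.trans ?_
    have e : (n : ℝ) * (1 / (24 * (K ^ 2 + 1) * 1)) ^ 2 * (192 * (K ^ 2 + 1)) ^ 2 / 16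
        = 4 * n := by
      field_simp
      ring
    rw [e]
    have : Real.exp (-(4 * (n : ℝ))) ≤ Real.exp (-(4 * p)) := by
      gcongr
    have := mul_le_mul_of_nonneg_left this (by positivity : (0 : ℝ) ≤ 9 ^ p)
    linarith
  -- fourth moments
  have p3 := (fourth_moment_norm hK hν hx hind hlaw hN hn).trans c3
  obtain ⟨hAi, hA⟩ := integral_norm_pow_four_le hK.le hν
  have hA' : ∫ z, ‖z‖ ^ 4 ∂ν ≤ 3 * (16 * K ^ 4 + 1) * p ^ 2 := by
    refine hA.trans ?_
    exact mul_le_mul_of_nonneg_right (by linarith [pow_pos hK 4]) (sq_nonneg _)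
  set C₄ := 3 * (16 * K ^ 4 + 1)
  set lam := 1 / (24 * (K ^ 2 + 1) * M) with hlam_def
  have hlam : 0 < lam := by positivity
  have ht' : 1 / (2 * N) ≤ 8 / lam := by
    rw [hlam_def, div_div_eq_mul_div, div_one]
    have h1 : 1 / (2 * N) ≤ 1 := by rw [div_le_one (by positivity)]; linarith
    nlinarith [sq_nonneg K, mul_nonneg (sq_nonneg K) hM0.le]
  -- Half of the error 1/N is for the deviation at net points, half for the mesh δ = 1/n.
  have htot : 1 / (2 * N) + 4 * B * (1 / n) * (1 + C₄ * p ^ 2) ≤ 1 / N := by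
    have : 1 / N = 1 / (2 * N) + 1 / (2 * N) := by field_simp; norm_num
    linarith
  have c1' : ∀ W : ℕ, (W : ℝ) ≤ 9 ^ p → W * (1 + 2 * R / (1 / n)) ^ p *
      (2 * Real.exp (-(n * lam ^ 2 * (1 / (2 * N)) ^ 2 / 16))) ≤ 2 * Real.exp (-p) := fun W hW => by
    rw [div_div_eq_mul_div, div_one]
    calc _ ≤ 9 ^ p * (1 + 2 * R * n) ^ p *
          (2 * Real.exp (-(n * lam ^ 2 * (1 / (2 * N)) ^ 2 / 16))) := by gcongr
      _ = 2 * (9 ^ p * (1 + 2 * R * n) ^ p *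
          Real.exp (-(n * lam ^ 2 * (1 / (2 * N)) ^ 2 / 16))) := by ring
      _ ≤ _ := by gcongr
  have lip : ∀ j, j < 5 → (∀ u, |iteratedDeriv (j + 1) φ u| ≤ B) → ∀ a b,
      |iteratedDeriv j φ a - iteratedDeriv j φ b| ≤ B * |a - b| := fun j hj hB =>
    abs_sub_le_of_hasDerivAt (hasDerivAt_iteratedDeriv hφ hj) hB
  have h9 : (((1 : ℕ)) : ℝ) ≤ 9 ^ p := by
    push_cast; exact one_le_pow₀ (by norm_num)
  have hcont2 := continuous_iteratedDeriv hφ (k := 2) (by norm_num)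
  have hcont4 := continuous_iteratedDeriv hφ (k := 4) (by norm_num)
  -- the scalar means
  let F : ℕ → Set Ω := fun j => {ω | (n : ℝ)⁻¹ * ∑ i, ‖x i ω‖ ^ 4 ≤ C₄ * p ^ 2 ∧
    ¬ ∀ k ∈ ({()} : Finset Unit), ∀ β : Vec p, ‖β‖ ≤ R →
      |(n : ℝ)⁻¹ * ∑ i, 1 * iteratedDeriv j φ ⟪x i ω, β⟫ - ∫ z, 1 * iteratedDeriv j φ ⟪z, β⟫ ∂ν|
        ≤ 1 / (2 * N) + 4 * B * (1 / n) * (1 + C₄ * p ^ 2)}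
  have scalar : ∀ j, j < 5 → (∀ u, |iteratedDeriv j φ u| ≤ M) →
      (∀ u, |iteratedDeriv (j + 1) φ u| ≤ B) →
      P.real (F j) ≤ 2 * Real.exp (-p) :=
    fun j hj hMj hBj => by
      have hcont := continuous_iteratedDeriv hφ hj.le
      exact (uniform_deviation hx hind hlaw hn0 ({()} : Finset Unit) (w := fun _ _ => 1)
        (fun _ _ z => by simp) hB0 (lip j hj hBj) hR.le
        (by positivity : (0 : ℝ) < 1 / n) hlam (by positivity) ht'
        (fun _ _ β => hasExpMoment_bdd K hM0 (g := fun z => iteratedDeriv j φ ⟪z, β⟫)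
          (by fun_prop) fun z => hMj _) hAi hA').trans (c1' 1 h9)
  have p4 := scalar 2 (by norm_num) h2 h3
  have p5 := scalar 4 (by norm_num) h4 h5
  -- the Hessian
  obtain ⟨V, hV1, hV2, hV3⟩ := unit_ball_net p
  let H : Set Ω := {ω | (n : ℝ)⁻¹ * ∑ i, ‖x i ω‖ ^ 4 ≤ C₄ * p ^ 2 ∧
    ¬ ∀ v ∈ V, ∀ β : Vec p, ‖β‖ ≤ R →
      |(n : ℝ)⁻¹ * ∑ i, ⟪v, x i ω⟫ ^ 2 * iteratedDeriv 2 φ ⟪x i ω, β⟫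
        - ∫ z, ⟪v, z⟫ ^ 2 * iteratedDeriv 2 φ ⟪z, β⟫ ∂ν|
        ≤ 1 / (2 * N) + 4 * B * (1 / n) * (1 + C₄ * p ^ 2)}
  have p6 : P.real H ≤ 2 * Real.exp (-p) := (uniform_deviation hx hind hlaw hn0 V (w := fun v z => ⟪v, z⟫ ^ 2)
    (fun v hv z => by
      rw [abs_of_nonneg (sq_nonneg _), ← sq_abs]
      have h1 : |⟪v, z⟫| ≤ ‖z‖ := by
        refine (abs_real_inner_le_norm _ _).trans ?_
        nlinarith [hV1 v hv, norm_nonneg z]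
      have h2 : |⟪v, z⟫| ^ 2 ≤ ‖z‖ ^ 2 := by gcongr
      linarith) hB0 (lip 2 (by norm_num) h3) hR.le
    (by positivity : (0 : ℝ) < 1 / n) hlam (by positivity) ht'
    (fun v hv β => hasExpMoment_sq hK hν hM0 (hV1 v hv) (g := fun z => iteratedDeriv 2 φ ⟪z, β⟫)
      (by fun_prop) fun z => h2 _) hAi hA').trans (c1' _ hV3)
  -- Six failure events, each of probability at most 2 e^{-p}. The last three include the
  -- fourth-moment bound, whose failure is already the third.
  have hsub : {ω | ¬ GoodSample φ R ν (fun i => x i ω) (S ω) (1 / N)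
        (384 * (K ^ 2 + 1) * √(p / s)) (384 * (K ^ 2 + 1)) C₄} ⊆
      ((((({ω | ¬ ‖toEuclideanCLM (𝕜 := ℝ) (sampleCov (fun i => x i ω) (S ω))
          - toEuclideanCLM (𝕜 := ℝ) (secondMoment ν)‖ ≤ 384 * (K ^ 2 + 1) * √(p / s)} ∪
      {ω | ¬ ‖toEuclideanCLM (𝕜 := ℝ) (sampleCov (fun i => x i ω) Finset.univ)
          - toEuclideanCLM (𝕜 := ℝ) (secondMoment ν)‖ ≤ 384 * (K ^ 2 + 1)}) ∪
      {ω | ¬ (n : ℝ)⁻¹ * ∑ i, ‖x i ω‖ ^ 4 ≤ C₄ * p ^ 2}) ∪ F 2) ∪ F 4) ∪ H) := by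
    intro ω hω
    by_contra hcon
    simp only [Set.mem_union, not_or] at hcon
    obtain ⟨⟨⟨⟨⟨q1, q2⟩, q3⟩, q4⟩, q5⟩, q6⟩ := hcon
    have q1 := not_not.1 q1
    have q2 := not_not.1 q2
    have q3 := not_not.1 q3
    have q4 := not_not.1 fun h => q4 ⟨q3, h⟩
    have q5 := not_not.1 fun h => q5 ⟨q3, h⟩
    have q6 := not_not.1 fun h => q6 ⟨q3, h⟩
    refine hω ⟨q1, q2, q3, fun β hβ => ?_, fun β hβ => ?_, fun β hβ u hu => ?_⟩
    · have := (q4 () (by simp) β hβ).trans htot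
      simp only [one_mul] at this
      exact this
    · have := (q5 () (by simp) β hβ).trans htot
      simp only [one_mul] at this
      exact this
    -- Passing from the directions in V to all unit vectors doubles the error, hence 2η in the
    -- Hessian bound.
    · have hop : ‖devOp ν (fun z => iteratedDeriv 2 φ ⟪z, β⟫) (fun i => x i ω) Finset.univ‖
          ≤ 2 * (1 / N) := by
        refine opNorm_le_of_net (devOp_symm _ _ _) (by positivity) (N := (V : Set (Vec p))) hV1 hV2
          fun w hw => ?_
        rw [inner_devOp hK.le hν (by fun_prop) (fun z => h2 _), Finset.card_univ, Fintype.card_fin]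
        exact (q6 w hw β hβ).trans htot
      have h1 := abs_quadratic_le
        (devOp ν (fun z => iteratedDeriv 2 φ ⟪z, β⟫) (fun i => x i ω) Finset.univ) u
      rw [inner_devOp hK.le hν (by fun_prop) (fun z => h2 _), Finset.card_univ, Fintype.card_fin,
        hu, one_pow, mul_one] at h1
      exact h1.trans hop
  have hm := measureReal_mono (μ := P) hsub (measure_ne_top _ _)
  refine hm.trans ?_
  refine (measureReal_union_le _ _).trans ?_
  have u1 := measureReal_union_le (μ := P) {ω | ¬ ‖toEuclideanCLM (𝕜 := ℝ)
      (sampleCov (fun i => x i ω) (S ω)) - toEuclideanCLM (𝕜 := ℝ) (secondMoment ν)‖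
        ≤ 384 * (K ^ 2 + 1) * √(p / s)}
    {ω | ¬ ‖toEuclideanCLM (𝕜 := ℝ) (sampleCov (fun i => x i ω) Finset.univ)
          - toEuclideanCLM (𝕜 := ℝ) (secondMoment ν)‖ ≤ 384 * (K ^ 2 + 1)}
  have := add_le_add ((measureReal_union_le _ _).trans (add_le_add
    ((measureReal_union_le _ _).trans (add_le_add ((measureReal_union_le _ _).trans
      (add_le_add (u1.trans (add_le_add p1 p2)) p3)) p4)) p5)) p6
  linarith

end Probability

/-! ### Sample size -/

section SampleSize

variable {p n : ℕ} {K R M B a N : ℝ}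

/-- The nets, together with e^p, have size at most e^{2 p log n}, and p log n ≤ N/a, while a
deviation 1/(2N) has Bernstein exponent of order n/N² = N³. -/
lemma net_size_mul_exp_le (hR : 0 < R) (hM : 1 ≤ M) (ha : 0 < a) (hN : 1 ≤ N)
    (hn : (n : ℝ) = N ^ 5) (hap : a * p * Real.log n ≤ N) (hnR : 27 * (1 + 2 * R) ≤ n)
    (h1 : 128 * (24 * (K ^ 2 + 1) * M) ^ 2 / a ≤ N) :
    9 ^ p * (1 + 2 * R * n) ^ p *
      Real.exp (-(n * (1 / (24 * (K ^ 2 + 1) * M)) ^ 2 * (1 / (2 * N)) ^ 2 / 16))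
        ≤ Real.exp (-p) := by
  have hN0 : 0 < N := by linarith
  have hn0 : (0 : ℝ) < n := by rw [hn]; positivity
  have hn1 : (1 : ℝ) ≤ n := by rw [hn]; exact one_le_pow₀ hN
  have hbase : 9 * (1 + 2 * R * n) * Real.exp 1 ≤ (n : ℝ) ^ 2 := by
    have h3 : Real.exp 1 ≤ 3 := by linarith [Real.exp_one_lt_d9]
    calc 9 * (1 + 2 * R * n) * Real.exp 1 ≤ 9 * (n + 2 * R * n) * 3 := by gcongr
      _ = 27 * (1 + 2 * R) * n := by ring
      _ ≤ n * n := by gcongr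
      _ = (n : ℝ) ^ 2 := by ring
  have hpow : 9 ^ p * (1 + 2 * R * n) ^ p * Real.exp p ≤ Real.exp (2 * p * Real.log n) := by
    have e : Real.exp (2 * p * Real.log n) = ((n : ℝ) ^ 2) ^ p := by
      rw [← pow_mul, ← Real.exp_log hn0, ← Real.exp_nat_mul, Real.log_exp]
      push_cast
      rfl
    have e' : Real.exp p = Real.exp 1 ^ p := by rw [← Real.exp_nat_mul, mul_one]
    rw [e, e', ← mul_pow, ← mul_pow]
    gcongr
  set D := 24 * (K ^ 2 + 1) * M with hD
  have hD0 : 0 < D := by positivity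
  have hexp : 2 * p * Real.log n ≤ n * (1 / D) ^ 2 * (1 / (2 * N)) ^ 2 / 16 := by
    have e : n * (1 / D) ^ 2 * (1 / (2 * N)) ^ 2 / 16 = N ^ 3 / (64 * D ^ 2) := by
      rw [hn]; field_simp; ring
    rw [e, le_div_iff₀ (by positivity)]
    rw [div_le_iff₀ ha] at h1
    have h2 : a * (2 * p * Real.log n * (64 * D ^ 2)) ≤ a * N ^ 3 := by
      calc a * (2 * p * Real.log n * (64 * D ^ 2)) = a * p * Real.log n * (128 * D ^ 2) := by ring
        _ ≤ N * (N * a) := by gcongr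
        _ ≤ N * (N * a) * N := le_mul_of_one_le_right (by positivity) hN
        _ = a * N ^ 3 := by ring
    exact le_of_mul_le_mul_left h2 ha
  have h3 := hpow.trans (Real.exp_le_exp.2 hexp)
  rw [Real.exp_neg, Real.exp_neg, ← div_eq_mul_inv, div_le_iff₀ (Real.exp_pos _),
    inv_mul_eq_div, le_div_iff₀ (Real.exp_pos _)]
  exact h3

/-- The mesh is N⁻⁵ and p² ≤ N²/a², so the error is of order N⁻³; a lower bound on N absorbs the
constant. -/
lemma net_error_le (hB : 0 ≤ B) (ha : 0 < a) (hN : 1 ≤ N) (hn : (n : ℝ) = N ^ 5)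
    (hap : a * p ≤ N) (h2 : 8 * B * (1 + 3 * (16 * K ^ 4 + 1) / a ^ 2) ≤ N) :
    4 * B * (1 / n) * (1 + 3 * (16 * K ^ 4 + 1) * p ^ 2) ≤ 1 / (2 * N) := by
  have hN0 : 0 < N := by linarith
  have hp : (p : ℝ) ≤ N / a := by rw [le_div_iff₀ ha]; linarith
  have hp2 : (p : ℝ) ^ 2 ≤ N ^ 2 / a ^ 2 := by rw [← div_pow]; gcongr
  rw [hn, le_div_iff₀ (by positivity)]
  calc 4 * B * (1 / N ^ 5) * (1 + 3 * (16 * K ^ 4 + 1) * p ^ 2) * (2 * N)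
      ≤ 4 * B * (1 / N ^ 5) * (N ^ 2 + 3 * (16 * K ^ 4 + 1) * (N ^ 2 / a ^ 2)) * (2 * N) := by
        gcongr
        exact one_le_pow₀ hN
    _ = 8 * B * (1 + 3 * (16 * K ^ 4 + 1) / a ^ 2) * (1 / N ^ 2) := by field_simp; ring
    _ ≤ N ^ 2 * (1 / N ^ 2) := by
        gcongr
        nlinarith
    _ = 1 := by field_simp

/-- With p ≤ e^p, the first term needs 2p ≤ N. In the second, N²/(12K²) ≥ 2N + N/a outweighs 2p, the
1 and log n. -/
lemma truncation_le (hK : 0 < K) (ha : 0 < a) (hN : 1 ≤ N) (hn : (n : ℝ) = N ^ 5)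
    (hpN : 2 * (p : ℝ) ≤ N) (hL : a * Real.log n ≤ N) (h3 : 12 * K ^ 2 * (2 + 1 / a) ≤ N) :
    p * (Real.exp (-N) + n * Real.exp (1 - N ^ 2 / (12 * K ^ 2))) ≤ 2 * Real.exp (-p) := by
  have hN0 : 0 < N := by linarith
  have hn0 : (0 : ℝ) < n := by rw [hn]; positivity
  have hp : (p : ℝ) ≤ Real.exp p := by linarith [Real.add_one_le_exp (p : ℝ)]
  have t1 : p * Real.exp (-N) ≤ Real.exp (-p) := by
    calc p * Real.exp (-N) ≤ Real.exp p * Real.exp (-N) := by gcongr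
      _ = Real.exp (p - N) := by rw [← Real.exp_add, sub_eq_add_neg]
      _ ≤ Real.exp (-p) := by gcongr; linarith
  have hL' : Real.log n ≤ N / a := by rw [le_div_iff₀ ha]; linarith
  have hsq : N * (2 + 1 / a) ≤ N ^ 2 / (12 * K ^ 2) := by
    rw [le_div_iff₀ (by positivity)]
    calc N * (2 + 1 / a) * (12 * K ^ 2) = N * (12 * K ^ 2 * (2 + 1 / a)) := by ring
      _ ≤ N * N := by gcongr
      _ = N ^ 2 := by ring
  have e : N * (2 + 1 / a) = 2 * N + N / a := by ring
  have t2 : p * (n * Real.exp (1 - N ^ 2 / (12 * K ^ 2))) ≤ Real.exp (-p) := by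
    calc p * (n * Real.exp (1 - N ^ 2 / (12 * K ^ 2)))
        ≤ Real.exp p * (Real.exp (Real.log n) * Real.exp (1 - N ^ 2 / (12 * K ^ 2))) := by
          rw [Real.exp_log hn0]; gcongr
      _ = Real.exp (p + (Real.log n + (1 - N ^ 2 / (12 * K ^ 2)))) := by
          rw [← Real.exp_add, ← Real.exp_add]
      _ ≤ Real.exp (-p) := by gcongr; linarith
  linarith

end SampleSize

/-- A lower bound for a conditional probability, without measurability of the events. -/
lemma one_sub_div_le_cond_real {Ω : Type*} [MeasurableSpace Ω] {P : Measure Ω}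
    [IsProbabilityMeasure P] {E A G : Set Ω} {q ε : ℝ} (hq : 0 < q) (hE : q ≤ P.real E)
    (hG : P.real G ≤ ε) (hsub : ∀ ω ∈ E, ω ∉ G → ω ∈ A) :
    1 - ε / q ≤ (ProbabilityTheory.cond P E).real A := by
  have hE0 : 0 < P.real E := hq.trans_le hE
  have hε : 0 ≤ ε := measureReal_nonneg.trans hG
  have h1 : P.real E ≤ P.real (A ∩ E) + P.real G := by
    refine (measureReal_mono (fun ω hω => ?_) (measure_ne_top _ _)).trans (measureReal_union_le _ _)
    by_cases h : ω ∈ G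
    · exact Or.inr h
    · exact Or.inl ⟨hsub ω hω h, hω⟩
  -- This direction for restricted measures holds for arbitrary sets, so neither event has to be
  -- shown measurable.
  have h2 : P.real (A ∩ E) ≤ (P.restrict E).real A :=
    ENNReal.toReal_mono (measure_ne_top _ _) (Measure.le_restrict_apply _ _)
  have h3 : (ProbabilityTheory.cond P E).real A = (P.real E)⁻¹ * (P.restrict E).real A := by
    rw [ProbabilityTheory.cond, measureReal_ennreal_smul_apply, ENNReal.toReal_inv]
    rfl
  rw [h3]
  calc 1 - ε / q ≤ 1 - ε / P.real E := by gcongr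
    _ = (P.real E)⁻¹ * (P.real E - ε) := by field_simp
    _ ≤ _ := by
      gcongr
      linarith

end NewtonStein

end

/-! ### Choice of constants and conclusion -/

theorem mainTheorem2
    (K σ R ξ q B₂ B₄ : ℝ) (hK : 0 < K) (hσ : 0 < σ) (hR : 0 < R) (hξ : 0 < ξ) (hq : 0 < q)
    (b : ℝ → ℝ) (hb : Continuous b) (hb_pos : ∀ u, 0 < b u) :
    -- constants depend only on the parameters above
    ∃ c₁ c₂ c₃ c₄ κ : ℝ, 0 < c₁ ∧ 0 < c₂ ∧ 0 < c₃ ∧ 0 < c₄ ∧ 0 < κ ∧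
    -- `B` bounds the third and fifth derivatives, `a` is the implicit constant in `≳`
    ∀ B a : ℝ, 0 < a →
    -- "sufficiently large"
    ∃ (p₀ n₀ : ℕ) (s₀ : ℝ), 0 < s₀ ∧
    ∀ p n s : ℕ, p₀ ≤ p → n₀ ≤ n → s₀ * p ≤ s →
      a * p ≤ (n : ℝ) ^ (0.2 : ℝ) / Real.log n →
    ∀ (φ : ℝ → ℝ), ContDiff ℝ 5 φ →
      (∀ u, b u ≤ iteratedDeriv 2 φ u) → (∀ u, |iteratedDeriv 2 φ u| ≤ B₂) →
      (∀ u, |iteratedDeriv 3 φ u| ≤ B) → (∀ u, |iteratedDeriv 4 φ u| ≤ B₄) →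
      (∀ u, |iteratedDeriv 5 φ u| ≤ B) →
    -- the law of the covariates
    ∀ (r : Fin p) (ν : Measure (NewtonStein.Vec p)), IsProbabilityMeasure ν →
      NewtonStein.subGaussianNorm ν ≤ ENNReal.ofReal K →
      ∫ x, x ∂ν = 0 →
      NewtonStein.IsSpiked (r : ℕ) σ (NewtonStein.secondMoment ν) →
    -- the sample, the sub-sample, the starting point and the optimal value
    ∀ (Ω : Type*) (_ : MeasurableSpace Ω) (P : Measure Ω), IsProbabilityMeasure P →
    ∀ (x : Fin n → Ω → NewtonStein.Vec p) (y : Fin n → Ω → ℝ) (S : Ω → Finset (Fin n))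
      (β₀ βs : Ω → NewtonStein.Vec p),
      (∀ i, Measurable (x i)) → iIndepFun x P → (∀ i, P.map (x i) = ν) →
      (∀ i, Measurable (y i)) →
      Measurable S → (∀ ω, (S ω).card = s) → IndepFun (fun ω i => x i ω) S P →
      Measurable β₀ → Measurable βs →
    ∀ t : ℕ, 0 < t →
      let βhat : ℕ → Ω → NewtonStein.Vec p := fun k ω =>
        NewtonStein.iter φ R r (fun i => x i ω) (fun i => y i ω) (S ω) (β₀ ω) k
      let E : Set Ω := {ω | NewtonStein.GoodIterate φ R ξ ν (fun i => x i ω) (fun i => y i ω)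
        (βs ω) (βhat t ω)}
      q ≤ P.real E →
      1 - c₁ * Real.exp (-c₂ * p) ≤
        (ProbabilityTheory.cond P E).real {ω |
          ‖βhat (t + 1) ω - βs ω‖ ≤
            κ * (NewtonStein.gaussDiscrepancy φ R ν
                + c₃ * Real.sqrt (p / min (s : ℝ) ((n : ℝ) ^ (0.2 : ℝ) / Real.log n))
                + c₄ * (p : ℝ) ^ (1.5 : ℝ) * ‖βhat t ω - βs ω‖)
              * ‖βhat t ω - βs ω‖} := by
  obtain ⟨b₁, hb₁, hb₁b⟩ : ∃ b₁ : ℝ, 0 < b₁ ∧ ∀ u, |u| ≤ 2 * K * R → b₁ ≤ b u := by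
    obtain ⟨u₀, -, hu₀⟩ := (isCompact_Icc (a := -(2 * K * R)) (b := 2 * K * R)).exists_isMinOn
      ⟨0, neg_nonpos.2 (by positivity), by positivity⟩ hb.continuousOn
    exact ⟨b u₀, hb_pos u₀, fun u hu => hu₀ (abs_le.1 hu)⟩
  -- A single bound for both derivatives that is at least 1, as B₂ and B₄ may have any sign.
  set M : ℝ := 1 + |B₂| + |B₄| with hM_def
  have hM : 1 ≤ M := by linarith [abs_nonneg B₂, abs_nonneg B₄]
  have hM0 : 0 < M := by linarith
  have hB₂ : B₂ ≤ M := by linarith [le_abs_self B₂, abs_nonneg B₄]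
  have hB₄ : B₄ ≤ M := by linarith [le_abs_self B₄, abs_nonneg B₂]
  set k : ℝ := 3 * (384 * (K ^ 2 + 1)) with hk
  have hk0 : 0 < k := by positivity
  set e₁ : ℝ := 2 * K ^ 2 + 4 * K ^ 4 * R ^ 2 + 2 with he₁
  set e₂ : ℝ := M + M * R ^ 2 * (4 * K ^ 2 + 1) with he₂
  have he₁0 : 0 < e₁ := by positivity
  have he₂0 : 0 < e₂ := by positivity
  set κ : ℝ := (b₁ / 4)⁻¹ * ((σ ^ 2 / 2)⁻¹ + M * R ^ 2 / (ξ / 2)) with hκ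
  have hκ0 : 0 < κ := by positivity
  -- 12 e^{-p} is the failure probability and q the price of conditioning; e₁ and e₂ * k weigh the
  -- errors 1/N and √(p/s).
  refine ⟨12 / q, 1, e₁ + e₂ * k, 1, κ, by positivity, one_pos, by positivity, one_pos, hκ0,
    fun B a ha => ?_⟩
  set T : ℝ := 2 * K ^ 2 + 384 * (K ^ 2 + 1) + 3 * (16 * K ^ 4 + 1) with hT
  have hT0 : 0 < T := by positivity
  -- With s₀ = D², √(p/s) ≤ 1/D. Thus the thresholded covariance error is at most k/D, which is
  -- below 1 and σ²/2 and, after multiplication by M R², below ξ/4.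
  set D : ℝ := 1 + k * (1 + 2 / σ ^ 2 + M * R ^ 2 * 4 / ξ) with hD
  have hD1 : 1 ≤ D := le_add_of_nonneg_right (by positivity)
  have hD0 : 0 < D := by linarith
  have hNlim : Filter.Tendsto (fun n : ℕ => (n : ℝ) ^ (0.2 : ℝ)) Filter.atTop Filter.atTop :=
    (tendsto_rpow_atTop (by norm_num)).comp tendsto_natCast_atTop_atTop
  have hLlim : Filter.Tendsto (fun n : ℕ => Real.log n) Filter.atTop Filter.atTop :=
    Real.tendsto_log_atTop.comp tendsto_natCast_atTop_atTop
  have hev := (((((((hNlim.eventually_ge_atTop 1).and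
    (hNlim.eventually_ge_atTop (128 * (24 * (K ^ 2 + 1) * M) ^ 2 / a))).and
    (hNlim.eventually_ge_atTop (8 * |B| * (1 + 3 * (16 * K ^ 4 + 1) / a ^ 2)))).and
    (hNlim.eventually_ge_atTop (12 * K ^ 2 * (2 + 1 / a)))).and
    ((hNlim.eventually_ge_atTop (4 / b₁)).and
      (hNlim.eventually_ge_atTop ((1 + 2 * K ^ 2 * R ^ 2) * (4 / ξ))))).and
    (tendsto_natCast_atTop_atTop.eventually_ge_atTop (27 * (1 + 2 * R)))).and
    ((hLlim.eventually_ge_atTop 1).and (hLlim.eventually_ge_atTop (2 / a))))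
  obtain ⟨n₀, hn₀⟩ := Filter.eventually_atTop.1 hev
  refine ⟨⌈(|B| * T) ^ 2⌉₊ + 1, n₀, D ^ 2, by positivity, ?_⟩
  intro p n s hp hn hs hap φ hφ hbφ h2 h3 h4 h5 r ν _ hν _ hS Ω _ P _ x y S β₀ βs hx hind hlaw _ hSm
    hcard hSi _ _ t ht βhat E hE
  obtain ⟨⟨⟨⟨⟨⟨hN, hN1⟩, hN2⟩, hN3⟩, hN4, hN5⟩, hnR⟩, hL1, hL2⟩ := hn₀ n hn
  set N : ℝ := (n : ℝ) ^ (0.2 : ℝ) with hN_def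
  set L : ℝ := Real.log n with hL_def
  have hN0 : 0 < N := by linarith
  have hL0 : 0 < L := by linarith
  have hnN : (n : ℝ) = N ^ 5 := by
    rw [hN_def, ← Real.rpow_natCast, ← Real.rpow_mul (by positivity)]
    norm_num
  have hn1 : (1 : ℝ) ≤ n := by rw [hnN]; exact one_le_pow₀ hN
  have hn0 : 0 < n := by exact_mod_cast hn1
  have hp1 : 1 ≤ p := by omega
  have hp1' : (1 : ℝ) ≤ p := by exact_mod_cast hp1
  rw [le_div_iff₀ hL0] at hap
  rw [div_le_iff₀ ha] at hL2
  -- The requirement log n ≥ 2/a turns a p log n ≤ N into 2p ≤ N.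
  have hpN : 2 * (p : ℝ) ≤ N := by
    calc 2 * (p : ℝ) ≤ L * a * p := by gcongr
      _ = a * p * L := by ring
      _ ≤ N := hap
  have haL : a * L ≤ N := by
    calc a * L ≤ a * p * L := by gcongr; exact le_mul_of_one_le_right ha.le hp1'
      _ ≤ N := hap
  have hapN : a * p ≤ N := (le_mul_of_one_le_right (by positivity) hL1).trans hap
  have hpn : p ≤ n := by
    have h1 : N ≤ N ^ 5 := le_self_pow₀ hN (by norm_num)
    have : (p : ℝ) ≤ n := by rw [hnN]; linarith
    exact_mod_cast this
  have hsp : (p : ℝ) ≤ s := (le_mul_of_one_le_left (by positivity) (one_le_pow₀ hD1)).trans hs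
  have hps : p ≤ s := by exact_mod_cast hsp
  have hs0 : 0 < s := by omega
  have hs0' : (0 : ℝ) < s := by exact_mod_cast hs0
  have hB : 0 ≤ B := (abs_nonneg _).trans (h3 0)
  rw [abs_of_nonneg hB] at hN2 hp
  have h2' : ∀ u, |iteratedDeriv 2 φ u| ≤ M := fun u => (h2 u).trans hB₂
  have h4' : ∀ u, |iteratedDeriv 4 φ u| ≤ M := fun u => (h4 u).trans hB₄
  have hprob := NewtonStein.goodSample_probability hK hν hx hind hlaw hSm hs0 hcard hSi hφ hM hR
    h2' h3 h4' h5 hN hnN hps hpn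
    (NewtonStein.net_size_mul_exp_le hR hM ha hN hnN hap hnR hN1)
    (NewtonStein.net_error_le hB ha hN hnN hapN hN2)
    (NewtonStein.truncation_le hK ha hN hnN hpN haL hN3)
  have hsqrt : √((p : ℝ) / s) ≤ 1 / D := by
    rw [Real.sqrt_le_left (by positivity), div_pow, one_pow, div_le_div_iff₀ hs0' (by positivity)]
    linarith
  have hδD : 3 * (384 * (K ^ 2 + 1) * √((p : ℝ) / s)) ≤ k / D := by
    calc 3 * (384 * (K ^ 2 + 1) * √((p : ℝ) / s)) = k * √((p : ℝ) / s) := by rw [hk]; ring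
      _ ≤ k * (1 / D) := by gcongr
      _ = k / D := by ring
  have hDeq : D = 1 + k + k * 2 / σ ^ 2 + k * (M * R ^ 2 * 4) / ξ := by rw [hD]; ring
  have q1 : 0 ≤ k * 2 / σ ^ 2 := by positivity
  have q2 : 0 ≤ k * (M * R ^ 2 * 4) / ξ := by positivity
  have hδ1 : k / D ≤ 1 := by rw [div_le_one hD0]; linarith
  have hδσ : k / D ≤ σ ^ 2 / 2 := by
    rw [div_le_iff₀ hD0]
    calc k = σ ^ 2 / 2 * (k * 2 / σ ^ 2) := by field_simp
      _ ≤ σ ^ 2 / 2 * D := by gcongr; linarith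
  have hδξ : M * R ^ 2 * (k / D) ≤ ξ / 4 := by
    rw [← mul_div_assoc, div_le_iff₀ hD0]
    calc M * R ^ 2 * k = ξ / 4 * (k * (M * R ^ 2 * 4) / ξ) := by field_simp
      _ ≤ ξ / 4 * D := by gcongr; linarith
  have hη : 1 / N ≤ b₁ / 4 := by
    rw [div_le_iff₀ hb₁] at hN4
    rw [div_le_div_iff₀ hN0 (by norm_num)]
    linarith
  have hηξ : (1 + 2 * K ^ 2 * R ^ 2) * (1 / N) ≤ ξ / 4 := by
    rw [← mul_div_assoc, div_le_iff₀ hξ] at hN5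
    rw [mul_one_div, div_le_div_iff₀ hN0 (by norm_num)]
    linarith
  set ε : ℝ := √((p : ℝ) / min (s : ℝ) (N / L)) with hε
  have hmin0 : 0 < min (s : ℝ) (N / L) := lt_min hs0' (by positivity)
  have hεs : √((p : ℝ) / s) ≤ ε := by
    rw [hε]
    gcongr
    exact min_le_left _ _
  have hεN : 1 / N ≤ ε := by
    rw [hε]
    refine Real.le_sqrt_of_sq_le ?_
    calc (1 / N) ^ 2 ≤ 1 / N := by
          rw [div_pow, one_pow]
          gcongr
          exact le_self_pow₀ hN (by norm_num)
      _ ≤ p / (N / L) := by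
          rw [div_div_eq_mul_div]
          gcongr
          exact one_le_mul_of_one_le_of_one_le hp1' hL1
      _ ≤ p / min (s : ℝ) (N / L) := by
          gcongr
          exact min_le_right _ _
  -- The threshold on p gives (B T)² ≤ p; the spare factor √p in p^{1.5} swallows all dependence on
  -- B.
  have hpow : B * (T * p) ≤ (p : ℝ) ^ (1.5 : ℝ) := by
    have e : (p : ℝ) ^ (1.5 : ℝ) = p * √p := by
      rw [Real.sqrt_eq_rpow, ← Real.rpow_one_add' (by positivity) (by norm_num)]
      norm_num
    have h1 : (B * T) ^ 2 ≤ (p : ℝ) := (Nat.le_ceil _).trans (by exact_mod_cast (by omega))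
    have h2 : B * T ≤ √p := Real.le_sqrt_of_sq_le h1
    rw [e]
    calc B * (T * p) = p * (B * T) := by ring
      _ ≤ p * √p := by gcongr
  have hcond := NewtonStein.one_sub_div_le_cond_real (A := {ω |
          ‖βhat (t + 1) ω - βs ω‖ ≤
            κ * (NewtonStein.gaussDiscrepancy φ R ν
                + (e₁ + e₂ * k) * ε
                + 1 * (p : ℝ) ^ (1.5 : ℝ) * ‖βhat t ω - βs ω‖)
              * ‖βhat t ω - βs ω‖}) hq hE hprob fun ω hω hG => ?_
  · refine le_trans (le_of_eq ?_) hcond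
    ring_nf
  · have hG := not_not.1 hG
    -- Here t ≥ 1 matters: the iterate has been projected, so it lies in the ball over which the
    -- good event is uniform, whatever the starting point.
    have hstep := hG.norm_step_sub_le (b₁ := b₁) hn0 hp1 hK hσ hR hξ hφ hb₁
      (fun u => (hb_pos u).le.trans (hbφ u)) (fun u hu => (hb₁b u hu).trans (hbφ u)) h2' h3 h4'
      hν hS hη (hδD.trans hδ1) (hδD.trans hδσ)
      (by linarith [mul_le_mul_of_nonneg_left hδD (by positivity : 0 ≤ M * R ^ 2)])
      (β := βhat t ω) (NewtonStein.norm_iter_le hR.le ht) hω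
    refine hstep.trans ?_
    rw [← hκ, ← he₁, ← he₂, ← hT, mul_assoc κ]
    have g1 : e₁ * (1 / N) ≤ e₁ * ε := by gcongr
    have g2 : e₂ * (3 * (384 * (K ^ 2 + 1) * √((p : ℝ) / s))) ≤ e₂ * (k * ε) := by
      have : 3 * (384 * (K ^ 2 + 1) * √((p : ℝ) / s)) = k * √((p : ℝ) / s) := by rw [hk]; ring
      rw [this]
      gcongr
    have g3 : B * (T * p) * ‖βhat t ω - βs ω‖ ≤ (p : ℝ) ^ (1.5 : ℝ) * ‖βhat t ω - βs ω‖ := by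
      gcongr
    gcongr κ * (?_ * _)
    linarith
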